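/- **Setting.** $\lambda$ is the security parameter, $n(\lambda),m(\lambda)$ are polynomially bounded, and $2^{-n(\lambda)}$ is negligible (i.e. $n=\omega(\log\lambda)$). A non-uniform QPT algorithm is a family of polynomial-size quantum circuits over a fixed universal finite gate set (with measurements, ancillas and partial traces), which may also receive a quantum advice state for each $\lambda$. A *Haar isometry* from $n$ to $n+m$ qubits is $\mathcal I|\psi\rangle=U|\psi\rangle|0^m\rangle$ with $U$ a Haar unitary on $n+m$ qubits. The *inverse* of an isometry $\mathcal I$ is the channel $\mathcal I^{-1}(X)=\mathbb E_U\,\mathrm{Tr}_{\mathsf{Aux}}(U^\dagger XU)$, where $U$ is Haar distributed conditioned on $U|\psi\rangle|0^m\rangle=\mathcal I|\psi\rangle$ for all $|\psi\rangle$, and $\mathsf{Aux}$ denotes the last $m$ qubits. A pair $(F,\mathsf{Inv})$ of polynomial-size circuit families is a *strong invertible adaptive pseudorandom isometry (PRI)* if for every $k\in\{0,1\}^\lambda$ there is an isometry $\mathcal I_k$ from $n$ to $n+m$ qubits with $F(k,\cdot)=\mathcal I_k(\cdot)\mathcal I_k^\dagger$ and $\mathsf{Inv}(k,\cdot)=\mathcal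 I_k^{-1}$, and for every non-uniform QPT oracle distinguisher $\mathcal D$, $$\Big|\Pr_{k\leftarrow\{0,1\}^\lambda}\big[\mathcal D^{F(k,\cdot),\mathsf{Inv}(k,\cdot)}=1\big]-\Pr_{\mathcal I\ \text{Haar}}\big[\mathcal D^{\mathcal I,\mathcal I^{-1}}=1\big]\Big|\le\mathsf{negl}(\lambda).$$ **Game.** Define a MAC for $n$-qubit messages by $\mathsf{Sign}(k,\cdot)=F(k,\cdot)$ and $\mathsf{Ver}(k,\cdot)=\mathsf{Inv}(k,\cdot)$. For $q=q(\lambda)$ queries and $t=t(\lambda)$ copies: (1) a key $k\leftarrow\{0,1\}^\lambda$ is sampled; (2) the adversary sends $n$-qubit pure states $|\psi_1\rangle,\dots,|\psi_q\rangle$ (possibly chosen at random) and receives $\mathsf{Sign}(k,|\psi_i\rangle)$ for $i=1,\dots,q$; (3) it outputs $(|\psi^*\rangle\otimes|\phi^*\rangle)^{\otimes t}$ (possibly random), where $|\psi^*\rangle$ is an $n$-qubit pure state orthogonal to every $|\psi_i\rangle$ and $|\phi^*\rangle$ is an $(n+m)$-qubit pure state; (4) the challenger runs $\mathsf{Ver}(k,\cdot)$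 on each copy of $|\phi^*\rangle$ and a SWAP test between each copy of $|\psi^*\rangle$ and the corresponding result. The adversary wins if all $t$ SWAP tests output $1$; a SWAP test on $\rho\otimes\sigma$ outputs $1$ with probability $(1+\mathrm{Tr}(\rho\sigma))/2$. An adversary must obey these rules for every key $k$. **Lemma (many-copies-unforgeability).** There is an absolute constant $c>0$ such that for all such $n,m$, every strong invertible adaptive PRI $(F,\mathsf{Inv})$, all polynomially bounded $t$ and $q$, and every non-uniform QPT adversary in the game, there is a negligible function $\varepsilon$ such that for all $\lambda$ the adversary wins with probability at most $2^{-c\,t(\lambda)}+\varepsilon(\lambda)$. -/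

import Mathlib

open MeasureTheory Filter Topology Asymptotics
open scoped Matrix ComplexOrder

namespace QCrypto

noncomputable section

/-! ### Qubit registers, states and operators

A register is a finite type `ι` of wires; its computational basis is `ι → Bool`. -/

/-- Bit strings indexed by the wires `ι`. -/
abbrev Bits (ι : Type) : Type := ι → Bool

/-- Operators (in particular density matrices) on the register `ι`. -/
abbrev Op (ι : Type) : Type := Matrix (Bits ι) (Bits ι) ℂ

/-- The all-zero string. -/
def zeros (ι : Type) : Bits ι := fun _ => false

/-- `overwrite e a x` is the string `x` with the wires in the range of `e` set to `a`. -/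
def overwrite {α ι : Type} (e : α ↪ ι) (a : Bits α) (x : Bits ι) : Bits ι :=
  Function.extend e a x

section Registers

variable {α β ι κ : Type} [Fintype α] [DecidableEq α] [Fintype β] [DecidableEq β]
  [Fintype ι] [DecidableEq ι] [Fintype κ] [DecidableEq κ]

/-- Density matrices. -/
def IsDensity (ρ : Op ι) : Prop := ρ.PosSemidef ∧ ρ.trace = 1

/-- Pure states, i.e. unit vectors. -/
def IsKet (ψ : Bits ι → ℂ) : Prop := star ψ ⬝ᵥ ψ = 1

/-- The projector `|ψ⟩⟨ψ|`. -/
def proj (ψ : Bits ι → ℂ) : Op ι := Matrix.vecMulVec ψ (star ψ)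

/-- The reduced state on the wires selected by `e`: all other wires are traced out. -/
def reduced (e : α ↪ ι) (ρ : Op ι) : Op α := Matrix.of fun a b =>
  ∑ z : Bits ι, if z ∘ e = zeros α then ρ (overwrite e a z) (overwrite e b z) else 0

/-- Place a state on the wires selected by `e`, all other wires being `|0⟩`. -/
def inject (e : α ↪ ι) (X : Op α) : Op ι := Matrix.of fun x y =>
  if x = overwrite e (x ∘ e) (zeros ι) ∧ y = overwrite e (y ∘ e) (zeros ι) then
    X (x ∘ e) (y ∘ e)
  else 0

/-- `|k⟩⟨k| ⊗ X`. -/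
def withKey (k : Bits κ) (X : Op α) : Op (κ ⊕ α) := Matrix.of fun x y =>
  if x ∘ Sum.inl = k ∧ y ∘ Sum.inl = k then X (x ∘ Sum.inr) (y ∘ Sum.inr) else 0

/-- `ρ ⊗ |0⟩⟨0|`: adjoin fresh wires `κ` in the zero state. -/
def adjoinZeros (κ : Type) [Fintype κ] [DecidableEq κ] (ρ : Op ι) : Op (ι ⊕ κ) := Matrix.of fun x y =>
  if x ∘ Sum.inr = zeros κ ∧ y ∘ Sum.inr = zeros κ then ρ (x ∘ Sum.inl) (y ∘ Sum.inl) else 0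

/-- Call the channel `Φ` on a larger system.  The wires `e (inl ·)` hold the input, which is
consumed (these wires are reset to `|0⟩`); the output is written to the wires `e (inr ·)`, whose
previous content is discarded.  The remaining wires are untouched. -/
def call (Φ : Op α → Op β) (e : α ⊕ β ↪ ι) (ρ : Op ι) : Op ι := Matrix.of fun x y =>
  if x ∘ e ∘ Sum.inl = zeros α ∧ y ∘ e ∘ Sum.inl = zeros α then
    Φ (Matrix.of fun a b =>
        ∑ c : Bits β, ρ (overwrite e (Sum.elim a c) x) (overwrite e (Sum.elim b c) y))
      (x ∘ e ∘ Sum.inr) (y ∘ e ∘ Sum.inr)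
  else 0

/-- The accepting projector `(1 + SWAP) / 2` of the SWAP test between the registers `e (inl ·)`
and `e (inr ·)`. -/
def swapTestProj (e : α ⊕ α ↪ ι) : Op ι := Matrix.of fun x y =>
  ((if x = y then 1 else 0) + (if x = overwrite e (y ∘ e ∘ Sum.swap) y then 1 else 0)) / 2

end Registers

/-! ### Generalized quantum circuits -/

/-- Elementary operations: the universal discrete gate set `H`, `T`, `CNOT`, `Toffoli`, and the
measurement of one wire in the computational basis. -/
inductive Gate (ι : Type) : Type
  | hadamard (i : ι) : Gate ι
  | phaseT (i : ι) : Gate ι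
  | cnot (i j : ι) (hij : i ≠ j) : Gate ι
  | toffoli (i j l : ι) (hij : i ≠ j) (hil : i ≠ l) (hjl : j ≠ l) : Gate ι
  | measure (i : ι) : Gate ι

section Circuits

variable {α β ι : Type} [Fintype α] [DecidableEq α] [Fintype β] [DecidableEq β]
  [Fintype ι] [DecidableEq ι]

/-- `H` on wire `i`. -/
def hadamardMat (i : ι) : Op ι := Matrix.of fun x y =>
  if ∀ l, l ≠ i → x l = y l then
    (if x i && y i then -1 else 1) / ((Real.sqrt 2 : ℝ) : ℂ)
  else 0

/-- `T = diag(1, exp(iπ/4))` on wire `i`. -/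
def phaseTMat (i : ι) : Op ι :=
  Matrix.diagonal fun x => if x i then Complex.exp (Complex.I * (Real.pi / 4)) else 1

/-- `CNOT` with control `i` and target `j`. -/
def cnotMat (i j : ι) : Op ι := Matrix.of fun x y =>
  if x = Function.update y j (xor (y j) (y i)) then 1 else 0

/-- The Toffoli gate with controls `i`, `j` and target `l`. -/
def toffoliMat (i j l : ι) : Op ι := Matrix.of fun x y =>
  if x = Function.update y l (xor (y l) (y i && y j)) then 1 else 0

/-- Effect of an elementary operation on a state. -/
def Gate.apply : Gate ι → Op ι → Op ι
  | .hadamard i, ρ => hadamardMat i * ρ * (hadamardMat i)ᴴ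
  | .phaseT i, ρ => phaseTMat i * ρ * (phaseTMat i)ᴴ
  | .cnot i j _, ρ => cnotMat i j * ρ * (cnotMat i j)ᴴ
  | .toffoli i j l _ _ _, ρ => toffoliMat i j l * ρ * (toffoliMat i j l)ᴴ
  | .measure i, ρ => Matrix.of fun x y => if x i = y i then ρ x y else 0

/-- Run a list of elementary operations, from left to right. -/
def runGates (C : List (Gate ι)) (ρ : Op ι) : Op ι := C.foldl (fun σ g => g.apply σ) ρ

/-- A generalized quantum circuit with input register `α` and output register `β`: the wires that
are not inputs start in `|0⟩`, the wires that are not outputs are traced out. -/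
structure GenCircuit (α β : Type) where
  width : ℕ
  gates : List (Gate (Fin width))
  input : α ↪ Fin width
  output : β ↪ Fin width

/-- Number of wires plus number of elementary operations. -/
def GenCircuit.size (C : GenCircuit α β) : ℕ := C.width + C.gates.length

/-- The quantum channel implemented by a generalized circuit. -/
def GenCircuit.channel (C : GenCircuit α β) (X : Op α) : Op β :=
  reduced C.output (runGates C.gates (inject C.input X))

end Circuits

/-! ### Asymptotics -/

/-- Functions bounded by a polynomial in the security parameter. -/
def PolyBounded (f : ℕ → ℕ) : Prop := ∃ p : Polynomial ℕ, ∀ l, f l ≤ p.eval l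

/-- Negligible functions: they decay faster than every inverse polynomial. -/
def Negligible (f : ℕ → ℝ) : Prop := SuperpolynomialDecay atTop (fun l : ℕ => (l : ℝ)) f

/-! ### Haar unitaries, Haar isometries and their inverses -/

section Haar

variable {α β : Type} [Fintype α] [DecidableEq α] [Fintype β] [DecidableEq β]

/-- The unitary group of the register `ι`. -/
abbrev UGroup (ι : Type) [Fintype ι] [DecidableEq ι] : Type :=
  ↥(Matrix.unitaryGroup (Bits ι) ℂ)

instance (ι : Type) [Fintype ι] [DecidableEq ι] : CompactSpace (UGroup ι) := by
  have hK : IsCompact (Set.univ.pi fun _ : Bits ι => Set.univ.pi fun _ : Bits ι =>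
      Metric.closedBall (0 : ℂ) 1) :=
    isCompact_univ_pi fun _ => isCompact_univ_pi fun _ => isCompact_closedBall _ _
  have hcl : IsClosed (Matrix.unitaryGroup (Bits ι) ℂ : Set (Op ι)) :=
    isClosed_unitary
  refine isCompact_iff_compactSpace.mp (hK.of_isClosed_subset hcl ?_)
  intro U hU
  simp only [Set.mem_pi, Set.mem_univ, forall_true_left, mem_closedBall_zero_iff]
  intro i j
  exact entry_norm_bound_of_unitary hU i j

instance (ι : Type) [Fintype ι] [DecidableEq ι] : MeasurableSpace (UGroup ι) := borel _

instance (ι : Type) [Fintype ι] [DecidableEq ι] : BorelSpace (UGroup ι) := ⟨rfl⟩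

/-- The Haar probability measure on unitaries. -/
def haarUnitary (ι : Type) [Fintype ι] [DecidableEq ι] : Measure (UGroup ι) :=
  Measure.haarMeasure ⊤

/-- The isometry `|ψ⟩ ↦ |ψ⟩|0⟩` that appends an auxiliary register in the zero state. -/
def appendZeros (α β : Type) [Fintype α] [DecidableEq α] [Fintype β] [DecidableEq β] :
    Matrix (Bits (α ⊕ β)) (Bits α) ℂ := Matrix.of fun z x =>
  if z = Sum.elim x (zeros β) then 1 else 0

/-- Partial trace over the auxiliary register. -/
def traceAux (X : Op (α ⊕ β)) : Op α := Matrix.of fun x y =>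
  ∑ c : Bits β, X (Sum.elim x c) (Sum.elim y c)

/-- Isometries from the register `α` to the register `α ⊕ β`. -/
abbrev Isom (α β : Type) [Fintype α] [DecidableEq α] [Fintype β] [DecidableEq β] : Type :=
  {V : Matrix (Bits (α ⊕ β)) (Bits α) ℂ // Vᴴ * V = 1}

/-- A unitary `U` is consistent with the isometry `V` if `U|ψ⟩|0⟩ = V|ψ⟩` for all `ψ`. -/
def Consistent (V : Isom α β) (U : UGroup (α ⊕ β)) : Prop :=
  (U : Op (α ⊕ β)) * appendZeros α β = V.1

lemma exists_consistent (V : Isom α β) : ∃ U : UGroup (α ⊕ β), Consistent V U := by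
  classical
  obtain ⟨V, hV⟩ := V
  let v : Bits (α ⊕ β) → EuclideanSpace ℂ (Bits (α ⊕ β)) :=
    fun z => WithLp.toLp 2 fun w => V w (z ∘ Sum.inl)
  let s : Set (Bits (α ⊕ β)) := {z | z ∘ Sum.inr = zeros β}
  have hinner : ∀ z z', inner ℂ (v z) (v z') = (Vᴴ * V) (z ∘ Sum.inl) (z' ∘ Sum.inl) := by
    intro z z'
    simp [v, Matrix.mul_apply, PiLp.inner_apply, mul_comm]
  have hs : Orthonormal ℂ (s.domRestrict v) := by
    rw [orthonormal_iff_ite]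
    rintro ⟨z, hz⟩ ⟨z', hz'⟩
    simp only [Set.domRestrict_apply, hinner, hV, Matrix.one_apply, Subtype.mk.injEq]
    have : z ∘ Sum.inl = z' ∘ Sum.inl ↔ z = z' := by
      constructor
      · intro h
        funext i
        rcases i with i | i
        · exact congrFun h i
        · exact congrFun (hz.trans hz'.symm) i
      · rintro rfl
        rfl
    simp [this]
  obtain ⟨b, hb⟩ := hs.exists_orthonormalBasis_extension_of_card_eq (by simp)
  have hU : (Matrix.of fun w z => b z w : Op (α ⊕ β)) ∈ Matrix.unitaryGroup (Bits (α ⊕ β)) ℂ := by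
    rw [Matrix.mem_unitaryGroup_iff']
    ext z z'
    have h := (orthonormal_iff_ite.mp b.orthonormal) z z'
    rw [Matrix.one_apply, ← h, PiLp.inner_apply, Matrix.mul_apply]
    refine Finset.sum_congr rfl fun w _ => ?_
    simp [Matrix.star_apply, mul_comm]
  refine ⟨⟨_, hU⟩, ?_⟩
  ext w x
  have hx : Sum.elim x (zeros β) ∈ s := by
    simp [s]
  simp [appendZeros, Matrix.mul_apply, hb _ hx, v]

/-- The unitaries that fix every state `|ψ⟩|0⟩`. -/
def stabilizerZeros (α β : Type) [Fintype α] [DecidableEq α] [Fintype β] [DecidableEq β] :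
    Subgroup (UGroup (α ⊕ β)) where
  carrier := {W | (W : Op (α ⊕ β)) * appendZeros α β = appendZeros α β}
  one_mem' := by simp
  mul_mem' := by
    intro a b ha hb
    simp only [Set.mem_ofPred_eq, Submonoid.coe_mul] at *
    rw [Matrix.mul_assoc, hb, ha]
  inv_mem' := by
    intro a ha
    simp only [Set.mem_ofPred_eq] at *
    have h : ((a⁻¹ * a : UGroup (α ⊕ β)) : Op (α ⊕ β)) = 1 := by simp
    rw [Submonoid.coe_mul] at h
    calc ((a⁻¹ : UGroup (α ⊕ β)) : Op (α ⊕ β)) * appendZeros α β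
        = ((a⁻¹ : UGroup (α ⊕ β)) : Op (α ⊕ β)) * ((a : Op (α ⊕ β)) * appendZeros α β) := by
          rw [ha]
      _ = appendZeros α β := by rw [← Matrix.mul_assoc, h, Matrix.one_mul]

instance : CompactSpace ↥(stabilizerZeros α β) := by
  have : Continuous fun W : UGroup (α ⊕ β) => (W : Op (α ⊕ β)) * appendZeros α β :=
    continuous_subtype_val.matrix_mul continuous_const
  have hcl : IsClosed (stabilizerZeros α β : Set (UGroup (α ⊕ β))) :=
    isClosed_eq this continuous_const
  exact isCompact_iff_compactSpace.mp hcl.isCompact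

/-- The Haar measure on unitaries conditioned on being consistent with the isometry `V`.  The
consistent unitaries form a coset `U₀ · stabilizerZeros`; the measure is the translate by `U₀` of
the Haar probability measure of the stabilizer (which does not depend on the choice of `U₀`). -/
def condHaar (V : Isom α β) : Measure (UGroup (α ⊕ β)) :=
  Measure.map (fun W : ↥(stabilizerZeros α β) =>
      (exists_consistent V).choose * (W : UGroup (α ⊕ β)))
    (Measure.haarMeasure ⊤)

/-- The inverse of an isometry: the channel `X ↦ 𝔼_U Tr_aux (U† X U)`, where `U` is a Haar unitary
conditioned on being consistent with `V`. -/
def inverseChannel (V : Isom α β) (X : Op (α ⊕ β)) : Op α := Matrix.of fun x y =>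
  ∫ U : UGroup (α ⊕ β), traceAux ((U : Op (α ⊕ β))ᴴ * X * (U : Op (α ⊕ β))) x y ∂(condHaar V)

/-- The channel `X ↦ V X V†` of an isometry. -/
def isomChannel (V : Isom α β) (X : Op α) : Op (α ⊕ β) := V.1 * X * V.1ᴴ

/-- The isometry formed by the first columns of `U`: `|ψ⟩ ↦ U|ψ⟩|0⟩`.  It is a Haar isometry when
`U` is a Haar unitary. -/
def truncate (U : UGroup (α ⊕ β)) : Isom α β :=
  ⟨(U : Op (α ⊕ β)) * appendZeros α β, by
    have hU : (U : Op (α ⊕ β))ᴴ * (U : Op (α ⊕ β)) = 1 := Matrix.mem_unitaryGroup_iff'.mp U.2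
    rw [Matrix.conjTranspose_mul, Matrix.mul_assoc, ← Matrix.mul_assoc _ (U : Op (α ⊕ β)), hU,
      Matrix.one_mul]
    ext x y
    have h : Sum.elim y (zeros β) = Sum.elim x (zeros β) ↔ x = y :=
      ⟨fun h => funext fun i => (congrFun h (Sum.inl i)).symm, fun h => by rw [h]⟩
    simp [appendZeros, Matrix.mul_apply, Matrix.one_apply, h]⟩

end Haar

/-! ### Strong invertible adaptive pseudorandom isometries -/

/-- An operation of an oracle circuit on the wires `ι`, with one oracle from the register `α` to
the register `β` and one from `β` to `α`. -/
inductive OracleOp (α β ι : Type) : Type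
  | gate (g : Gate ι) : OracleOp α β ι
  | forward (e : α ⊕ β ↪ ι) : OracleOp α β ι
  | backward (e : β ⊕ α ↪ ι) : OracleOp α β ι

/-- Effect of an operation of an oracle circuit when the oracles are `Φ` and `Ψ`. -/
def OracleOp.apply {α β ι : Type} [Fintype α] [DecidableEq α] [Fintype β] [DecidableEq β]
    [Fintype ι] [DecidableEq ι] (Φ : Op α → Op β) (Ψ : Op β → Op α) :
    OracleOp α β ι → Op ι → Op ι
  | .gate g, ρ => g.apply ρ
  | .forward e, ρ => call Φ e ρ
  | .backward e, ρ => call Ψ e ρ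

/-- One member of a non-uniform oracle distinguisher: an oracle circuit together with its quantum
advice (the initial state, which also supplies the ancillas) and the wire that holds the output
bit. -/
structure Distinguisher (α β : Type) where
  width : ℕ
  advice : Op (Fin width)
  isDensity : IsDensity advice
  ops : List (OracleOp α β (Fin width))
  out : Fin width

/-- Number of wires plus number of operations; every oracle query counts. -/
def Distinguisher.size {α β : Type} (D : Distinguisher α β) : ℕ := D.width + D.ops.length

/-- Probability that the distinguisher outputs `1` with the oracles `Φ` and `Ψ`. -/
def Distinguisher.acceptProb {α β : Type} [Fintype α] [DecidableEq α] [Fintype β] [DecidableEq β]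
    (D : Distinguisher α β) (Φ : Op α → Op β) (Ψ : Op β → Op α) : ℝ :=
  let σ := D.ops.foldl (fun ρ o => o.apply Φ Ψ ρ) D.advice
  (∑ x : Bits (Fin D.width), if x D.out then σ x x else 0).re

/-- `(F, Inv)` is a strong invertible adaptive pseudorandom isometry from `n` to `n + m` qubits.
The register of `n + m` qubits is `Fin n ⊕ Fin m`, the second summand being the auxiliary
register; keys are strings of length equal to the security parameter. -/
structure IsStrongInvertiblePRI (n m : ℕ → ℕ)
    (F : ∀ l : ℕ, GenCircuit (Fin l ⊕ Fin (n l)) (Fin (n l) ⊕ Fin (m l)))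
    (Inv : ∀ l : ℕ, GenCircuit (Fin l ⊕ (Fin (n l) ⊕ Fin (m l))) (Fin (n l))) : Prop where
  efficient_F : PolyBounded fun l => (F l).size
  efficient_Inv : PolyBounded fun l => (Inv l).size
  functional : ∀ (l : ℕ) (k : Bits (Fin l)), ∃ V : Isom (Fin (n l)) (Fin (m l)),
    (∀ X, (F l).channel (withKey k X) = isomChannel V X) ∧
    ∀ X, (Inv l).channel (withKey k X) = inverseChannel V X
  secure : ∀ D : ∀ l : ℕ, Distinguisher (Fin (n l)) (Fin (n l) ⊕ Fin (m l)),
    (PolyBounded fun l => (D l).size) →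
    Negligible fun l =>
      |(∑ k : Bits (Fin l), (D l).acceptProb (fun X => (F l).channel (withKey k X))
            (fun X => (Inv l).channel (withKey k X))) / 2 ^ l
        - ∫ U : UGroup (Fin (n l) ⊕ Fin (m l)),
            (D l).acceptProb (isomChannel (truncate U)) (inverseChannel (truncate U))
              ∂(haarUnitary (Fin (n l) ⊕ Fin (m l)))|

/-! ### Message authentication codes for quantum messages -/

/-- A MAC for quantum messages on the register `M l`, with tags on the register `T l`.  The key is
a uniformly random string whose length is the security parameter `l`. -/
structure QMAC (M T : ℕ → Type) where
  sign : ∀ l : ℕ, GenCircuit (Fin l ⊕ M l) (T l)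
  ver : ∀ l : ℕ, GenCircuit (Fin l ⊕ T l) (M l)

/-- The MAC of a strong invertible pseudorandom isometry: sign with `F`, verify with `Inv`. -/
def priMAC {n m : ℕ → ℕ}
    (F : ∀ l : ℕ, GenCircuit (Fin l ⊕ Fin (n l)) (Fin (n l) ⊕ Fin (m l)))
    (Inv : ∀ l : ℕ, GenCircuit (Fin l ⊕ (Fin (n l) ⊕ Fin (m l))) (Fin (n l))) :
    QMAC (fun l => Fin (n l)) (fun l => Fin (n l) ⊕ Fin (m l)) where
  sign := F
  ver := Inv

/-- One member of a non-uniform forger with `q` queries and `t` copies of its forgery.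
`advice` is its initial state (quantum advice and ancillas).  After `stage1` the wires
`query (i, inl ·)` hold the `i`-th queried message, and the signing oracle writes its tag to the
wires `query (i, inr ·)`.  After `stage2` the wires `forgery (j, inl ·)` and `forgery (j, inr ·)`
hold the `j`-th copy of the message and of the tag of the forgery. -/
structure Forger (μ τ : Type) (q t : ℕ) where
  width : ℕ
  advice : Op (Fin width)
  isDensity : IsDensity advice
  stage1 : List (Gate (Fin width))
  query : Fin q × (μ ⊕ τ) ↪ Fin width
  stage2 : List (Gate (Fin width))
  forgery : Fin t × (μ ⊕ τ) ↪ Fin width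

section Forger

variable {μ τ : Type} [Fintype μ] [DecidableEq μ] [Fintype τ] [DecidableEq τ] {q t : ℕ}

/-- Number of wires plus number of elementary operations. -/
def Forger.size (A : Forger μ τ q t) : ℕ := A.width + A.stage1.length + A.stage2.length

/-- The wires `(i, ·)` of an indexed family of registers. -/
def slot {δ ι : Type} (e : Fin q × δ ↪ ι) (i : Fin q) : δ ↪ ι :=
  ⟨fun d => e (i, d), fun _ _ h => (Prod.mk.inj (e.injective h)).2⟩

/-- The signing oracle is applied to all `q` queries at once. -/
def Forger.signAll (A : Forger μ τ q t) (Sign : Op μ → Op τ) (ρ : Op (Fin A.width)) :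
    Op (Fin A.width) :=
  (List.finRange q).foldl (fun σ i => call Sign (slot A.query i) σ) ρ

/-- State after the second stage, if `ρ` is the state after the first stage. -/
def Forger.finish (A : Forger μ τ q t) (Sign : Op μ → Op τ) (ρ : Op (Fin A.width)) :
    Op (Fin A.width) :=
  runGates A.stage2 (A.signAll Sign ρ)

/-- The state on the forger's wires at the end of its run. -/
def Forger.output (A : Forger μ τ q t) (Sign : Op μ → Op τ) : Op (Fin A.width) :=
  A.finish Sign (runGates A.stage1 A.advice)

/-- `σ` is a state in which the `i`-th queried message is the pure state `ψ i`, for every `i`. -/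
def Forger.Sends (A : Forger μ τ q t) (ψ : Fin q → Bits μ → ℂ) (σ : Op (Fin A.width)) : Prop :=
  IsDensity σ ∧ ∀ i, reduced (Function.Embedding.inl.trans (slot A.query i)) σ = proj (ψ i)

/-- `σ` is a state in which the output is `(|ψ'⟩ ⊗ |φ'⟩)^{⊗ t}`, for pure states `ψ'`, `φ'` with
`ψ'` orthogonal to all `ψ i`. -/
def Forger.Forges (A : Forger μ τ q t) (ψ : Fin q → Bits μ → ℂ) (σ : Op (Fin A.width)) : Prop :=
  IsDensity σ ∧ ∃ (ψ' : Bits μ → ℂ) (φ' : Bits τ → ℂ), IsKet ψ' ∧ IsKet φ' ∧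
    (∀ i, star (ψ i) ⬝ᵥ ψ' = 0) ∧
    ∀ j, reduced (Function.Embedding.inl.trans (slot A.forgery j)) σ = proj ψ' ∧
      reduced (Function.Embedding.inr.trans (slot A.forgery j)) σ = proj φ'

/-- The forger obeys the rules of the game against the signing oracles in the set `O`: possibly
after some random choice (index `r`, probability `p r`), the queried messages are pure states, and
then, up to some further random choice, its output consists of `t` copies of a pure product state
of a message and a tag, the message being orthogonal to all queried messages. -/
def Forger.Admissible (A : Forger μ τ q t) (O : Set (Op μ → Op τ)) : Prop :=
  ∃ (N : ℕ) (p : Fin N → ℝ) (ψ : Fin N → Fin q → Bits μ → ℂ) (σ : Fin N → Op (Fin A.width)),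
    (∀ r, 0 ≤ p r) ∧ ∑ r, p r = 1 ∧
    runGates A.stage1 A.advice = ∑ r, (p r : ℂ) • σ r ∧
    (∀ r i, IsKet (ψ r i)) ∧ (∀ r, A.Sends (ψ r) (σ r)) ∧
    ∀ r, ∀ Sign ∈ O, A.finish Sign (σ r) ∈ convexHull ℝ {ω | A.Forges (ψ r) ω}

/-- Wires of the verification of the `j`-th copy: the tag, and a fresh register that receives
the output of the verification algorithm. -/
def Forger.verWires (A : Forger μ τ q t) (j : Fin t) : τ ⊕ μ ↪ Fin A.width ⊕ (Fin t × μ) :=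
  ⟨Sum.map (fun x => A.forgery (j, Sum.inr x)) fun y => (j, y), by
    apply Function.Injective.sumMap
    · intro a b h
      simpa using A.forgery.injective h
    · intro a b h
      simpa using h⟩

/-- Wires of the `j`-th SWAP test: the message and the output of the verification algorithm. -/
def Forger.swapWires (A : Forger μ τ q t) (j : Fin t) : μ ⊕ μ ↪ Fin A.width ⊕ (Fin t × μ) :=
  ⟨Sum.map (fun x => A.forgery (j, Sum.inl x)) fun y => (j, y), by
    apply Function.Injective.sumMap
    · intro a b h
      simpa using A.forgery.injective h
    · intro a b h
      simpa using h⟩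

/-- Probability that the forger wins for one key: the challenger runs the verification algorithm
on each of the `t` tags, then a SWAP test between each message and the corresponding result; the
forger wins if all `t` SWAP tests output `1`. -/
def Forger.winProb (A : Forger μ τ q t) (Sign : Op μ → Op τ) (Ver : Op τ → Op μ) : ℝ :=
  let verified := (List.finRange t).foldl (fun σ j => call Ver (A.verWires j) σ)
    (adjoinZeros (Fin t × μ) (A.output Sign))
  let accepted := (List.finRange t).foldl
    (fun σ j => swapTestProj (A.swapWires j) * σ * (swapTestProj (A.swapWires j))ᴴ) verified
  accepted.trace.re

end Forger

section Unforgeability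

variable {M T : ℕ → Type} [∀ l, Fintype (M l)] [∀ l, DecidableEq (M l)]
  [∀ l, Fintype (T l)] [∀ l, DecidableEq (T l)]

/-- The signing channel under the key `k`. -/
def QMAC.signChannel (S : QMAC M T) (l : ℕ) (k : Bits (Fin l)) (X : Op (M l)) : Op (T l) :=
  (S.sign l).channel (withKey k X)

/-- The verification channel under the key `k`. -/
def QMAC.verChannel (S : QMAC M T) (l : ℕ) (k : Bits (Fin l)) (X : Op (T l)) : Op (M l) :=
  (S.ver l).channel (withKey k X)

/-- Probability, over a uniformly random key, that the forger wins the game. -/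
def QMAC.gameProb (S : QMAC M T) (l : ℕ) {q t : ℕ} (A : Forger (M l) (T l) q t) : ℝ :=
  (∑ k : Bits (Fin l), A.winProb (S.signChannel l k) (S.verChannel l k)) / 2 ^ l

/-- Many-copies-unforgeability with `t` copies and error `δ`, up to a negligible function: for
every polynomial number of queries, every non-uniform polynomial-size forger that obeys the rules
of the game wins with probability at most `δ + negl`. -/
def QMAC.ManyCopiesUnforgeable (S : QMAC M T) (t : ℕ → ℕ) (δ : ℕ → ℝ) : Prop :=
  ∀ q : ℕ → ℕ, PolyBounded q →
  ∀ A : ∀ l : ℕ, Forger (M l) (T l) (q l) (t l), (PolyBounded fun l => (A l).size) →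
    (∀ l, (A l).Admissible (Set.range (S.signChannel l))) →
    ∃ ε : ℕ → ℝ, Negligible ε ∧ ∀ l, S.gameProb l (A l) ≤ δ l + ε l

end Unforgeability

end

end QCrypto

open QCrypto

/-! Let `P` be the orthogonal projector onto the span of the queried messages and `d ≤ q` its rank.
If the forgery consists of copies of a pure pair `ψ'`, `φ'`, the registers carry a product state, so
all SWAP tests accept with probability `((1 + x) / 2) ^ t`, where `x = ⟨ψ'|Ver(φ')|ψ'⟩` lies in `[0,
1]`. By convexity this is at most `2 ^ (-t) + x`. Hence the constant `c = 1` works once the mean of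
`x` is shown to be negligible. As `P ψ' = 0`, the number `x` is the value of `overlap (1 - P) Ver`,
that is of `ρ ↦ Tr[SWAP · ((1 - P) ⊗ 1) · (id ⊗ Ver)(ρ)]`, on one forged pair. This functional is
linear in the state, so the bound survives random choices of the forger
(`Forger.win_le_of_mem_convexHull`).

From pseudorandom to Haar: `overlap (1 - P) = overlap 1 - d · overlap (P / d)`. The real part of
each term is an affine function of the acceptance probability of a Hadamard test with `q + 1` oracle
calls: a controlled swap of message and verified output for the first, a controlled 3-cycle with an
extra register in the state `P / d`, given as quantum advice, for the second
(`Forger.exists_overlap_one`, `Forger.exists_overlap_density`). Replacing the keyed isometry by a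
Haar isometry therefore costs at most two advantages, one of them multiplied by `d`. The weight `1 -
P` cannot be dropped in favour of `1`: the forger obeys the rules only for the actual keys, and
against a Haar isometry it might return a queried message with its tag.

The Haar case: by invariance, the inverse of the isometry may be replaced by the inverse of the Haar
unitary `U` itself. The forger's final state depends on `U` only through its restriction to `J
(range P)`, where `J` appends zeros, so `U` may be multiplied on the right by any unitary fixing
that subspace. Averaging over a finite set of such unitaries (`exists_twirl`) turns `(1 - P)|a⟩⟨b| ⊗
1` into a multiple of the projector `Q` onto the orthogonal complement of the subspace. What is left
is `2 ^ m / (2 ^ (n + m) - d)` times `Tr[ρ · ((1 - P) ⊗ U Q U†)] ≤ 1`, and the quotient is at most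
`(d + 1) / 2 ^ n` (`integral_overlap_unitaryInverse_le`). `Forger.exists_distinguishers` combines
the two halves. -/

set_option linter.unusedSectionVars false

namespace QCrypto

noncomputable section

/-! ### Overwriting wires of bit strings -/

section OverwriteCalculus

variable {α β γ ι κ : Type}

theorem overwrite_emb (e : α ↪ ι) (a : Bits α) (x : Bits ι) (i : α) :
    overwrite e a x (e i) = a i :=
  e.injective.extend_apply a x i

theorem overwrite_comp (e : α ↪ ι) (a : Bits α) (x : Bits ι) : overwrite e a x ∘ e = a :=
  funext fun i => overwrite_emb e a x i

theorem overwrite_of_forall_ne (e : α ↪ ι) (a : Bits α) (x : Bits ι) {i : ι}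
    (h : ∀ j, e j ≠ i) : overwrite e a x i = x i :=
  Function.extend_apply' a x i fun ⟨j, hj⟩ => h j hj

/-- Two families of wires have no wire in common. -/
def DisjointWires (e : α ↪ ι) (f : β ↪ ι) : Prop := ∀ i j, e i ≠ f j

theorem DisjointWires.symm {e : α ↪ ι} {f : β ↪ ι} (h : DisjointWires e f) :
    DisjointWires f e := fun i j => (h j i).symm

theorem overwrite_comp_of_disjoint {e : α ↪ ι} {f : β ↪ ι} (h : DisjointWires e f)
    (a : Bits α) (x : Bits ι) : overwrite e a x ∘ f = x ∘ f :=
  funext fun j => overwrite_of_forall_ne e a x fun i => h i j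

theorem overwrite_comm {e : α ↪ ι} {f : β ↪ ι} (h : DisjointWires e f)
    (a : Bits α) (b : Bits β) (x : Bits ι) :
    overwrite e a (overwrite f b x) = overwrite f b (overwrite e a x) := by
  funext i
  by_cases he : ∃ j, e j = i
  · obtain ⟨j, rfl⟩ := he
    rw [overwrite_emb, overwrite_of_forall_ne f _ _ fun k => (h j k).symm, overwrite_emb]
  · push Not at he
    rw [overwrite_of_forall_ne e _ _ he]
    by_cases hf : ∃ j, f j = i
    · obtain ⟨j, rfl⟩ := hf
      rw [overwrite_emb, overwrite_emb]
    · push Not at hf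
      rw [overwrite_of_forall_ne f _ _ hf, overwrite_of_forall_ne f _ _ hf,
        overwrite_of_forall_ne e _ _ he]

theorem overwrite_overwrite (e : α ↪ ι) (a b : Bits α) (x : Bits ι) :
    overwrite e a (overwrite e b x) = overwrite e a x := by
  funext i
  by_cases he : ∃ j, e j = i
  · obtain ⟨j, rfl⟩ := he
    rw [overwrite_emb, overwrite_emb]
  · push Not at he
    simp only [overwrite_of_forall_ne e _ _ he]

theorem overwrite_self (e : α ↪ ι) (x : Bits ι) : overwrite e (x ∘ e) x = x := by
  funext i
  by_cases he : ∃ j, e j = i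
  · obtain ⟨j, rfl⟩ := he
    rw [overwrite_emb, Function.comp]
  · push Not at he
    rw [overwrite_of_forall_ne e _ _ he]

theorem overwrite_inl_overwrite_inr (e : α ⊕ β ↪ ι) (a : Bits α) (b : Bits β) (x : Bits ι) :
    overwrite (Function.Embedding.inl.trans e) a
      (overwrite (Function.Embedding.inr.trans e) b x) = overwrite e (Sum.elim a b) x := by
  funext i
  by_cases he : ∃ j, e j = i
  · obtain ⟨j | j, rfl⟩ := he
    · rw [overwrite_emb]
      exact overwrite_emb (Function.Embedding.inl.trans e) a _ j
    · rw [overwrite_emb, overwrite_of_forall_ne]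
      · exact overwrite_emb (Function.Embedding.inr.trans e) b _ j
      · intro k hk
        simpa using e.injective hk
  · push Not at he
    rw [overwrite_of_forall_ne e _ _ he, overwrite_of_forall_ne _ _ _ fun j => he (Sum.inl j),
      overwrite_of_forall_ne _ _ _ fun j => he (Sum.inr j)]

theorem disjointWires_inl_inr (e : α ⊕ β ↪ ι) :
    DisjointWires (Function.Embedding.inl.trans e) (Function.Embedding.inr.trans e) := by
  intro i j h
  simpa using e.injective h

theorem overwrite_trans_comp (e : α ↪ ι) (f : ι ↪ κ) (a : Bits α) (x : Bits κ) :
    overwrite (e.trans f) a x ∘ f = overwrite e a (x ∘ f) := by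
  funext i
  by_cases he : ∃ j, e j = i
  · obtain ⟨j, rfl⟩ := he
    rw [overwrite_emb]
    exact overwrite_emb (e.trans f) a x j
  · push Not at he
    rw [overwrite_of_forall_ne e _ _ he, Function.comp, overwrite_of_forall_ne, Function.comp]
    intro j hj
    exact he j (f.injective hj)

theorem comp_sum_eq_zeros_iff {γ : Type} (x : γ → Bool) (u : α → γ) (v : β → γ) :
    (x ∘ u = zeros α ∧ x ∘ v = zeros β) ↔ x ∘ Sum.elim u v = zeros (α ⊕ β) := by
  constructor
  · rintro ⟨h, h'⟩
    funext i
    rcases i with i | i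
    · exact congrFun h i
    · exact congrFun h' i
  · intro h
    exact ⟨funext fun i => congrFun h (Sum.inl i), funext fun i => congrFun h (Sum.inr i)⟩

end OverwriteCalculus

/-! ### Sums over bit strings and partial traces -/

section Sums

variable {α β ι κ : Type} [Fintype α] [DecidableEq α] [Fintype β] [DecidableEq β]
  [Fintype ι] [DecidableEq ι] [Fintype κ] [DecidableEq κ] {M : Type*} [AddCommMonoid M]

/-- Strings are grouped by their values off the wires `e`, each class being represented by its
member that vanishes on `e`. This is the summation convention of `reduced`, and it also suits
`call`, which resets wires to zero. -/
theorem sum_bits_overwrite (e : α ↪ ι) (f : Bits ι → M) :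
    ∑ x, f x = ∑ z : Bits ι, if z ∘ e = zeros α then ∑ a, f (overwrite e a z) else 0 := by
  have h1 : ∑ x, f x = ∑ a : Bits α, ∑ x : Bits ι, if x ∘ e = a then f x else 0 := by
    rw [Finset.sum_comm]
    simp
  have h2 : (∑ z : Bits ι, if z ∘ e = zeros α then ∑ a, f (overwrite e a z) else 0) =
      ∑ a : Bits α, ∑ z : Bits ι, if z ∘ e = zeros α then f (overwrite e a z) else 0 := by
    rw [Finset.sum_comm]
    refine Finset.sum_congr rfl fun z _ => ?_
    split_ifs <;> simp
  rw [h1, h2]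
  refine Finset.sum_congr rfl fun a _ => ?_
  rw [← Finset.sum_filter, ← Finset.sum_filter]
  refine Finset.sum_bij' (fun x _ => overwrite e (zeros α) x) (fun z _ => overwrite e a z)
    ?_ ?_ ?_ ?_ ?_
  · intro x _
    simp [overwrite_comp]
  · intro x _
    simp [overwrite_comp]
  · intro x hx
    have hx : x ∘ e = a := by simpa using hx
    rw [overwrite_overwrite, ← hx, overwrite_self]
  · intro x hx
    have hx : x ∘ e = zeros α := by simpa using hx
    rw [overwrite_overwrite, ← hx, overwrite_self]
  · intro x hx
    have hx : x ∘ e = a := by simpa using hx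
    rw [overwrite_overwrite, ← hx, overwrite_self]

theorem sum_bits_sum (f : Bits (α ⊕ β) → M) : ∑ x, f x = ∑ a, ∑ b, f (Sum.elim a b) := by
  rw [← Fintype.sum_prod_type']
  exact Fintype.sum_equiv (Equiv.sumArrowEquivProdArrow α β Bool) _ _ fun x =>
    congrArg f (Sum.elim_comp_inl_inr x).symm

theorem trace_reduced (e : α ↪ ι) (ρ : Op ι) : (reduced e ρ).trace = ρ.trace := by
  simp only [Matrix.trace, Matrix.diag_apply, reduced, Matrix.of_apply]
  rw [sum_bits_overwrite e, Finset.sum_comm]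
  refine Finset.sum_congr rfl fun z _ => ?_
  split_ifs <;> simp

theorem reduced_inl (e : α ⊕ β ↪ ι) (ρ : Op ι) (a b : Bits α) :
    reduced (Function.Embedding.inl.trans e) ρ a b =
      ∑ c : Bits β, reduced e ρ (Sum.elim a c) (Sum.elim b c) := by
  simp only [reduced, Matrix.of_apply]
  rw [sum_bits_overwrite (Function.Embedding.inr.trans e), Finset.sum_comm]
  refine Finset.sum_congr rfl fun z _ => ?_
  simp only [overwrite_inl_overwrite_inr,
    overwrite_comp_of_disjoint (disjointWires_inl_inr e).symm]
  have h := comp_sum_eq_zeros_iff (z ∘ e) (Sum.inl : α → α ⊕ β) (Sum.inr : β → α ⊕ β)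
  rw [Sum.elim_inl_inr, Function.comp_id] at h
  by_cases h1 : z ∘ e = zeros _
  · obtain ⟨h2, h3⟩ := h.2 h1
    have h2' : z ∘ (Function.Embedding.inl.trans e) = zeros α := h2
    have h3' : z ∘ (Function.Embedding.inr.trans e) = zeros β := h3
    simp [h1, h2', h3']
  · have h4 : ¬ (z ∘ (Function.Embedding.inl.trans e) = zeros α ∧
        z ∘ (Function.Embedding.inr.trans e) = zeros β) := fun h5 => h1 (h.1 h5)
    by_cases h5 : z ∘ (Function.Embedding.inr.trans e) = zeros β
    · have h6 : z ∘ (Function.Embedding.inl.trans e) ≠ zeros α := fun h6 => h4 ⟨h6, h5⟩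
      simp [h1, h6]
    · simp [h1, h5]

theorem posSemidef_reduced (e : α ↪ ι) {ρ : Op ι} (h : ρ.PosSemidef) :
    (reduced e ρ).PosSemidef := by
  have : reduced e ρ = ∑ z : Bits ι, if z ∘ e = zeros α then
      ρ.submatrix (fun a => overwrite e a z) (fun a => overwrite e a z) else 0 := by
    ext a b
    simp only [reduced, Matrix.of_apply, Matrix.sum_apply]
    refine Finset.sum_congr rfl fun z _ => ?_
    split_ifs <;> rfl
  rw [this]
  refine Matrix.posSemidef_sum _ fun z _ => ?_
  split_ifs
  · exact h.submatrix _
  · exact Matrix.PosSemidef.zero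

theorem isDensity_reduced (e : α ↪ ι) {ρ : Op ι} (h : IsDensity ρ) : IsDensity (reduced e ρ) :=
  ⟨posSemidef_reduced e h.1, (trace_reduced e ρ).trans h.2⟩

end Sums

/-! ### Channel calls on part of a register, and pure registers -/

section Calls

variable {α β ι κ γ : Type} [Fintype α] [DecidableEq α] [Fintype β] [DecidableEq β]
  [Fintype ι] [DecidableEq ι] [Fintype κ] [DecidableEq κ] [Fintype γ] [DecidableEq γ]
  {Φ : Op α → Op β}

/-- The operator on the input register of a call, for fixed values of the other wires. -/
def callArg (e : α ⊕ β ↪ ι) (ρ : Op ι) (x y : Bits ι) : Op α := Matrix.of fun a b =>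
  ∑ c : Bits β, ρ (overwrite e (Sum.elim a c) x) (overwrite e (Sum.elim b c) y)

theorem call_apply (Φ : Op α → Op β) (e : α ⊕ β ↪ ι) (ρ : Op ι) (x y : Bits ι) :
    call Φ e ρ x y = if x ∘ e ∘ Sum.inl = zeros α ∧ y ∘ e ∘ Sum.inl = zeros α then
      Φ (callArg e ρ x y) (x ∘ e ∘ Sum.inr) (y ∘ e ∘ Sum.inr) else 0 := rfl

theorem callArg_overwrite (e : α ⊕ β ↪ ι) (ρ : Op ι) (x y : Bits ι) (u v : Bits (α ⊕ β)) :
    callArg e ρ (overwrite e u x) (overwrite e v y) = callArg e ρ x y := by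
  simp only [callArg, overwrite_overwrite]

theorem callArg_add (e : α ⊕ β ↪ ι) (ρ σ : Op ι) (x y : Bits ι) :
    callArg e (ρ + σ) x y = callArg e ρ x y + callArg e σ x y := by
  ext a b
  simp [callArg, Finset.sum_add_distrib]

theorem callArg_smul (e : α ⊕ β ↪ ι) (c : ℂ) (ρ : Op ι) (x y : Bits ι) :
    callArg e (c • ρ) x y = c • callArg e ρ x y := by
  ext a b
  simp [callArg, Finset.mul_sum]

theorem isLinearMap_call (hΦ : IsLinearMap ℂ Φ) (e : α ⊕ β ↪ ι) : IsLinearMap ℂ (call Φ e) := by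
  constructor
  · intro ρ σ
    ext x y
    simp only [Matrix.add_apply, call_apply, callArg_add, hΦ.map_add]
    split_ifs <;> simp
  · intro c ρ
    ext x y
    simp only [Matrix.smul_apply, call_apply, callArg_smul, hΦ.map_smul]
    split_ifs <;> simp

/-- For fixed values of the other wires, only the reset input string contributes to the diagonal
sum. The remaining sum over the output wires is the trace of `Φ` applied to one block. -/
theorem trace_call (hΦ : ∀ X, (Φ X).trace = X.trace) (e : α ⊕ β ↪ ι) (ρ : Op ι) :
    (call Φ e ρ).trace = ρ.trace := by
  simp only [Matrix.trace, Matrix.diag_apply]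
  rw [sum_bits_overwrite e, sum_bits_overwrite e (fun x => ρ x x)]
  refine Finset.sum_congr rfl fun z _ => ?_
  split_ifs with hz
  swap
  · rfl
  simp only [call_apply, callArg_overwrite, ← Function.comp_assoc, overwrite_comp, and_self]
  rw [sum_bits_sum, sum_bits_sum]
  simp only [Sum.elim_comp_inl, Sum.elim_comp_inr]
  rw [Finset.sum_eq_single (zeros α)]
  · simp only [if_true]
    exact hΦ (callArg e ρ z z)
  · intro a _ ha
    simp [ha]
  · simp

theorem conjTranspose_call (hΦ : ∀ X, Φ Xᴴ = (Φ X)ᴴ) (e : α ⊕ β ↪ ι) (ρ : Op ι) :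
    call Φ e ρᴴ = (call Φ e ρ)ᴴ := by
  ext x y
  have h : callArg e ρᴴ x y = (callArg e ρ y x)ᴴ := by
    ext a b
    simp [callArg]
  rw [Matrix.conjTranspose_apply, call_apply, call_apply, h, hΦ]
  by_cases h1 : x ∘ e ∘ Sum.inl = zeros α <;> by_cases h2 : y ∘ e ∘ Sum.inl = zeros α <;>
    simp [h1, h2]

/-- Place the state `ρ` on the wires `f`, with the weights `E` on the other wires. -/
def extendState (f : ι ↪ κ) (E : Bits κ → Bits κ → ℂ) (ρ : Op ι) : Op κ := Matrix.of fun x y =>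
  ρ (x ∘ f) (y ∘ f) * E x y

/-- `E` does not depend on the wires `f`. -/
def IndepOf (f : ι ↪ κ) (E : Bits κ → Bits κ → ℂ) : Prop :=
  ∀ a b x y, E (overwrite f a x) (overwrite f b y) = E x y

theorem IndepOf.overwrite_trans {f : ι ↪ κ} {E : Bits κ → Bits κ → ℂ} (hE : IndepOf f E)
    (e : α ↪ ι) (a b : Bits α) (x y : Bits κ) :
    E (overwrite (e.trans f) a x) (overwrite (e.trans f) b y) = E x y := by
  rw [← hE (x ∘ f) (y ∘ f), ← hE (x ∘ f) (y ∘ f) x y]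
  congr 1 <;>
  · funext i
    by_cases he : ∃ j, f j = i
    · obtain ⟨j, rfl⟩ := he
      rw [overwrite_emb, overwrite_emb]
    · push Not at he
      rw [overwrite_of_forall_ne f _ _ he, overwrite_of_forall_ne f _ _ he,
        overwrite_of_forall_ne _ _ _ fun j => he (e j)]

/-- The weight `E` does not see the wires of the call, so it is a scalar that passes through `Φ`.
The same argument serves renaming of wires (`E = 1`), fresh zero wires, and an adjoined density
matrix. -/
theorem call_extendState (hΦ : IsLinearMap ℂ Φ) (e : α ⊕ β ↪ ι) (f : ι ↪ κ)
    {E : Bits κ → Bits κ → ℂ} (hE : IndepOf f E) (ρ : Op ι) :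
    call Φ (e.trans f) (extendState f E ρ) = extendState f E (call Φ e ρ) := by
  ext x y
  have h : callArg (e.trans f) (extendState f E ρ) x y =
      E x y • callArg e ρ (x ∘ f) (y ∘ f) := by
    ext a b
    simp only [callArg, extendState, Matrix.of_apply, overwrite_trans_comp, hE.overwrite_trans,
      Matrix.smul_apply, smul_eq_mul, Finset.mul_sum]
    exact Finset.sum_congr rfl fun c _ => mul_comm _ _
  rw [call_apply, h, hΦ.map_smul]
  simp only [extendState, Matrix.of_apply, call_apply, Matrix.smul_apply, smul_eq_mul]
  change (if (x ∘ f) ∘ e ∘ Sum.inl = _ ∧ (y ∘ f) ∘ e ∘ Sum.inl = _ then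
    _ * Φ _ ((x ∘ f) ∘ e ∘ Sum.inr) ((y ∘ f) ∘ e ∘ Sum.inr) else 0) = _
  split_ifs
  · exact mul_comm _ _
  · simp

/-- On the wires `e` the state `ρ` is the pure state `ψ`, in a product with all other wires. -/
def PureOn (e : γ ↪ ι) (ψ : Bits γ → ℂ) (ρ : Op ι) : Prop :=
  ∃ R : Bits ι → Bits ι → ℂ, IndepOf e R ∧
    ∀ x y, ρ x y = ψ (x ∘ e) * star (ψ (y ∘ e)) * R x y

theorem PureOn.call_disjoint (hΦ : IsLinearMap ℂ Φ) {e : α ⊕ β ↪ ι} {f : γ ↪ ι}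
    (hef : DisjointWires e f) {ψ : Bits γ → ℂ} {ρ : Op ι} (h : PureOn f ψ ρ) :
    PureOn f ψ (call Φ e ρ) := by
  obtain ⟨R, hR, hρ⟩ := h
  refine ⟨call Φ e (Matrix.of R), ?_, ?_⟩
  · intro a b x y
    have h1 : ∀ (a : Bits γ) (x : Bits ι), overwrite f a x ∘ e = x ∘ e := fun a x =>
      overwrite_comp_of_disjoint hef.symm a x
    have h2 : callArg e (Matrix.of R) (overwrite f a x) (overwrite f b y) =
        callArg e (Matrix.of R) x y := by
      ext c d
      simp only [callArg, Matrix.of_apply, overwrite_comm hef, hR a b]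
    simp only [call_apply, ← Function.comp_assoc, h1, h2]
  · intro x y
    have h : callArg e ρ x y =
        (ψ (x ∘ f) * star (ψ (y ∘ f))) • callArg e (Matrix.of R) x y := by
      ext c d
      simp only [callArg, Matrix.of_apply, hρ, overwrite_comp_of_disjoint hef,
        Matrix.smul_apply, smul_eq_mul, Finset.mul_sum]
    rw [call_apply, h, hΦ.map_smul, call_apply]
    split_ifs <;> simp

/-- A pure marginal leaves no correlations. With `ρ = B† B`, the components of the rows of `B`
orthogonal to the conjugate of `ψ` on the wires `e` have total squared norm determined by the
marginal, and this is zero. Every row thus factors as that conjugate times a function of the other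
wires. -/
theorem pureOn_of_reduced (e : γ ↪ ι) {ψ : Bits γ → ℂ} (hψ : IsKet ψ) {ρ : Op ι}
    (hρ : ρ.PosSemidef) (h : reduced e ρ = proj ψ) : PureOn e ψ ρ := by
  obtain ⟨m, B, rfl⟩ : ∃ (m : ℕ) (B : Matrix (Fin m) (Bits ι) ℂ), ρ = Bᴴ * B := by
    obtain ⟨m, v, rfl⟩ := Matrix.posSemidef_iff_eq_sum_vecMulVec.mp hρ
    refine ⟨m, Matrix.of fun s x => star (v s x), ?_⟩
    ext x y
    simp [Matrix.sum_apply, Matrix.mul_apply, Matrix.vecMulVec_apply]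
  have hψ' : ∑ a, star (ψ a) * ψ a = 1 := hψ
  -- the component of a row of `B` orthogonal to `ψ`
  let N : Bits γ → Bits γ → ℂ := fun b a => (if b = a then 1 else 0) - star (ψ b) * ψ a
  -- Expanding the squares produces the entries of the reduced state, which are `ψ a * star (ψ a')`;
  -- the matrix `N` annihilates `star ψ`.
  have key : ∀ b, ∑ z : Bits ι, ∑ s, (if z ∘ e = zeros γ then
      star (∑ a, N b a * B s (overwrite e a z)) * (∑ a, N b a * B s (overwrite e a z))
      else 0) = 0 := by
    intro b
    have h1 : ∀ a a', ∑ z : Bits ι, (if z ∘ e = zeros γ then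
        ∑ s, star (B s (overwrite e a z)) * B s (overwrite e a' z) else 0) =
        ψ a * star (ψ a') := by
      intro a a'
      have := congrFun (congrFun h a) a'
      simpa [reduced, proj, Matrix.vecMulVec_apply, Matrix.mul_apply] using this
    calc _ = ∑ a, ∑ a', star (N b a) * N b a' * ∑ z : Bits ι, (if z ∘ e = zeros γ then
        ∑ s, star (B s (overwrite e a z)) * B s (overwrite e a' z) else 0) := by
          simp only [Finset.mul_sum]
          rw [Finset.sum_comm_cycle]
          refine Finset.sum_congr rfl fun z _ => ?_
          split_ifs
          · simp only [star_sum, Finset.sum_mul, Finset.mul_sum, star_mul']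
            rw [Finset.sum_comm]
            conv_lhs =>
              enter [2, a]
              rw [Finset.sum_comm]
            rw [Finset.sum_comm]
            refine Finset.sum_congr rfl fun a _ => ?_
            refine Finset.sum_congr rfl fun a' _ => ?_
            refine Finset.sum_congr rfl fun s _ => ?_
            ring
          · simp
      _ = ∑ a, ∑ a', star (N b a) * N b a' * (ψ a * star (ψ a')) := by simp only [h1]
      _ = (∑ a, star (N b a) * ψ a) * ∑ a', N b a' * star (ψ a') := by
          rw [Finset.sum_mul_sum]
          refine Finset.sum_congr rfl fun a _ => Finset.sum_congr rfl fun a' _ => ?_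
          ring
      _ = 0 := by
          have : ∑ a', N b a' * star (ψ a') = 0 := by
            have h2 : ∀ a', N b a' * star (ψ a') = (if b = a' then star (ψ a') else 0) -
                star (ψ b) * (star (ψ a') * ψ a') := by
              intro a'
              simp only [N]
              split_ifs <;> ring
            simp only [h2, Finset.sum_sub_distrib, ← Finset.mul_sum, hψ']
            simp
          rw [this, mul_zero]
  have key2 : ∀ b (z : Bits ι) s, z ∘ e = zeros γ → ∑ a, N b a * B s (overwrite e a z) = 0 := by
    intro b z s hz
    have hnn : ∀ w : ℂ, 0 ≤ star w * w := fun w => star_mul_self_nonneg w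
    have h3 := (Finset.sum_eq_zero_iff_of_nonneg (fun z _ => Finset.sum_nonneg fun s _ => by
      split_ifs
      · exact hnn _
      · exact le_rfl)).mp (key b) z (Finset.mem_univ _)
    have h4 := (Finset.sum_eq_zero_iff_of_nonneg (fun s _ => by
      split_ifs
      exact hnn _)).mp h3 s (Finset.mem_univ _)
    rw [if_pos hz] at h4
    rcases mul_eq_zero.mp h4 with h5 | h5
    · exact star_eq_zero.mp h5
    · exact h5
  have key3 : ∀ s (x : Bits ι), B s x =
      star (ψ (x ∘ e)) * ∑ a, ψ a * B s (overwrite e a x) := by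
    intro s x
    have h6 := key2 (x ∘ e) (overwrite e (zeros γ) x) s (overwrite_comp _ _ _)
    simp only [overwrite_overwrite, N, sub_mul, Finset.sum_sub_distrib, ite_mul, one_mul,
      zero_mul, Finset.sum_ite_eq, Finset.mem_univ, if_true, overwrite_self] at h6
    rw [sub_eq_zero.mp h6, Finset.mul_sum]
    exact Finset.sum_congr rfl fun a _ => by ring
  -- The remaining factor is the Gram matrix of the rows of `B` contracted with `ψ` along `e`.
  refine ⟨fun x y => ∑ s, star (∑ a, ψ a * B s (overwrite e a x)) *
    ∑ a, ψ a * B s (overwrite e a y), ?_, ?_⟩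
  · intro a b x y
    simp only [overwrite_overwrite]
  · intro x y
    rw [Matrix.mul_apply, Finset.mul_sum]
    refine Finset.sum_congr rfl fun s _ => ?_
    rw [Matrix.conjTranspose_apply, key3 s x, key3 s y, star_mul', star_star]
    ring

end Calls

/-! ### Elementary gates: entries, relabelling, preservation of states -/

section Gates

variable {ι κ : Type} [Fintype ι] [DecidableEq ι] [Fintype κ] [DecidableEq κ]

/-- Relabel the wires of an elementary operation. -/
def Gate.map (f : ι ↪ κ) : Gate ι → Gate κ
  | .hadamard i => .hadamard (f i)
  | .phaseT i => .phaseT (f i)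
  | .cnot i j hij => .cnot (f i) (f j) (f.injective.ne hij)
  | .toffoli i j l hij hil hjl =>
      .toffoli (f i) (f j) (f l) (f.injective.ne hij) (f.injective.ne hil) (f.injective.ne hjl)
  | .measure i => .measure (f i)

/-- The entries of the one-qubit Hadamard matrix. -/
def hadamardCoeff (a b : Bool) : ℂ := (if a && b then -1 else 1) / ((Real.sqrt 2 : ℝ) : ℂ)

theorem sum_hadamardMat (i : ι) (x : Bits ι) (g : Bits ι → ℂ) :
    ∑ z, hadamardMat i x z * g z =
      ∑ a, hadamardCoeff (x i) a * g (Function.update x i a) := by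
  have h : ∀ z, hadamardMat i x z * g z =
      if ∀ l, l ≠ i → x l = z l then hadamardCoeff (x i) (z i) * g z else 0 := by
    intro z
    simp only [hadamardMat, Matrix.of_apply, hadamardCoeff]
    split_ifs <;> simp
  simp only [h]
  rw [← Finset.sum_filter]
  refine Finset.sum_bij' (fun z _ => z i) (fun a _ => Function.update x i a) ?_ ?_ ?_ ?_ ?_
  · simp
  · intro a _
    simp only [Finset.mem_filter, Finset.mem_univ, true_and]
    intro l hl
    rw [Function.update_of_ne hl]
  · intro z hz
    simp only [Finset.mem_filter, Finset.mem_univ, true_and] at hz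
    funext l
    by_cases hl : l = i
    · subst hl
      simp
    · rw [Function.update_of_ne hl, hz l hl]
  · simp
  · intro z hz
    simp only [Finset.mem_filter, Finset.mem_univ, true_and] at hz
    have : Function.update x i (z i) = z := by
      funext l
      by_cases hl : l = i
      · subst hl
        simp
      · rw [Function.update_of_ne hl, hz l hl]
    rw [this]

theorem hadamard_apply (i : ι) (ρ : Op ι) (x y : Bits ι) :
    (Gate.hadamard i).apply ρ x y = ∑ a, ∑ b, hadamardCoeff (x i) a * hadamardCoeff (y i) b *
      ρ (Function.update x i a) (Function.update y i b) := by
  have h : (Gate.hadamard i).apply ρ x y =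
      ∑ z, hadamardMat i x z * ∑ w, hadamardMat i y w * ρ z w := by
    simp only [Gate.apply, Matrix.mul_apply, Matrix.conjTranspose_apply, Finset.sum_mul,
      Finset.mul_sum]
    rw [Finset.sum_comm]
    refine Finset.sum_congr rfl fun z _ => Finset.sum_congr rfl fun w _ => ?_
    have : star (hadamardMat i y w) = hadamardMat i y w := by
      simp only [hadamardMat, Matrix.of_apply]
      split_ifs <;> simp
    rw [this]
    ring
  rw [h, sum_hadamardMat]
  refine Finset.sum_congr rfl fun a _ => ?_
  rw [sum_hadamardMat, Finset.mul_sum]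
  exact Finset.sum_congr rfl fun b _ => by ring

/-- Both `CNOT` and Toffoli permute the computational basis by an involution, so conjugation is
reindexing and no inverse permutation has to be named. -/
theorem permMat_conj {p : Bits ι → Bits ι} (hp : Function.Involutive p) (ρ : Op ι) :
    (Matrix.of fun x y => if x = p y then (1 : ℂ) else 0) * ρ *
      (Matrix.of fun x y => if x = p y then (1 : ℂ) else 0)ᴴ = ρ.submatrix p p := by
  ext x y
  have hx : ∀ z, x = p z ↔ z = p x := fun z =>
    ⟨fun h => by rw [h, hp z], fun h => by rw [h, hp x]⟩
  have hy : ∀ z, y = p z ↔ z = p y := fun z =>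
    ⟨fun h => by rw [h, hp z], fun h => by rw [h, hp y]⟩
  simp only [Matrix.mul_apply, Matrix.of_apply, Matrix.conjTranspose_apply, hx, hy, ite_mul, one_mul,
    zero_mul, Finset.sum_ite_eq', Finset.mem_univ, if_true, apply_ite star, star_one, star_zero,
    mul_ite, mul_one, mul_zero, Matrix.submatrix_apply]

/-- The action of a `CNOT` gate on bit strings. -/
def cnotPerm (i j : ι) (x : Bits ι) : Bits ι := Function.update x j (xor (x j) (x i))

/-- The action of a Toffoli gate on bit strings. -/
def toffoliPerm (i j l : ι) (x : Bits ι) : Bits ι :=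
  Function.update x l (xor (x l) (x i && x j))

theorem cnotPerm_involutive {i j : ι} (h : i ≠ j) : Function.Involutive (cnotPerm i j) := by
  intro x
  simp [cnotPerm, Function.update_of_ne h]

theorem toffoliPerm_involutive {i j l : ι} (hi : i ≠ l) (hj : j ≠ l) :
    Function.Involutive (toffoliPerm i j l) := by
  intro x
  simp [toffoliPerm, Function.update_of_ne hi, Function.update_of_ne hj]

theorem cnot_apply (i j : ι) (h : i ≠ j) (ρ : Op ι) :
    (Gate.cnot i j h).apply ρ = ρ.submatrix (cnotPerm i j) (cnotPerm i j) :=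
  permMat_conj (cnotPerm_involutive h) ρ

theorem toffoli_apply (i j l : ι) (hij : i ≠ j) (hi : i ≠ l) (hj : j ≠ l) (ρ : Op ι) :
    (Gate.toffoli i j l hij hi hj).apply ρ =
      ρ.submatrix (toffoliPerm i j l) (toffoliPerm i j l) :=
  permMat_conj (toffoliPerm_involutive hi hj) ρ

/-- The diagonal entries of the one-qubit `T` gate. -/
def phaseTCoeff (a : Bool) : ℂ := if a then Complex.exp (Complex.I * (Real.pi / 4)) else 1

theorem phaseT_apply (i : ι) (ρ : Op ι) (x y : Bits ι) :
    (Gate.phaseT i).apply ρ x y = phaseTCoeff (x i) * ρ x y * star (phaseTCoeff (y i)) := by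
  simp [Gate.apply, phaseTMat, phaseTCoeff, Matrix.diagonal_conjTranspose]

theorem star_phaseTCoeff_mul_self (a : Bool) : star (phaseTCoeff a) * phaseTCoeff a = 1 := by
  cases a
  · simp [phaseTCoeff]
  · simp only [phaseTCoeff, if_true, Complex.star_def]
    rw [mul_comm, Complex.mul_conj, Complex.normSq_eq_norm_sq]
    have : Complex.I * (Real.pi / 4) = ((Real.pi / 4 : ℝ) : ℂ) * Complex.I := by
      push_cast
      ring
    rw [this, Complex.norm_exp_ofReal_mul_I]
    simp

theorem update_comp_emb (f : ι ↪ κ) (x : Bits κ) (i : ι) (a : Bool) :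
    Function.update x (f i) a ∘ f = Function.update (x ∘ f) i a := by
  funext j
  by_cases h : j = i
  · subst h
    simp
  · rw [Function.comp, Function.update_of_ne (f.injective.ne h), Function.update_of_ne h,
      Function.comp]

theorem IndepOf.update {f : ι ↪ κ} {E : Bits κ → Bits κ → ℂ} (hE : IndepOf f E) (i j : ι)
    (a b : Bool) (x y : Bits κ) :
    E (Function.update x (f i) a) (Function.update y (f j) b) = E x y := by
  have h : ∀ (i : ι) (a : Bool) (x : Bits κ),
      Function.update x (f i) a = overwrite f (Function.update (x ∘ f) i a) x := by
    intro i a x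
    rw [← update_comp_emb]
    funext k
    by_cases hk : ∃ l, f l = k
    · obtain ⟨l, rfl⟩ := hk
      rw [overwrite_emb, Function.comp]
    · push Not at hk
      rw [overwrite_of_forall_ne f _ _ hk, Function.update_of_ne (hk i).symm]
  rw [h, h, hE]

theorem Gate.apply_map (f : ι ↪ κ) {E : Bits κ → Bits κ → ℂ} (hE : IndepOf f E) (g : Gate ι)
    (ρ : Op ι) : (g.map f).apply (extendState f E ρ) = extendState f E (g.apply ρ) := by
  ext x y
  cases g with
  | hadamard i =>
    simp only [Gate.map, hadamard_apply, extendState, Matrix.of_apply, update_comp_emb, hE.update,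
      Finset.sum_mul, Function.comp, mul_assoc]
  | phaseT i =>
    simp only [Gate.map, phaseT_apply, extendState, Matrix.of_apply, Function.comp]
    ring
  | cnot i j h =>
    simp only [Gate.map, cnot_apply, extendState, Matrix.of_apply, Matrix.submatrix_apply,
      cnotPerm, update_comp_emb, hE.update, Function.comp]
  | toffoli i j l h1 h2 h3 =>
    simp only [Gate.map, toffoli_apply, extendState, Matrix.of_apply, Matrix.submatrix_apply,
      toffoliPerm, update_comp_emb, hE.update, Function.comp]
  | measure i =>
    simp only [Gate.map, Gate.apply, extendState, Matrix.of_apply, Function.comp]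
    split_ifs <;> simp

theorem Gate.isLinearMap_apply (g : Gate ι) : IsLinearMap ℂ g.apply := by
  cases g
  case measure i =>
    constructor
    · intro ρ σ
      ext x y
      by_cases h : x i = y i <;> simp [Gate.apply, h]
    · intro c ρ
      ext x y
      by_cases h : x i = y i <;> simp [Gate.apply, h]
  all_goals
    constructor
    · intro ρ σ
      simp only [Gate.apply, Matrix.mul_add, Matrix.add_mul]
    · intro c ρ
      simp only [Gate.apply, Matrix.mul_smul, Matrix.smul_mul]

theorem hadamardMat_mul_self (i : ι) : (hadamardMat i)ᴴ * hadamardMat i = 1 := by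
  have h2 : ((Real.sqrt 2 : ℝ) : ℂ) * ((Real.sqrt 2 : ℝ) : ℂ) = 2 := by
    rw [← Complex.ofReal_mul, Real.mul_self_sqrt (by norm_num)]
    simp
  have hH : (hadamardMat i)ᴴ = hadamardMat i := by
    ext x y
    have : (∀ l, l ≠ i → y l = x l) ↔ ∀ l, l ≠ i → x l = y l :=
      ⟨fun h l hl => (h l hl).symm, fun h l hl => (h l hl).symm⟩
    simp only [Matrix.conjTranspose_apply, hadamardMat, Matrix.of_apply, this, Bool.and_comm]
    split_ifs <;> simp
  rw [hH]
  ext x y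
  rw [Matrix.mul_apply, sum_hadamardMat, Matrix.one_apply]
  have h : ∀ a, hadamardMat i (Function.update x i a) y =
      if ∀ l, l ≠ i → x l = y l then hadamardCoeff a (y i) else 0 := by
    intro a
    have : (∀ l, l ≠ i → Function.update x i a l = y l) ↔ ∀ l, l ≠ i → x l = y l :=
      forall_congr' fun l => imp_congr_right fun hl => by rw [Function.update_of_ne hl]
    simp only [hadamardMat, Matrix.of_apply, this, Function.update_self, hadamardCoeff]
  simp only [h]
  by_cases hl : ∀ l, l ≠ i → x l = y l
  · have hxy : x = y ↔ x i = y i := by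
      constructor
      · rintro rfl
        rfl
      · intro h
        funext l
        by_cases hli : l = i
        · rw [hli, h]
        · exact hl l hli
    have hd : ((Real.sqrt 2 : ℝ) : ℂ)⁻¹ * ((Real.sqrt 2 : ℝ) : ℂ)⁻¹ = 1 / 2 := by
      rw [← mul_inv, h2, one_div]
    simp only [if_pos hl, hxy, Fintype.sum_bool, hadamardCoeff]
    cases x i <;> cases y i <;> simp [neg_div, hd] <;> norm_num
  · have hxy : x ≠ y := by
      rintro rfl
      exact hl fun _ _ => rfl
    simp [hl, hxy]

theorem trace_conj_of_isometry {A ρ : Op ι} (h : Aᴴ * A = 1) : (A * ρ * Aᴴ).trace = ρ.trace := by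
  rw [Matrix.trace_mul_comm, ← Matrix.mul_assoc, h, Matrix.one_mul]

theorem Gate.trace_apply (g : Gate ι) (ρ : Op ι) : (g.apply ρ).trace = ρ.trace := by
  cases g with
  | hadamard i => exact trace_conj_of_isometry (hadamardMat_mul_self i)
  | phaseT i =>
    simp only [Matrix.trace, Matrix.diag_apply, phaseT_apply]
    refine Finset.sum_congr rfl fun x _ => ?_
    rw [mul_right_comm, mul_comm (phaseTCoeff _), star_phaseTCoeff_mul_self, one_mul]
  | cnot i j h =>
    rw [cnot_apply]
    exact Equiv.sum_comp (cnotPerm_involutive h).toPerm fun x => ρ x x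
  | toffoli i j l h1 h2 h3 =>
    rw [toffoli_apply]
    exact Equiv.sum_comp (toffoliPerm_involutive h2 h3).toPerm fun x => ρ x x
  | measure i => simp [Gate.apply, Matrix.trace]

theorem Gate.posSemidef_apply (g : Gate ι) {ρ : Op ι} (h : ρ.PosSemidef) :
    (g.apply ρ).PosSemidef := by
  cases g
  case measure i =>
    -- A measurement is the Schur product with the positive semidefinite matrix that marks pairs of
    -- strings agreeing on wire `i`.
    have h1 : ((1 : Matrix Bool Bool ℂ).submatrix (fun x : Bits ι => x i)
        (fun x => x i)).PosSemidef := Matrix.PosSemidef.one.submatrix _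
    have h2 : (Gate.measure i).apply ρ = Matrix.hadamard
        ((1 : Matrix Bool Bool ℂ).submatrix (fun x : Bits ι => x i) (fun x => x i)) ρ := by
      ext x y
      by_cases hxy : x i = y i <;> simp [Gate.apply, Matrix.hadamard_apply, Matrix.one_apply, hxy]
    rw [h2]
    exact h1.hadamard h
  all_goals exact h.mul_mul_conjTranspose_same _

theorem Gate.isDensity_apply (g : Gate ι) {ρ : Op ι} (h : IsDensity ρ) : IsDensity (g.apply ρ) :=
  ⟨g.posSemidef_apply h.1, (g.trace_apply ρ).trans h.2⟩

theorem isDensity_runGates (C : List (Gate ι)) {ρ : Op ι} (h : IsDensity ρ) :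
    IsDensity (runGates C ρ) := by
  induction C generalizing ρ with
  | nil => exact h
  | cons g C ih => exact ih (g.isDensity_apply h)

theorem isLinearMap_runGates (C : List (Gate ι)) : IsLinearMap ℂ (runGates C) := by
  induction C with
  | nil => exact ⟨fun _ _ => rfl, fun _ _ => rfl⟩
  | cons g C ih =>
    constructor
    · intro ρ σ
      change runGates C (g.apply (ρ + σ)) = runGates C (g.apply ρ) + runGates C (g.apply σ)
      rw [g.isLinearMap_apply.map_add, ih.map_add]
    · intro c ρ
      change runGates C (g.apply (c • ρ)) = c • runGates C (g.apply ρ)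
      rw [g.isLinearMap_apply.map_smul, ih.map_smul]

theorem runGates_append (C C' : List (Gate ι)) (ρ : Op ι) :
    runGates (C ++ C') ρ = runGates C' (runGates C ρ) := List.foldl_append

theorem IsLinearMap.continuous_op {F : Op ι → Op κ} (h : IsLinearMap ℂ F) : Continuous F :=
  LinearMap.continuous_of_finiteDimensional (h.mk' F)

end Gates

/-! ### Controlled swaps and the Hadamard test -/

section HadamardTest

variable {ι μ : Type} [Fintype ι] [DecidableEq ι] [Fintype μ] [DecidableEq μ]

/-- Exchange the contents of the registers `e (inl ·)` and `e (inr ·)`. -/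
def swapBits (e : μ ⊕ μ ↪ ι) (x : Bits ι) : Bits ι := overwrite e (x ∘ e ∘ Sum.swap) x

theorem swapBits_comp (e : μ ⊕ μ ↪ ι) (x : Bits ι) : swapBits e x ∘ e = x ∘ e ∘ Sum.swap :=
  overwrite_comp _ _ _

theorem swapBits_involutive (e : μ ⊕ μ ↪ ι) : Function.Involutive (swapBits e) := by
  intro x
  have h : swapBits e x ∘ e ∘ Sum.swap = x ∘ e := by
    rw [← Function.comp_assoc, swapBits_comp]
    funext i
    simp
  rw [swapBits, h, swapBits, overwrite_overwrite, overwrite_self]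

/-- The bit string map `F`, controlled by an additional wire. -/
def controlled (F : Bits ι → Bits ι) (x : Bits (ι ⊕ Unit)) : Bits (ι ⊕ Unit) :=
  Sum.elim (if x (Sum.inr ()) then F (x ∘ Sum.inl) else x ∘ Sum.inl) (x ∘ Sum.inr)

theorem controlled_controlled (F G : Bits ι → Bits ι) (x : Bits (ι ⊕ Unit)) :
    controlled F (controlled G x) = controlled (F ∘ G) x := by
  simp only [controlled, Sum.elim_inr, Sum.elim_comp_inl, Sum.elim_comp_inr, Function.comp]
  split_ifs <;> rfl

/-- Exchange the wires `a` and `b` if the additional wire is set. -/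
def controlledSwapGates (a b : ι) (h : a ≠ b) : List (Gate (ι ⊕ Unit)) :=
  [.cnot (.inl b) (.inl a) (by simpa using h.symm),
    .toffoli (.inr ()) (.inl a) (.inl b) (by simp) (by simp) (by simpa using h),
    .cnot (.inl b) (.inl a) (by simpa using h.symm)]

/-- A swap is three alternating `CNOT` gates. Only the middle one needs the control, since the two
outer ones cancel when it is absent. -/
theorem runGates_controlledSwapGates (a b : ι) (h : a ≠ b) (ρ : Op (ι ⊕ Unit)) :
    runGates (controlledSwapGates a b h) ρ =
      ρ.submatrix (controlled fun x => x ∘ Equiv.swap a b)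
        (controlled fun x => x ∘ Equiv.swap a b) := by
  have key : ∀ x : Bits (ι ⊕ Unit), cnotPerm (Sum.inl b) (Sum.inl a)
      (toffoliPerm (Sum.inr ()) (Sum.inl a) (Sum.inl b) (cnotPerm (Sum.inl b) (Sum.inl a) x)) =
      controlled (fun x => x ∘ Equiv.swap a b) x := by
    intro x
    have hab : (Sum.inl a : ι ⊕ Unit) ≠ Sum.inl b := by simpa using h
    have hba : (Sum.inl b : ι ⊕ Unit) ≠ Sum.inl a := hab.symm
    funext w
    rcases w with w | ⟨⟩
    · by_cases hwa : w = a
      · subst hwa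
        cases hc : x (Sum.inr ()) <;> cases ha : x (Sum.inl w) <;> cases hb : x (Sum.inl b) <;>
          simp [cnotPerm, toffoliPerm, controlled, hab, hba, hc, ha, hb]
      · by_cases hwb : w = b
        · subst hwb
          cases hc : x (Sum.inr ()) <;> cases ha : x (Sum.inl a) <;>
            cases hb : x (Sum.inl w) <;>
            simp [cnotPerm, toffoliPerm, controlled, hab, hba, hc, ha, hb]
        · cases hc : x (Sum.inr ()) <;>
            simp [cnotPerm, toffoliPerm, controlled, hwa, hwb, hc,
              Equiv.swap_apply_of_ne_of_ne hwa hwb]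
    · simp [cnotPerm, toffoliPerm, controlled]
  simp only [runGates, controlledSwapGates, List.foldl, cnot_apply, toffoli_apply,
    Matrix.submatrix_submatrix]
  congr 1 <;> exact funext key

theorem inl_ne_inr (e : μ ⊕ μ ↪ ι) (i : μ) : e (Sum.inl i) ≠ e (Sum.inr i) := by
  simp

/-- Exchange the registers `e (inl ·)` and `e (inr ·)` if the additional wire is set. -/
def controlledSwapCircuit (e : μ ⊕ μ ↪ ι) : List (Gate (ι ⊕ Unit)) :=
  (Finset.univ : Finset μ).toList.flatMap fun i =>
    controlledSwapGates (e (.inl i)) (e (.inr i)) (inl_ne_inr e i)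

theorem length_controlledSwapCircuit (e : μ ⊕ μ ↪ ι) :
    (controlledSwapCircuit e).length = Fintype.card μ * 3 := by
  simp [controlledSwapCircuit, List.length_flatMap, controlledSwapGates]

theorem runGates_controlledSwapCircuit (e : μ ⊕ μ ↪ ι) (ρ : Op (ι ⊕ Unit)) :
    runGates (controlledSwapCircuit e) ρ =
      ρ.submatrix (controlled (swapBits e)) (controlled (swapBits e)) := by
  -- The induction records the accumulated wire map `s`: it exchanges exactly the pairs already
  -- treated and fixes everything outside the range of `e`. Absence of duplicates keeps a pair from
  -- being swapped back.
  have key : ∀ L : List μ, L.Nodup → ∃ s : ι → ι,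
      (∀ ρ, runGates (L.flatMap fun i =>
          controlledSwapGates (e (.inl i)) (e (.inr i)) (inl_ne_inr e i)) ρ =
        ρ.submatrix (controlled fun x => x ∘ s) (controlled fun x => x ∘ s)) ∧
      (∀ i, s (e i) = if Sum.elim id id i ∈ L then e i.swap else e i) ∧
      ∀ w, (∀ i, e i ≠ w) → s w = w := by
    intro L
    induction L with
    | nil =>
      intro _
      refine ⟨id, fun ρ => ?_, fun i => by simp, fun w _ => rfl⟩
      have h : (controlled fun x : Bits ι => x ∘ id) = id := by
        funext x w
        rcases w with w | w
        · simp [controlled]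
        · rfl
      rw [h]
      rfl
    | cons j L ih =>
      intro hL
      obtain ⟨s, h1, h2, h3⟩ := ih (List.nodup_cons.mp hL).2
      have hj : j ∉ L := (List.nodup_cons.mp hL).1
      refine ⟨s ∘ Equiv.swap (e (.inl j)) (e (.inr j)), fun ρ => ?_, fun i => ?_, fun w hw => ?_⟩
      · rw [List.flatMap_cons, runGates_append, runGates_controlledSwapGates, h1,
          Matrix.submatrix_submatrix]
        congr 1 <;>
        · funext x
          rw [Function.comp, controlled_controlled]
          rfl
      · by_cases hi : Sum.elim id id i = j
        · rcases i with i | i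
          · obtain rfl : i = j := hi
            simp [h2, hj]
          · obtain rfl : i = j := hi
            simp [h2, hj]
        · have h4 : e i ≠ e (.inl j) := by
            intro h
            rw [e.injective h] at hi
            exact hi rfl
          have h5 : e i ≠ e (.inr j) := by
            intro h
            rw [e.injective h] at hi
            exact hi rfl
          rw [Function.comp, Equiv.swap_apply_of_ne_of_ne h4 h5, h2]
          simp [hi]
      · rw [Function.comp, Equiv.swap_apply_of_ne_of_ne (hw _).symm (hw _).symm, h3 w hw]
  obtain ⟨s, h1, h2, h3⟩ := key _ (Finset.nodup_toList (Finset.univ : Finset μ))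
  have h4 : (fun x : Bits ι => x ∘ s) = swapBits e := by
    funext x w
    by_cases hw : ∃ i, e i = w
    · obtain ⟨i, rfl⟩ := hw
      rw [swapBits, overwrite_emb, Function.comp, h2]
      simp
    · push Not at hw
      rw [swapBits, overwrite_of_forall_ne e _ _ hw, Function.comp, h3 w hw]
  rw [controlledSwapCircuit, h1, h4]

theorem hadamardCoeff_false_mul (a b : Bool) :
    hadamardCoeff a false * hadamardCoeff b false = 1 / 2 := by
  have h2 : ((Real.sqrt 2 : ℝ) : ℂ) * ((Real.sqrt 2 : ℝ) : ℂ) = 2 := by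
    rw [← Complex.ofReal_mul, Real.mul_self_sqrt (by norm_num)]
    simp
  rw [hadamardCoeff, hadamardCoeff, Bool.and_false, Bool.and_false, div_mul_div_comm, h2]
  simp

theorem hadamardCoeff_true_mul (a b : Bool) :
    hadamardCoeff true a * hadamardCoeff true b = (if a then -1 else 1) * (if b then -1 else 1) / 2 := by
  have h2 : ((Real.sqrt 2 : ℝ) : ℂ) * ((Real.sqrt 2 : ℝ) : ℂ) = 2 := by
    rw [← Complex.ofReal_mul, Real.mul_self_sqrt (by norm_num)]
    simp
  rw [hadamardCoeff, hadamardCoeff, Bool.true_and, Bool.true_and, div_mul_div_comm, h2]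

theorem hadamard_inr_apply (ρ : Op (ι ⊕ Unit)) (x y : Bits ι) (u v : Bits Unit) :
    (Gate.hadamard (Sum.inr ())).apply ρ (Sum.elim x u) (Sum.elim y v) =
      ∑ a, ∑ b, hadamardCoeff (u ()) a * hadamardCoeff (v ()) b *
        ρ (Sum.elim x fun _ => a) (Sum.elim y fun _ => b) := by
  have h : ∀ (x : Bits ι) (u : Bits Unit) (a : Bool),
      Function.update (Sum.elim x u) (Sum.inr ()) a = Sum.elim x fun _ => a := by
    intro x u a
    funext w
    rcases w with w | w
    · rfl
    · simp
  simp only [hadamard_apply, h, Sum.elim_inr]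

/-- Acceptance of the Hadamard test for a reversible map `F`. -/
theorem hadamardTest (C : List (Gate (ι ⊕ Unit))) (F : Bits ι → Bits ι)
    (hF : Function.Bijective F)
    (hC : ∀ ρ, runGates C ρ = ρ.submatrix (controlled F) (controlled F))
    (ρ : Op ι) (hρ : ρᴴ = ρ) :
    (∑ x : Bits (ι ⊕ Unit), if x (Sum.inr ()) then
      runGates (Gate.hadamard (Sum.inr ()) :: (C ++ [Gate.hadamard (Sum.inr ())]))
        (adjoinZeros Unit ρ) x x else 0).re = (ρ.trace.re - (∑ z, ρ (F z) z).re) / 2 := by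
  -- The first Hadamard gate puts the control wire in a uniform superposition, so each of its four
  -- blocks is half of `ρ`.
  have h1 : ∀ (x y : Bits ι) (u v : Bits Unit), (Gate.hadamard (Sum.inr ())).apply
      (adjoinZeros Unit ρ) (Sum.elim x u) (Sum.elim y v) = ρ x y / 2 := by
    intro x y u v
    have hz : ∀ a : Bool, ((fun _ : Unit => a) = zeros Unit) ↔ a = false := by
      intro a
      constructor
      · intro h
        exact congrFun h ()
      · rintro rfl
        rfl
    rw [hadamard_inr_apply]
    simp only [adjoinZeros, Matrix.of_apply, Sum.elim_comp_inl, Sum.elim_comp_inr, hz,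
      Fintype.sum_bool]
    simp only [hadamardCoeff_false_mul, and_false, false_and, if_false, mul_zero, and_self,
      if_true, zero_add, Bool.true_eq_false]
    ring
  have h2 : ∀ (x y : Bits ι) (a b : Bool), runGates C
      ((Gate.hadamard (Sum.inr ())).apply (adjoinZeros Unit ρ))
      (Sum.elim x fun _ => a) (Sum.elim y fun _ => b) =
      ρ (if a then F x else x) (if b then F y else y) / 2 := by
    intro x y a b
    rw [hC, Matrix.submatrix_apply, controlled, controlled, h1]
    simp only [Sum.elim_inr, Sum.elim_comp_inl]
    rfl
  -- Outcome `1` recombines the two branches with opposite signs, hence the minus sign of the cross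
  -- terms. They are complex conjugates because `ρ` is Hermitian; this yields a real part although
  -- `F` need not be an involution.
  have h3 : ∀ x : Bits ι, runGates (Gate.hadamard (Sum.inr ()) ::
      (C ++ [Gate.hadamard (Sum.inr ())])) (adjoinZeros Unit ρ)
      (Sum.elim x fun _ => true) (Sum.elim x fun _ => true) =
      (ρ x x + ρ (F x) (F x) - (ρ (F x) x + star (ρ (F x) x))) / 4 := by
    intro x
    change runGates (C ++ [Gate.hadamard (Sum.inr ())])
      ((Gate.hadamard (Sum.inr ())).apply (adjoinZeros Unit ρ)) _ _ = _
    rw [runGates_append]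
    change (Gate.hadamard (Sum.inr ())).apply (runGates C _) _ _ = _
    rw [hadamard_inr_apply]
    simp only [h2, hadamardCoeff_true_mul, Fintype.sum_bool]
    have h4 : star (ρ (F x) x) = ρ x (F x) := by
      conv_rhs => rw [← hρ]
      rw [Matrix.conjTranspose_apply]
    rw [h4]
    simp
    ring
  have h5 : ∑ x, ρ (F x) (F x) = ρ.trace := hF.sum_comp fun x => ρ x x
  have h6 : (∑ x : Bits (ι ⊕ Unit), if x (Sum.inr ()) then
      runGates (Gate.hadamard (Sum.inr ()) :: (C ++ [Gate.hadamard (Sum.inr ())]))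
        (adjoinZeros Unit ρ) x x else 0) =
      ∑ x : Bits ι, (ρ x x + ρ (F x) (F x) - (ρ (F x) x + star (ρ (F x) x))) / 4 := by
    rw [sum_bits_sum]
    refine Finset.sum_congr rfl fun x _ => ?_
    rw [← h3 x]
    rw [Finset.sum_eq_single (fun _ => true : Bits Unit)]
    · simp
    · intro b _ hb
      have : b () = false := by
        by_contra h
        exact hb (funext fun _ => by simpa using h)
      simp [this]
    · simp
  rw [h6, ← Finset.sum_div, Finset.sum_sub_distrib, Finset.sum_add_distrib,
    Finset.sum_add_distrib, h5, ← star_sum]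
  have h7 : ∑ x, ρ x x = ρ.trace := rfl
  rw [h7]
  have h8 : ∀ w : ℂ, (w / 4).re = w.re / 4 := fun w => by
    rw [show (4 : ℂ) = ((4 : ℝ) : ℂ) by norm_num, Complex.div_ofReal_re]
  rw [h8]
  simp only [Complex.sub_re, Complex.add_re, Complex.star_def, Complex.conj_re]
  ring

end HadamardTest

/-! ### The overlap functional -/

section Overlap

variable {μ τ ι : Type} [Fintype μ] [DecidableEq μ] [Fintype τ] [DecidableEq τ]
  [Fintype ι] [DecidableEq ι]

theorem IsLinearMap.map_sum_op {α β : Type} [Fintype α] [Fintype β] {Φ : Op α → Op β}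
    (h : IsLinearMap ℂ Φ) {S : Type*} (s : Finset S) (f : S → Op α) :
    Φ (∑ i ∈ s, f i) = ∑ i ∈ s, Φ (f i) :=
  map_sum (h.mk' Φ) f s

/-- Apply `Ψ` to the second register of `ρ`; the expectation of `SWAP · (A ⊗ 1)` on the first
register and the output. -/
def overlap (A : Op μ) (Ψ : Op τ → Op μ) (ρ : Op (μ ⊕ τ)) : ℂ :=
  ∑ a, ∑ b, ∑ r, A r a * Ψ (Matrix.of fun s t => ρ (Sum.elim a s) (Sum.elim b t)) b r

theorem isLinearMap_overlap {Ψ : Op τ → Op μ} (hΨ : IsLinearMap ℂ Ψ) (A : Op μ) :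
    IsLinearMap ℂ (overlap A Ψ) := by
  constructor
  · intro ρ σ
    have h : ∀ a b, (Matrix.of fun s t => (ρ + σ) (Sum.elim a s) (Sum.elim b t)) =
        (Matrix.of fun s t => ρ (Sum.elim a s) (Sum.elim b t)) +
          (Matrix.of fun s t => σ (Sum.elim a s) (Sum.elim b t)) := fun a b => rfl
    simp only [overlap, h, hΨ.map_add]
    simp only [Matrix.add_apply, mul_add, Finset.sum_add_distrib]
  · intro c ρ
    have h : ∀ a b, (Matrix.of fun s t => (c • ρ) (Sum.elim a s) (Sum.elim b t)) =
        c • (Matrix.of fun s t => ρ (Sum.elim a s) (Sum.elim b t)) := fun a b => rfl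
    simp only [overlap, h, hΨ.map_smul]
    simp only [Matrix.smul_apply, smul_eq_mul, Finset.mul_sum, mul_left_comm c]

theorem overlap_sub (A B : Op μ) (Ψ : Op τ → Op μ) (ρ : Op (μ ⊕ τ)) :
    overlap (A - B) Ψ ρ = overlap A Ψ ρ - overlap B Ψ ρ := by
  simp only [overlap, Matrix.sub_apply, sub_mul, Finset.sum_sub_distrib]

theorem overlap_smul (c : ℂ) (A : Op μ) (Ψ : Op τ → Op μ) (ρ : Op (μ ⊕ τ)) :
    overlap (c • A) Ψ ρ = c * overlap A Ψ ρ := by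
  simp only [overlap, Matrix.smul_apply, smul_eq_mul, Finset.mul_sum, mul_assoc]

/-- On a pure message in a product with the tag, the trace against SWAP becomes a matrix element. If
`A ψ = ψ`, it is the fidelity of the verified output with the message. -/
theorem overlap_pure (A : Op μ) {Ψ : Op τ → Op μ} (hΨ : IsLinearMap ℂ Ψ) {ψ : Bits μ → ℂ}
    {X : Op τ} {ρ : Op (μ ⊕ τ)}
    (h : ∀ a b s t, ρ (Sum.elim a s) (Sum.elim b t) = ψ a * star (ψ b) * X s t) :
    overlap A Ψ ρ = star ψ ⬝ᵥ (Ψ X *ᵥ (A *ᵥ ψ)) := by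
  have h1 : ∀ a b, (Matrix.of fun s t => ρ (Sum.elim a s) (Sum.elim b t)) =
      (ψ a * star (ψ b)) • X := by
    intro a b
    ext s t
    simp [h]
  simp only [overlap, h1, hΨ.map_smul, Matrix.smul_apply, smul_eq_mul, dotProduct, Matrix.mulVec,
    Finset.mul_sum, Pi.star_apply]
  rw [Finset.sum_comm]
  refine Finset.sum_congr rfl fun b _ => ?_
  rw [Finset.sum_comm]
  refine Finset.sum_congr rfl fun r _ => ?_
  refine Finset.sum_congr rfl fun a _ => ?_
  ring

/-- The tag and the output register among the message, tag and output registers. -/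
def tagOut (E : (μ ⊕ τ) ⊕ μ ↪ ι) : τ ⊕ μ ↪ ι :=
  ⟨Sum.elim (fun t => E (.inl (.inr t))) fun r => E (.inr r), by
    rintro (a | a) (b | b) h <;> simp at h ⊢ <;> exact h⟩

/-- The message and the output register among the message, tag and output registers. -/
def msgOut (E : (μ ⊕ τ) ⊕ μ ↪ ι) : μ ⊕ μ ↪ ι :=
  ⟨Sum.elim (fun a => E (.inl (.inl a))) fun r => E (.inr r), by
    rintro (a | a) (b | b) h <;> simp at h ⊢ <;> exact h⟩

/-- This identifies an expectation after a call inside a large register with a functional of the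
message-tag marginal before it. Taking `A = 1` gives the plain SWAP, and a density matrix for `A`
gives the 3-cycle with an additional register. -/
theorem sum_call_eq_overlap {Ψ : Op τ → Op μ} (hΨ : IsLinearMap ℂ Ψ) (E : (μ ⊕ τ) ⊕ μ ↪ ι)
    (A : Op μ) (ρ : Op ι) :
    ∑ x : Bits ι, ∑ a : Bits μ, A (x ∘ E ∘ Sum.inr) a * call Ψ (tagOut E) ρ
        (overwrite (msgOut E) (Sum.elim a (x ∘ E ∘ Sum.inl ∘ Sum.inl)) x) x =
      overlap A Ψ (reduced (Function.Embedding.inl.trans E) ρ) := by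
  let M : Bits ι → Bits μ → Bits μ → Op τ := fun z a b => Matrix.of fun s t => ∑ c : Bits μ,
    ρ (overwrite E (Sum.elim (Sum.elim a s) c) z) (overwrite E (Sum.elim (Sum.elim b t) c) z)
  have hN : ∀ a b, (Matrix.of fun s t => reduced (Function.Embedding.inl.trans E) ρ
      (Sum.elim a s) (Sum.elim b t)) =
      ∑ z : Bits ι, if z ∘ E = zeros _ then M z a b else 0 := by
    intro a b
    ext s t
    rw [Matrix.of_apply, reduced_inl, Matrix.sum_apply]
    simp only [reduced, Matrix.of_apply]
    rw [Finset.sum_comm]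
    refine Finset.sum_congr rfl fun z _ => ?_
    split_ifs <;> simp [M]
  -- The call resets the tag wires, so only `s = zeros τ` survives. Its argument `M z a b` no longer
  -- depends on `s` and `r`, because those wires are summed over or overwritten.
  have hx : ∀ (z : Bits ι) (a b r : Bits μ) (s : Bits τ),
      call Ψ (tagOut E) ρ (overwrite (msgOut E) (Sum.elim a b)
        (overwrite E (Sum.elim (Sum.elim b s) r) z)) (overwrite E (Sum.elim (Sum.elim b s) r) z) =
      if s = zeros τ then Ψ (M z a b) b r else 0 := by
    intro z a b r s
    have e1 : overwrite E (Sum.elim (Sum.elim b s) r) z ∘ tagOut E ∘ Sum.inl = s :=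
      funext fun t => overwrite_emb E _ _ (.inl (.inr t))
    have e2 : overwrite E (Sum.elim (Sum.elim b s) r) z ∘ tagOut E ∘ Sum.inr = r :=
      funext fun t => overwrite_emb E _ _ (.inr t)
    have e3 : overwrite (msgOut E) (Sum.elim a b) (overwrite E (Sum.elim (Sum.elim b s) r) z) ∘
        tagOut E ∘ Sum.inl = s := by
      funext t
      rw [Function.comp, overwrite_of_forall_ne]
      · exact overwrite_emb E _ _ (.inl (.inr t))
      · rintro (j | j) h
        · exact absurd (E.injective h) (by simp)
        · exact absurd (E.injective h) (by simp)
    have e4 : overwrite (msgOut E) (Sum.elim a b) (overwrite E (Sum.elim (Sum.elim b s) r) z) ∘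
        tagOut E ∘ Sum.inr = b :=
      funext fun t => overwrite_emb (msgOut E) _ _ (.inr t)
    have e5 : ∀ (w : Bits ((μ ⊕ τ) ⊕ μ)) (t : Bits τ) (c : Bits μ),
        overwrite (tagOut E) (Sum.elim t c) (overwrite E w z) =
        overwrite E (Sum.elim (Sum.elim (w ∘ Sum.inl ∘ Sum.inl) t) c) z := by
      intro w t c
      funext i
      by_cases hi : ∃ j, E j = i
      · obtain ⟨(j | j) | j, rfl⟩ := hi
        · rw [overwrite_emb, overwrite_of_forall_ne, overwrite_emb]
          · rfl
          · rintro (k | k) h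
            · exact absurd (E.injective h) (by simp)
            · exact absurd (E.injective h) (by simp)
        · rw [overwrite_emb]
          exact overwrite_emb (tagOut E) _ _ (.inl j)
        · rw [overwrite_emb]
          exact overwrite_emb (tagOut E) _ _ (.inr j)
      · push Not at hi
        rw [overwrite_of_forall_ne E _ _ hi, overwrite_of_forall_ne, overwrite_of_forall_ne E _ _ hi]
        rintro (j | j)
        · exact hi _
        · exact hi _
    have e6 : overwrite (msgOut E) (Sum.elim a b) (overwrite E (Sum.elim (Sum.elim b s) r) z) =
        overwrite E (Sum.elim (Sum.elim a s) b) z := by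
      funext i
      by_cases hi : ∃ j, E j = i
      · obtain ⟨(j | j) | j, rfl⟩ := hi
        · rw [overwrite_emb]
          exact overwrite_emb (msgOut E) _ _ (.inl j)
        · rw [overwrite_emb, overwrite_of_forall_ne, overwrite_emb]
          · rfl
          · rintro (k | k) h
            · exact absurd (E.injective h) (by simp)
            · exact absurd (E.injective h) (by simp)
        · rw [overwrite_emb]
          exact overwrite_emb (msgOut E) _ _ (.inr j)
      · push Not at hi
        rw [overwrite_of_forall_ne E _ _ hi, overwrite_of_forall_ne, overwrite_of_forall_ne E _ _ hi]
        rintro (j | j)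
        · exact hi _
        · exact hi _
    have e7 : callArg (tagOut E) ρ (overwrite (msgOut E) (Sum.elim a b)
        (overwrite E (Sum.elim (Sum.elim b s) r) z))
        (overwrite E (Sum.elim (Sum.elim b s) r) z) = M z a b := by
      ext t t'
      rw [e6]
      simp only [callArg, Matrix.of_apply, e5, M]
      rfl
    simp only [call_apply, e7, e1, e2, e3, e4, and_self]
  have hR : ∀ (z : Bits ι) (b r : Bits μ) (s : Bits τ),
      overwrite E (Sum.elim (Sum.elim b s) r) z ∘ E ∘ Sum.inr = r := fun z b r s =>
    funext fun t => overwrite_emb E _ _ (.inr t)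
  have hM : ∀ (z : Bits ι) (b r : Bits μ) (s : Bits τ),
      overwrite E (Sum.elim (Sum.elim b s) r) z ∘ E ∘ Sum.inl ∘ Sum.inl = b := fun z b r s =>
    funext fun t => overwrite_emb E _ _ (.inl (.inl t))
  rw [sum_bits_overwrite E]
  simp only [sum_bits_sum, hR, hM, hx, overlap, hN, IsLinearMap.map_sum_op hΨ, Matrix.sum_apply,
    Finset.mul_sum]
  have hif : ∀ (z : Bits ι) (a b : Bits μ), Ψ (if z ∘ E = zeros _ then M z a b else 0) =
      if z ∘ E = zeros _ then Ψ (M z a b) else 0 := by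
    intro z a b
    split_ifs
    · rfl
    · exact hΨ.map_zero
  simp only [hif]
  rw [Finset.sum_congr rfl fun a _ => Finset.sum_congr rfl fun b _ => Finset.sum_comm]
  rw [Finset.sum_congr rfl fun a _ => Finset.sum_comm, Finset.sum_comm]
  refine Finset.sum_congr rfl fun z _ => ?_
  split_ifs with hz
  · trans ∑ b, ∑ r, ∑ a, A r a * Ψ (M z a b) b r
    swap
    · exact Finset.sum_comm_cycle
    refine Finset.sum_congr rfl fun b _ => ?_
    rw [Finset.sum_eq_single (zeros τ)]
    · simp only [if_true]
    · intro s _ hs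
      simp [hs]
    · simp
  · simp

end Overlap

/-! ### Calls of an isometry -/

section IsometryCalls

variable {α β ι κ : Type} [Fintype α] [DecidableEq α] [Fintype β] [DecidableEq β]
  [Fintype ι] [DecidableEq ι] [Fintype κ] [DecidableEq κ]

theorem isLinearMap_isomChannel (V : Isom α β) : IsLinearMap ℂ (isomChannel V) := by
  constructor
  · intro X Y
    simp only [isomChannel, Matrix.mul_add, Matrix.add_mul]
  · intro c X
    simp only [isomChannel, Matrix.mul_smul, Matrix.smul_mul]

theorem trace_isomChannel (V : Isom α β) (X : Op α) : (isomChannel V X).trace = X.trace := by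
  rw [isomChannel, Matrix.trace_mul_comm, ← Matrix.mul_assoc, V.2, Matrix.one_mul]

theorem isomChannel_apply (V : Isom α β) (X : Op α) (x y : Bits (α ⊕ β)) :
    isomChannel V X x y = ∑ a, ∑ b, V.1 x a * star (V.1 y b) * X a b := by
  simp only [isomChannel, Matrix.mul_apply, Matrix.conjTranspose_apply, Finset.sum_mul]
  rw [Finset.sum_comm]
  exact Finset.sum_congr rfl fun a _ => Finset.sum_congr rfl fun b _ => by ring

/-- Decompose `ρ` into rank-one terms and apply `V` to each vector for every discarded content of
the output wires. Collecting these vectors as columns of `G` writes the result as `G G†`. -/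
theorem posSemidef_call_isomChannel (V : Isom α β) (e : α ⊕ (α ⊕ β) ↪ ι) {ρ : Op ι}
    (hρ : ρ.PosSemidef) : (call (isomChannel V) e ρ).PosSemidef := by
  obtain ⟨m, v, rfl⟩ := Matrix.posSemidef_iff_eq_sum_vecMulVec.mp hρ
  let G : Matrix (Bits ι) (Bits (α ⊕ β) × Fin m) ℂ := Matrix.of fun x p =>
    if x ∘ e ∘ Sum.inl = zeros α then
      ∑ a, V.1 (x ∘ e ∘ Sum.inr) a * v p.2 (overwrite e (Sum.elim a p.1) x) else 0
  have h : call (isomChannel V) e (∑ i, Matrix.vecMulVec (v i) (star (v i))) = G * Gᴴ := by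
    ext x y
    rw [call_apply, Matrix.mul_apply]
    by_cases hx : x ∘ e ∘ Sum.inl = zeros α
    · by_cases hy : y ∘ e ∘ Sum.inl = zeros α
      · have h1 : ∀ p : Bits (α ⊕ β) × Fin m, G x p * Gᴴ p y =
            ∑ a, ∑ b, V.1 (x ∘ e ∘ Sum.inr) a * star (V.1 (y ∘ e ∘ Sum.inr) b) *
              (v p.2 (overwrite e (Sum.elim a p.1) x) *
                star (v p.2 (overwrite e (Sum.elim b p.1) y))) := by
          intro p
          simp only [G, hx, hy, if_true, Matrix.of_apply, Matrix.conjTranspose_apply, star_sum,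
            star_mul', Finset.sum_mul_sum]
          exact Finset.sum_congr rfl fun a _ => Finset.sum_congr rfl fun b _ => by ring
        simp only [h1, hx, hy, and_self, if_true, isomChannel_apply]
        rw [← Finset.sum_comm_cycle]
        refine Finset.sum_congr rfl fun a _ => Finset.sum_congr rfl fun b _ => ?_
        rw [← Finset.mul_sum, Fintype.sum_prod_type]
        simp only [callArg, Matrix.of_apply, Matrix.sum_apply, Matrix.vecMulVec_apply,
          Pi.star_apply]
      · simp [G, hx, hy]
    · simp [G, hx]
  rw [h]
  exact Matrix.posSemidef_self_mul_conjTranspose G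

theorem isDensity_call_isomChannel (V : Isom α β) (e : α ⊕ (α ⊕ β) ↪ ι) {ρ : Op ι}
    (hρ : IsDensity ρ) : IsDensity (call (isomChannel V) e ρ) :=
  ⟨posSemidef_call_isomChannel V e hρ.1, (trace_call (trace_isomChannel V) e ρ).trans hρ.2⟩

/-- When the input register is in the pure state `ψ`, every block fed to the channel is a multiple
of `|ψ⟩⟨ψ|`, so only the vector `V ψ` enters. -/
theorem call_isomChannel_congr {V V' : Isom α β} {ψ : Bits α → ℂ} (h : V.1 *ᵥ ψ = V'.1 *ᵥ ψ)
    (e : α ⊕ (α ⊕ β) ↪ ι) {ρ : Op ι} (hρ : PureOn (Function.Embedding.inl.trans e) ψ ρ) :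
    call (isomChannel V) e ρ = call (isomChannel V') e ρ := by
  obtain ⟨R, hR, hρ⟩ := hρ
  have h1 : ∀ x y, callArg e ρ x y = callArg e (Matrix.of R) x y (zeros α) (zeros α) •
      Matrix.vecMulVec ψ (star ψ) := by
    intro x y
    ext a b
    simp only [callArg, Matrix.of_apply, hρ, ← overwrite_inl_overwrite_inr, overwrite_comp,
      hR _ _ (overwrite _ _ _), Matrix.smul_apply, Matrix.vecMulVec_apply, Pi.star_apply,
      smul_eq_mul, Finset.sum_mul]
    exact Finset.sum_congr rfl fun c _ => mul_comm _ _
  have h2 : isomChannel V (Matrix.vecMulVec ψ (star ψ)) =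
      isomChannel V' (Matrix.vecMulVec ψ (star ψ)) := by
    simp only [isomChannel, Matrix.mul_vecMulVec, Matrix.vecMulVec_mul, ← Matrix.star_mulVec, h]
  ext x y
  simp only [call_apply, h1, (isLinearMap_isomChannel V).map_smul,
    (isLinearMap_isomChannel V').map_smul, h2]

theorem slot_disjointWires {δ : Type} {q : ℕ} (e : Fin q × δ ↪ ι) {i j : Fin q} (h : i ≠ j) :
    DisjointWires (slot e i) (slot e j) := by
  intro a b hab
  exact h (Prod.mk.inj (e.injective hab)).1

/-- Apply a channel to each of a list of slots. -/
def callSlots {q : ℕ} (Φ : Op α → Op β) (e : Fin q × (α ⊕ β) ↪ ι) (L : List (Fin q))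
    (ρ : Op ι) : Op ι :=
  L.foldl (fun σ i => call Φ (slot e i) σ) ρ

theorem isLinearMap_callSlots {q : ℕ} {Φ : Op α → Op β} (hΦ : IsLinearMap ℂ Φ)
    (e : Fin q × (α ⊕ β) ↪ ι) (L : List (Fin q)) : IsLinearMap ℂ (callSlots Φ e L) := by
  induction L with
  | nil => exact ⟨fun _ _ => rfl, fun _ _ => rfl⟩
  | cons i L ih =>
    constructor
    · intro ρ σ
      change callSlots Φ e L (call Φ (slot e i) (ρ + σ)) =
        callSlots Φ e L (call Φ (slot e i) ρ) + callSlots Φ e L (call Φ (slot e i) σ)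
      rw [(isLinearMap_call hΦ _).map_add, ih.map_add]
    · intro c ρ
      change callSlots Φ e L (call Φ (slot e i) (c • ρ)) =
        c • callSlots Φ e L (call Φ (slot e i) ρ)
      rw [(isLinearMap_call hΦ _).map_smul, ih.map_smul]

theorem isDensity_callSlots {q : ℕ} (V : Isom α β) (e : Fin q × (α ⊕ (α ⊕ β)) ↪ ι)
    (L : List (Fin q)) {ρ : Op ι} (hρ : IsDensity ρ) :
    IsDensity (callSlots (isomChannel V) e L ρ) := by
  induction L generalizing ρ with
  | nil => exact hρ
  | cons i L ih => exact ih (isDensity_call_isomChannel V _ hρ)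

/-- The isometries are exchanged one call at a time. A call leaves the messages in the other slots
pure, since the slots are disjoint. -/
theorem callSlots_congr {q : ℕ} {V V' : Isom α β} {ψ : Fin q → Bits α → ℂ}
    (h : ∀ i, V.1 *ᵥ ψ i = V'.1 *ᵥ ψ i) (e : Fin q × (α ⊕ (α ⊕ β)) ↪ ι) {L : List (Fin q)}
    (hL : L.Nodup) {ρ : Op ι}
    (hρ : ∀ i ∈ L, PureOn (Function.Embedding.inl.trans (slot e i)) (ψ i) ρ) :
    callSlots (isomChannel V) e L ρ = callSlots (isomChannel V') e L ρ := by
  induction L generalizing ρ with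
  | nil => rfl
  | cons i L ih =>
    rw [List.nodup_cons] at hL
    change callSlots _ e L (call _ (slot e i) ρ) = callSlots _ e L (call _ (slot e i) ρ)
    rw [call_isomChannel_congr (h i) _ (hρ i List.mem_cons_self)]
    refine ih hL.2 fun j hj => ?_
    refine (hρ j (List.mem_cons_of_mem i hj)).call_disjoint (isLinearMap_isomChannel V') ?_
    intro a b
    exact slot_disjointWires e (fun hij : i = j => hL.1 (hij ▸ hj)) a (.inl b)

end IsometryCalls

/-! ### Inverse channels and Haar measures -/

section InverseChannel

variable {α β : Type} [Fintype α] [DecidableEq α] [Fintype β] [DecidableEq β]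

/-- Undo the unitary `U` and discard the auxiliary register. -/
def unitaryInverse (U : UGroup (α ⊕ β)) (X : Op (α ⊕ β)) : Op α :=
  traceAux ((U : Op (α ⊕ β))ᴴ * X * (U : Op (α ⊕ β)))

theorem trace_traceAux (X : Op (α ⊕ β)) : (traceAux X).trace = X.trace := by
  simp only [Matrix.trace, Matrix.diag_apply, traceAux, Matrix.of_apply]
  rw [sum_bits_sum]

theorem UGroup.mul_conjTranspose {ι : Type} [Fintype ι] [DecidableEq ι] (U : UGroup ι) :
    (U : Op ι) * (U : Op ι)ᴴ = 1 := Matrix.mem_unitaryGroup_iff.mp U.2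

theorem UGroup.conjTranspose_mul {ι : Type} [Fintype ι] [DecidableEq ι] (U : UGroup ι) :
    (U : Op ι)ᴴ * (U : Op ι) = 1 := Matrix.mem_unitaryGroup_iff'.mp U.2

theorem trace_unitaryInverse (U : UGroup (α ⊕ β)) (X : Op (α ⊕ β)) :
    (unitaryInverse U X).trace = X.trace := by
  rw [unitaryInverse, trace_traceAux, Matrix.mul_assoc, Matrix.trace_mul_comm, Matrix.mul_assoc,
    UGroup.mul_conjTranspose, Matrix.mul_one]

theorem isLinearMap_unitaryInverse (U : UGroup (α ⊕ β)) : IsLinearMap ℂ (unitaryInverse U) := by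
  constructor
  · intro X Y
    ext x y
    simp [unitaryInverse, traceAux, Matrix.mul_add, Matrix.add_mul, Finset.sum_add_distrib]
  · intro c X
    ext x y
    simp [unitaryInverse, traceAux, Finset.mul_sum]

theorem posSemidef_unitaryInverse (U : UGroup (α ⊕ β)) {X : Op (α ⊕ β)} (hX : X.PosSemidef) :
    (unitaryInverse U X).PosSemidef := by
  have h : ∀ Y : Op (α ⊕ β), traceAux Y = ∑ c : Bits β,
      Y.submatrix (fun x => Sum.elim x c) (fun x => Sum.elim x c) := by
    intro Y
    ext x y
    simp [traceAux, Matrix.sum_apply]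
  rw [unitaryInverse, h]
  exact Matrix.posSemidef_sum _ fun c _ => (hX.conjTranspose_mul_mul_same _).submatrix _

theorem conjTranspose_unitaryInverse (U : UGroup (α ⊕ β)) (X : Op (α ⊕ β)) :
    unitaryInverse U Xᴴ = (unitaryInverse U X)ᴴ := by
  have h : ∀ Y : Op (α ⊕ β), traceAux Yᴴ = (traceAux Y)ᴴ := by
    intro Y
    ext x y
    simp [traceAux]
  rw [unitaryInverse, unitaryInverse, ← h]
  simp [Matrix.mul_assoc]

theorem continuous_unitaryInverse {T : Type*} [TopologicalSpace T] {U : T → UGroup (α ⊕ β)}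
    {X : T → Op (α ⊕ β)} (hU : Continuous U) (hX : Continuous X) :
    Continuous fun t => unitaryInverse (U t) (X t) := by
  have h1 : Continuous fun t => (U t : Op (α ⊕ β)) := continuous_subtype_val.comp hU
  have h2 : Continuous fun t => (U t : Op (α ⊕ β))ᴴ * X t * (U t : Op (α ⊕ β)) :=
    (h1.matrix_conjTranspose.matrix_mul hX).matrix_mul h1
  refine continuous_matrix fun x y => ?_
  simp only [unitaryInverse, traceAux, Matrix.of_apply]
  exact continuous_finsetSum _ fun c _ => h2.matrix_elem _ _

instance (ι : Type) [Fintype ι] [DecidableEq ι] : IsProbabilityMeasure (haarUnitary ι) :=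
  ⟨by simpa [haarUnitary] using Measure.haarMeasure_self (K₀ := (⊤ : TopologicalSpace.PositiveCompacts (UGroup ι)))⟩

/-- The Haar probability measure of the unitaries that fix every state `|ψ⟩|0⟩`. -/
def haarStabilizer (α β : Type) [Fintype α] [DecidableEq α] [Fintype β] [DecidableEq β] :
    Measure ↥(stabilizerZeros α β) := Measure.haarMeasure ⊤

instance : IsProbabilityMeasure (haarStabilizer α β) :=
  ⟨by simpa [haarStabilizer] using Measure.haarMeasure_self (K₀ := (⊤ : TopologicalSpace.PositiveCompacts (stabilizerZeros α β)))⟩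

instance : (haarStabilizer α β).IsHaarMeasure := by
  unfold haarStabilizer
  infer_instance

instance (ι : Type) [Fintype ι] [DecidableEq ι] : (haarUnitary ι).IsHaarMeasure := by
  unfold haarUnitary
  infer_instance

/-- A right translate of Haar measure is again a Haar probability measure, and on a compact group
there is only one. -/
instance (ι : Type) [Fintype ι] [DecidableEq ι] : (haarUnitary ι).IsMulRightInvariant := by
  constructor
  intro g
  have hm : Measurable fun U : UGroup ι => U * g := (continuous_mul_const g).measurable
  have : IsProbabilityMeasure (Measure.map (fun U : UGroup ι => U * g) (haarUnitary ι)) :=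
    Measure.isProbabilityMeasure_map hm.aemeasurable
  exact Measure.isHaarMeasure_eq_of_isProbabilityMeasure _ _

/-- The consistent unitary `U₀` chosen in the definition equals `U` times the element `U⁻¹ U₀` of
the stabilizer. Left invariance on the stabilizer absorbs that element, so `U` itself can serve as
base point of the coset. -/
theorem inverseChannel_truncate (U : UGroup (α ⊕ β)) (X : Op (α ⊕ β)) (x y : Bits α) :
    inverseChannel (truncate U) X x y =
      ∫ W, unitaryInverse (U * (W : UGroup (α ⊕ β))) X x y ∂(haarStabilizer α β) := by
  set U₀ := (exists_consistent (truncate U)).choose with hU₀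
  have hc : (U₀ : Op (α ⊕ β)) * appendZeros α β = (U : Op (α ⊕ β)) * appendZeros α β :=
    (exists_consistent (truncate U)).choose_spec
  have hW : U⁻¹ * U₀ ∈ stabilizerZeros α β := by
    change ((U⁻¹ * U₀ : UGroup (α ⊕ β)) : Op (α ⊕ β)) * appendZeros α β = appendZeros α β
    have h1 : ((U⁻¹ * U : UGroup (α ⊕ β)) : Op (α ⊕ β)) = 1 := by simp
    rw [Submonoid.coe_mul, Matrix.mul_assoc, hc, ← Matrix.mul_assoc, ← Submonoid.coe_mul, h1,
      Matrix.one_mul]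
  have hcont : Continuous fun V : UGroup (α ⊕ β) => unitaryInverse V X x y :=
    (continuous_unitaryInverse continuous_id continuous_const).matrix_elem x y
  have hmeas : Measurable fun W : ↥(stabilizerZeros α β) => U₀ * (W : UGroup (α ⊕ β)) :=
    (continuous_const.mul continuous_subtype_val).measurable
  have h2 : inverseChannel (truncate U) X x y = ∫ V, unitaryInverse V X x y
      ∂(Measure.map (fun W : ↥(stabilizerZeros α β) => U₀ * (W : UGroup (α ⊕ β)))
        (haarStabilizer α β)) := rfl
  rw [h2, integral_map hmeas.aemeasurable hcont.aestronglyMeasurable]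
  rw [← integral_mul_left_eq_self (μ := haarStabilizer α β)
    (fun W => unitaryInverse (U * (W : UGroup (α ⊕ β))) X x y) ⟨_, hW⟩]
  simp only [Subgroup.coe_mul, ← mul_assoc, mul_inv_cancel, one_mul]

theorem exists_truncate_eq (V : Isom α β) : ∃ U, truncate U = V := by
  obtain ⟨U, hU⟩ := exists_consistent V
  exact ⟨U, Subtype.ext hU⟩

end InverseChannel

/-! ### Averaging over the stabilizer -/

section InverseChannelIntegral

variable {α β : Type} [Fintype α] [DecidableEq α] [Fintype β] [DecidableEq β]

theorem integrable_of_continuous {T : Type*} [TopologicalSpace T] [CompactSpace T]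
    [MeasurableSpace T] [OpensMeasurableSpace T] {E : Type*} [NormedAddCommGroup E]
    [SecondCountableTopologyEither T E] {ν : Measure T}
    [IsFiniteMeasureOnCompacts ν] {f : T → E} (hf : Continuous f) : Integrable f ν :=
  hf.integrable_of_hasCompactSupport (HasCompactSupport.of_compactSpace f)

instance (ι : Type) [Fintype ι] [DecidableEq ι] : FirstCountableTopology (UGroup ι) := by
  have : FirstCountableTopology (Op ι) :=
    inferInstanceAs (FirstCountableTopology (Bits ι → Bits ι → ℂ))
  exact Topology.IsInducing.subtypeVal.firstCountableTopology

theorem continuous_unitaryInverse_stabilizer (U : UGroup (α ⊕ β)) (X : Op (α ⊕ β)) :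
    Continuous fun W : ↥(stabilizerZeros α β) => unitaryInverse (U * (W : UGroup (α ⊕ β))) X :=
  continuous_unitaryInverse (continuous_const.mul continuous_subtype_val) continuous_const

theorem integrable_unitaryInverse_stabilizer (U : UGroup (α ⊕ β)) (X : Op (α ⊕ β))
    (x y : Bits α) : Integrable (fun W : ↥(stabilizerZeros α β) =>
      unitaryInverse (U * (W : UGroup (α ⊕ β))) X x y) (haarStabilizer α β) :=
  integrable_of_continuous ((continuous_unitaryInverse_stabilizer U X).matrix_elem x y)

theorem isLinearMap_inverseChannel (V : Isom α β) : IsLinearMap ℂ (inverseChannel V) := by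
  obtain ⟨U, rfl⟩ := exists_truncate_eq V
  constructor
  · intro X Y
    ext x y
    rw [Matrix.add_apply]
    simp only [inverseChannel_truncate, (isLinearMap_unitaryInverse _).map_add, Matrix.add_apply]
    exact integral_add (integrable_unitaryInverse_stabilizer U X x y)
      (integrable_unitaryInverse_stabilizer U Y x y)
  · intro c X
    ext x y
    rw [Matrix.smul_apply]
    simp only [inverseChannel_truncate, (isLinearMap_unitaryInverse _).map_smul,
      Matrix.smul_apply]
    exact integral_smul c _

theorem conjTranspose_inverseChannel (V : Isom α β) (X : Op (α ⊕ β)) :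
    inverseChannel V Xᴴ = (inverseChannel V X)ᴴ := by
  obtain ⟨U, rfl⟩ := exists_truncate_eq V
  ext x y
  rw [Matrix.conjTranspose_apply, inverseChannel_truncate, inverseChannel_truncate]
  simp only [conjTranspose_unitaryInverse, Matrix.conjTranspose_apply]
  exact integral_conj

/-- Trace, overlap and fidelity of the inverse channel are all finite combinations of entries; this
moves the integral outside each of them. -/
theorem sum_inverseChannel_truncate {S : Type*} [Fintype S] (U : UGroup (α ⊕ β))
    (w : S → ℂ) (X : S → Op (α ⊕ β)) (x y : S → Bits α) :
    ∑ s, w s * inverseChannel (truncate U) (X s) (x s) (y s) =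
      ∫ W, ∑ s, w s * unitaryInverse (U * (W : UGroup (α ⊕ β))) (X s) (x s) (y s)
        ∂(haarStabilizer α β) := by
  rw [integral_finsetSum _ fun s _ =>
    (integrable_unitaryInverse_stabilizer U (X s) (x s) (y s)).const_mul (w s)]
  simp only [inverseChannel_truncate, integral_const_mul]

theorem trace_inverseChannel (V : Isom α β) (X : Op (α ⊕ β)) :
    (inverseChannel V X).trace = X.trace := by
  obtain ⟨U, rfl⟩ := exists_truncate_eq V
  have h := sum_inverseChannel_truncate U (fun _ : Bits α => 1) (fun _ => X) id id
  have h1 : ∀ Y : Op α, ∑ x, Y x x = Y.trace := fun Y => rfl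
  simp only [one_mul, id, h1, trace_unitaryInverse] at h
  simpa using h

theorem overlap_eq_sum {τ : Type} [Fintype τ] (A : Op α) (Ψ : Op τ → Op α) (ρ : Op (α ⊕ τ)) :
    overlap A Ψ ρ = ∑ p : Bits α × Bits α × Bits α, A p.2.2 p.1 *
      Ψ (Matrix.of fun s t => ρ (Sum.elim p.1 s) (Sum.elim p.2.1 t)) p.2.1 p.2.2 := by
  simp only [overlap, Fintype.sum_prod_type]

theorem overlap_inverseChannel_truncate (A : Op α) (U : UGroup (α ⊕ β)) (ρ : Op (α ⊕ (α ⊕ β))) :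
    overlap A (inverseChannel (truncate U)) ρ =
      ∫ W, overlap A (unitaryInverse (U * (W : UGroup (α ⊕ β)))) ρ ∂(haarStabilizer α β) := by
  simp only [overlap_eq_sum]
  exact sum_inverseChannel_truncate U (fun p : Bits α × Bits α × Bits α => A p.2.2 p.1)
    (fun p => Matrix.of fun s t => ρ (Sum.elim p.1 s) (Sum.elim p.2.1 t)) (fun p => p.2.1)
    fun p => p.2.2

theorem continuous_overlap_unitaryInverse {T : Type*} [TopologicalSpace T] (A : Op α)
    {U : T → UGroup (α ⊕ β)} {ρ : T → Op (α ⊕ (α ⊕ β))} (hU : Continuous U)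
    (hρ : Continuous ρ) : Continuous fun t => overlap A (unitaryInverse (U t)) (ρ t) := by
  unfold overlap
  refine continuous_finsetSum _ fun a _ => continuous_finsetSum _ fun b _ =>
    continuous_finsetSum _ fun r _ => continuous_const.mul ?_
  refine (continuous_unitaryInverse hU (continuous_matrix fun s t => ?_)).matrix_elem b r
  exact hρ.matrix_elem _ _

theorem continuous_overlap_inverseChannel (A : Op α) {ρ : UGroup (α ⊕ β) → Op (α ⊕ (α ⊕ β))}
    (hρ : Continuous ρ) :
    Continuous fun U => overlap A (inverseChannel (truncate U)) (ρ U) := by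
  simp only [overlap_inverseChannel_truncate]
  have h : Continuous (Function.uncurry fun (U : UGroup (α ⊕ β)) (W : ↥(stabilizerZeros α β)) =>
      overlap A (unitaryInverse (U * (W : UGroup (α ⊕ β)))) (ρ U)) :=
    continuous_overlap_unitaryInverse A
      (continuous_fst.mul (continuous_subtype_val.comp continuous_snd)) (hρ.comp continuous_fst)
  simpa using continuous_parametric_integral_of_continuous (μ := haarStabilizer α β) h
    isCompact_univ

/-- Averaged over a Haar unitary, the inverse of the isometry may be replaced by the inverse of
the unitary. -/
theorem integral_overlap_inverseChannel (A : Op α) {ρ : UGroup (α ⊕ β) → Op (α ⊕ (α ⊕ β))}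
    (hρ : Continuous ρ) (hW : ∀ U, ∀ W ∈ stabilizerZeros α β, ρ (U * W) = ρ U) :
    ∫ U, overlap A (inverseChannel (truncate U)) (ρ U) ∂(haarUnitary (α ⊕ β)) =
      ∫ U, overlap A (unitaryInverse U) (ρ U) ∂(haarUnitary (α ⊕ β)) := by
  simp only [overlap_inverseChannel_truncate]
  have h : Continuous (Function.uncurry fun (U : UGroup (α ⊕ β)) (W : ↥(stabilizerZeros α β)) =>
      overlap A (unitaryInverse (U * (W : UGroup (α ⊕ β)))) (ρ U)) :=
    continuous_overlap_unitaryInverse A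
      (continuous_fst.mul (continuous_subtype_val.comp continuous_snd)) (hρ.comp continuous_fst)
  -- With the order of integration exchanged, `W` is fixed. Right invariance of the Haar measure
  -- then removes it, because `ρ (U * W) = ρ U`.
  rw [integral_integral_swap_of_hasCompactSupport h (HasCompactSupport.of_compactSpace _)]
  have h1 : ∀ W : ↥(stabilizerZeros α β),
      ∫ U, overlap A (unitaryInverse (U * (W : UGroup (α ⊕ β)))) (ρ U) ∂(haarUnitary (α ⊕ β)) =
      ∫ U, overlap A (unitaryInverse U) (ρ U) ∂(haarUnitary (α ⊕ β)) := by
    intro W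
    rw [← integral_mul_right_eq_self (μ := haarUnitary (α ⊕ β))
      (fun U => overlap A (unitaryInverse U) (ρ U)) (W : UGroup (α ⊕ β))]
    simp only [hW _ _ W.2]
  simp only [h1]
  simp

/-- The fidelity of the inverse of an isometry is a probability. -/
theorem dotProduct_inverseChannel_mem (V : Isom α β) {ψ : Bits α → ℂ} (hψ : IsKet ψ)
    {X : Op (α ⊕ β)} (hX : IsDensity X) :
    0 ≤ (star ψ ⬝ᵥ (inverseChannel V X *ᵥ ψ)).re ∧
      (star ψ ⬝ᵥ (inverseChannel V X *ᵥ ψ)).re ≤ 1 := by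
  obtain ⟨U, rfl⟩ := exists_truncate_eq V
  have h0 : ∀ Y : Op α, star ψ ⬝ᵥ (Y *ᵥ ψ) =
      ∑ p : Bits α × Bits α, star (ψ p.1) * ψ p.2 * Y p.1 p.2 := by
    intro Y
    simp only [dotProduct, Matrix.mulVec, Pi.star_apply, Finset.mul_sum, Fintype.sum_prod_type]
    exact Finset.sum_congr rfl fun a _ => Finset.sum_congr rfl fun b _ => by ring
  have h1 : star ψ ⬝ᵥ (inverseChannel (truncate U) X *ᵥ ψ) =
      ∫ W, star ψ ⬝ᵥ (unitaryInverse (U * (W : UGroup (α ⊕ β))) X *ᵥ ψ)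
        ∂(haarStabilizer α β) := by
    simp only [h0]
    exact sum_inverseChannel_truncate U (fun p : Bits α × Bits α => star (ψ p.1) * ψ p.2)
      (fun _ => X) Prod.fst Prod.snd
  have hint : Integrable (fun W : ↥(stabilizerZeros α β) =>
      star ψ ⬝ᵥ (unitaryInverse (U * (W : UGroup (α ⊕ β))) X *ᵥ ψ)) (haarStabilizer α β) := by
    simp only [h0]
    exact integrable_finsetSum _ fun p _ =>
      (integrable_unitaryInverse_stabilizer U X p.1 p.2).const_mul _
  -- The upper bound is the nonnegativity of the trace of `Y` compressed to the complement of `ψ`.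
  have h2 : ∀ Y : Op α, IsDensity Y → 0 ≤ (star ψ ⬝ᵥ (Y *ᵥ ψ)).re ∧
      (star ψ ⬝ᵥ (Y *ᵥ ψ)).re ≤ 1 := by
    intro Y hY
    refine ⟨(Complex.le_def.mp (hY.1.dotProduct_mulVec_nonneg ψ)).1, ?_⟩
    have hQ1 : (proj ψ)ᴴ = proj ψ := by
      rw [proj, Matrix.conjTranspose_vecMulVec, star_star]
    have hQ2 : proj ψ * proj ψ = proj ψ := by
      rw [proj, Matrix.vecMulVec_mul_vecMulVec]
      have : star ψ ⬝ᵥ ψ = 1 := hψ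
      simp [this]
    have hc : ((1 - proj ψ) * Y * (1 - proj ψ)ᴴ).PosSemidef :=
      hY.1.mul_mul_conjTranspose_same _
    have ht := (Complex.le_def.mp hc.trace_nonneg).1
    have hp : (1 - proj ψ)ᴴ * (1 - proj ψ) = 1 - proj ψ := by
      rw [Matrix.conjTranspose_sub, hQ1, Matrix.conjTranspose_one, Matrix.sub_mul, Matrix.mul_sub,
        Matrix.mul_sub, hQ2]
      simp
    rw [Matrix.trace_mul_comm, ← Matrix.mul_assoc, hp, Matrix.sub_mul, Matrix.trace_sub,
      Matrix.one_mul, hY.2, proj, Matrix.vecMulVec_mul, Matrix.trace_vecMulVec, dotProduct_comm,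
      ← Matrix.dotProduct_mulVec] at ht
    simpa using ht
  have h3 : (star ψ ⬝ᵥ (inverseChannel (truncate U) X *ᵥ ψ)).re =
      ∫ W, (star ψ ⬝ᵥ (unitaryInverse (U * (W : UGroup (α ⊕ β))) X *ᵥ ψ)).re
        ∂(haarStabilizer α β) := by
    rw [h1]
    exact (integral_re hint).symm
  have h4 : ∀ W : UGroup (α ⊕ β), IsDensity (unitaryInverse (U * W) X) := fun W =>
    ⟨posSemidef_unitaryInverse _ hX.1, (trace_unitaryInverse _ X).trans hX.2⟩
  rw [h3]
  refine ⟨integral_nonneg fun W => (h2 _ (h4 _)).1, ?_⟩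
  calc _ ≤ ∫ _W, (1 : ℝ) ∂(haarStabilizer α β) :=
        integral_mono hint.re (integrable_const 1) fun W => (h2 _ (h4 _)).2
    _ = 1 := by simp

end InverseChannelIntegral

/-! ### A finite twirl by signed permutations -/

section Twirl

/-- By transitivity of the symmetric group the left sum does not depend on `u`; summing over all
points and exchanging the sums gives the claim. -/
theorem sum_perm_apply {C : Type*} [Fintype C] [DecidableEq C] (f : C → ℂ) (u : C) :
    (Fintype.card C : ℂ) * ∑ π : Equiv.Perm C, f (π⁻¹ u) =
      (Fintype.card (Equiv.Perm C) : ℂ) * ∑ v, f v := by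
  have h : ∀ v, ∑ π : Equiv.Perm C, f (π⁻¹ v) = ∑ π : Equiv.Perm C, f (π⁻¹ u) := by
    intro v
    refine Fintype.sum_equiv (Equiv.mulLeft (Equiv.swap u v)) _ _ fun π => ?_
    simp
  calc _ = ∑ v, ∑ π : Equiv.Perm C, f (π⁻¹ v) := by
        simp only [h, Finset.sum_const, Finset.card_univ, nsmul_eq_mul]
    _ = ∑ π : Equiv.Perm C, ∑ v, f (π⁻¹ v) := Finset.sum_comm
    _ = ∑ _π : Equiv.Perm C, ∑ v, f v := Finset.sum_congr rfl fun π _ => Equiv.sum_comp π⁻¹ f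
    _ = _ := by simp

variable {n : Type} [Fintype n] [DecidableEq n]

/-- The signs `s` on the subtype `p`, and `1` elsewhere. -/
def extendSign {p : n → Prop} [DecidablePred p] (s : Subtype p → ℤˣ) (z : n) : ℂ :=
  if h : p z then (((s ⟨z, h⟩ : ℤˣ) : ℤ) : ℂ) else 1

theorem extendSign_mul_self {p : n → Prop} [DecidablePred p] (s : Subtype p → ℤˣ) (z : n) :
    extendSign s z * extendSign s z = 1 := by
  unfold extendSign
  split_ifs with h
  · rcases Int.units_eq_one_or (s ⟨z, h⟩) with h1 | h1 <;> simp [h1]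
  · simp

theorem star_extendSign {p : n → Prop} [DecidablePred p] (s : Subtype p → ℤˣ) (z : n) :
    star (extendSign s z) = extendSign s z := by
  unfold extendSign
  split_ifs <;> simp

/-- Flipping the sign at `u` negates every term and permutes the summands. The coordinate `v` may
lie outside `p`. -/
theorem sum_extendSign_mul {p : n → Prop} [DecidablePred p] {u v : n} (hu : p u) (huv : u ≠ v) :
    ∑ s : Subtype p → ℤˣ, extendSign s u * extendSign s v = 0 := by
  have h : ∑ s : Subtype p → ℤˣ, extendSign s u * extendSign s v =
      ∑ s : Subtype p → ℤˣ, -(extendSign s u * extendSign s v) := by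
    refine Fintype.sum_equiv (Equiv.mulLeft (Pi.mulSingle ⟨u, hu⟩ (-1))) _ _ fun s => ?_
    have h1 : extendSign (Equiv.mulLeft (Pi.mulSingle (⟨u, hu⟩ : Subtype p) (-1 : ℤˣ)) s) u =
        -extendSign s u := by
      simp [extendSign, hu]
    have h2 : extendSign (Equiv.mulLeft (Pi.mulSingle (⟨u, hu⟩ : Subtype p) (-1 : ℤˣ)) s) v =
        extendSign s v := by
      unfold extendSign
      split_ifs with hv
      · have : (⟨v, hv⟩ : Subtype p) ≠ ⟨u, hu⟩ := fun h => huv (Subtype.mk.inj h).symm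
        simp [Pi.mulSingle_eq_of_ne this]
      · rfl
    rw [h1, h2]
    ring
  rw [Finset.sum_neg_distrib] at h
  exact self_eq_neg.mp h

/-- A signed permutation of the coordinates in `p`. -/
def signedPerm {p : n → Prop} [DecidablePred p] (s : Subtype p → ℤˣ)
    (π : Equiv.Perm (Subtype p)) : Matrix n n ℂ :=
  Matrix.of fun u v => if Equiv.Perm.ofSubtype π⁻¹ u = v then extendSign s u else 0

theorem signedPerm_conj_apply {p : n → Prop} [DecidablePred p] (s : Subtype p → ℤˣ)
    (π : Equiv.Perm (Subtype p)) (X : Matrix n n ℂ) (u v : n) :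
    (signedPerm s π * X * (signedPerm s π)ᴴ) u v = extendSign s u * extendSign s v *
      X (Equiv.Perm.ofSubtype π⁻¹ u) (Equiv.Perm.ofSubtype π⁻¹ v) := by
  simp only [Matrix.mul_apply, signedPerm, Matrix.of_apply, Matrix.conjTranspose_apply, ite_mul,
    zero_mul, Finset.sum_ite_eq, Finset.mem_univ, if_true, apply_ite star, star_zero, mul_ite,
    mul_zero, star_extendSign]
  ring

theorem signedPerm_mem {p : n → Prop} [DecidablePred p] (s : Subtype p → ℤˣ)
    (π : Equiv.Perm (Subtype p)) : signedPerm s π ∈ Matrix.unitaryGroup n ℂ := by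
  rw [Matrix.mem_unitaryGroup_iff, Matrix.star_eq_conjTranspose]
  ext u v
  have h := signedPerm_conj_apply s π 1 u v
  rw [Matrix.mul_one] at h
  rw [h, Matrix.one_apply, Matrix.one_apply]
  simp only [EmbeddingLike.apply_eq_iff_eq]
  split_ifs with huv
  · rw [huv, extendSign_mul_self, one_mul]
  · simp

/-- The projection onto the coordinates in `p`. -/
def coordProj (p : n → Prop) [DecidablePred p] : Matrix n n ℂ :=
  Matrix.diagonal fun z => if p z then 1 else 0

theorem signedPerm_mul_coordProj {p : n → Prop} [DecidablePred p] (s : Subtype p → ℤˣ)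
    (π : Equiv.Perm (Subtype p)) :
    signedPerm s π * (1 - coordProj p) = 1 - coordProj p := by
  ext u v
  simp only [Matrix.mul_sub, Matrix.mul_one, coordProj, Matrix.sub_apply, Matrix.mul_diagonal,
    Matrix.one_apply, Matrix.diagonal_apply, signedPerm, Matrix.of_apply]
  by_cases hv : p v
  · by_cases huv : u = v <;> simp [hv, huv]
  · by_cases hu : p u
    · have h1 : u ≠ v := fun h => hv (h ▸ hu)
      have h2 : Equiv.Perm.ofSubtype π⁻¹ u ≠ v := by
        rw [Equiv.Perm.ofSubtype_apply_of_mem _ hu]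
        intro h
        exact hv (h ▸ Subtype.property _)
      simp only [h1, h2, if_false]
      simp
    · rw [Equiv.Perm.ofSubtype_apply_of_not_mem _ hu]
      by_cases huv : u = v <;> simp [hv, huv, extendSign]

/-- Signs kill the off-diagonal entries and permutations level the diagonal. Control of the rows of
`X` is enough: an entry with row in `p` and column outside is off-diagonal, hence killed as well.
The identity is stated without division so that it covers an empty `p`. -/
theorem sum_signedPerm_conj (p : n → Prop) [DecidablePred p] {X : Matrix n n ℂ}
    (hX : (1 - coordProj p) * X = 0) :
    (coordProj p).trace • ∑ g : (Subtype p → ℤˣ) × Equiv.Perm (Subtype p),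
        signedPerm g.1 g.2 * X * (signedPerm g.1 g.2)ᴴ =
      ((Fintype.card ((Subtype p → ℤˣ) × Equiv.Perm (Subtype p)) : ℂ) * X.trace) •
        coordProj p := by
  have hX0 : ∀ u v, ¬ p u → X u v = 0 := by
    intro u v hu
    have h := congrFun (congrFun hX u) v
    simpa [coordProj, Matrix.sub_mul, Matrix.diagonal_mul, hu] using h
  have htr : (coordProj p).trace = (Fintype.card (Subtype p) : ℂ) := by
    simp [coordProj, Fintype.card_subtype]
  have htX : X.trace = ∑ z : Subtype p, X z z := by
    rw [Matrix.trace, ← Fintype.sum_subtype_add_sum_subtype p]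
    have : ∑ i : {x // ¬ p x}, X.diag i = 0 := Finset.sum_eq_zero fun i _ => hX0 _ _ i.2
    rw [this, add_zero]
    rfl
  ext u v
  rw [Matrix.smul_apply, Matrix.smul_apply, Matrix.sum_apply]
  simp only [signedPerm_conj_apply, Fintype.sum_prod_type, smul_eq_mul]
  by_cases hu : p u
  · by_cases huv : u = v
    · subst huv
      simp only [extendSign_mul_self, one_mul, Equiv.Perm.ofSubtype_apply_of_mem _ hu]
      have h := sum_perm_apply (fun z : Subtype p => X z z) ⟨u, hu⟩
      rw [Finset.sum_const, htr, Finset.card_univ, nsmul_eq_mul, mul_left_comm, h, htX,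
        Fintype.card_prod]
      simp [coordProj, hu]
      ring
    · rw [Finset.sum_comm]
      have : ∀ π : Equiv.Perm (Subtype p), ∑ s : Subtype p → ℤˣ,
          extendSign s u * extendSign s v * X (Equiv.Perm.ofSubtype π⁻¹ u)
            (Equiv.Perm.ofSubtype π⁻¹ v) = 0 := by
        intro π
        rw [← Finset.sum_mul, sum_extendSign_mul hu huv, zero_mul]
      simp only [this, Finset.sum_const_zero, mul_zero]
      simp [coordProj, Matrix.diagonal_apply_ne _ huv]
  · have : ∀ π : Equiv.Perm (Subtype p), Equiv.Perm.ofSubtype π⁻¹ u = u := fun π =>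
      Equiv.Perm.ofSubtype_apply_of_not_mem _ hu
    simp only [this, hX0 u _ hu, mul_zero, Finset.sum_const_zero]
    by_cases huv : u = v
    · subst huv
      simp [coordProj, hu]
    · simp [coordProj, Matrix.diagonal_apply_ne _ huv]

/-- Diagonalise `Q`; idempotence forces its eigenvalues to be `0` or `1`. -/
theorem exists_coordProj {Q : Matrix n n ℂ} (hQ : Q.IsHermitian) (hQ2 : Q * Q = Q) :
    ∃ (B : Matrix.unitaryGroup n ℂ) (p : n → Prop) (_ : DecidablePred p),
      Q = (B : Matrix n n ℂ) * coordProj p * (B : Matrix n n ℂ)ᴴ := by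
  set B := hQ.eigenvectorUnitary
  set D : Matrix n n ℂ := Matrix.diagonal (RCLike.ofReal ∘ hQ.eigenvalues)
  have hB1 : (B : Matrix n n ℂ)ᴴ * (B : Matrix n n ℂ) = 1 := Matrix.mem_unitaryGroup_iff'.mp B.2
  have hQD : Q = (B : Matrix n n ℂ) * D * (B : Matrix n n ℂ)ᴴ := by
    have h := hQ.spectral_theorem
    rwa [Unitary.conjStarAlgAut_apply] at h
  have hD : D = (B : Matrix n n ℂ)ᴴ * Q * (B : Matrix n n ℂ) := by
    conv_rhs => rw [hQD]
    simp only [Matrix.mul_assoc, hB1, Matrix.mul_one]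
    rw [← Matrix.mul_assoc, hB1, Matrix.one_mul]
  have hB2 : (B : Matrix n n ℂ) * (B : Matrix n n ℂ)ᴴ = 1 := Matrix.mem_unitaryGroup_iff.mp B.2
  have hDD : D * D = D := by
    have : D * D = (B : Matrix n n ℂ)ᴴ * (Q * ((B : Matrix n n ℂ) * (B : Matrix n n ℂ)ᴴ) * Q) *
        (B : Matrix n n ℂ) := by
      rw [hD]
      simp only [Matrix.mul_assoc]
    rw [this, hB2, Matrix.mul_one, hQ2, ← hD]
  have he : ∀ z, hQ.eigenvalues z = 0 ∨ hQ.eigenvalues z = 1 := by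
    intro z
    have h := congrFun (congrFun hDD z) z
    simp only [D, Matrix.diagonal_mul_diagonal, Matrix.diagonal_apply_eq, Function.comp] at h
    have h1 : hQ.eigenvalues z * hQ.eigenvalues z = hQ.eigenvalues z := by exact_mod_cast h
    rcases eq_or_ne (hQ.eigenvalues z) 0 with h2 | h2
    · exact Or.inl h2
    · exact Or.inr (mul_left_cancel₀ h2 (by rw [h1, mul_one]))
  classical
  refine ⟨B, fun z => hQ.eigenvalues z = 1, inferInstance, ?_⟩
  conv_lhs => rw [hQD]
  congr 2
  ext u v
  by_cases huv : u = v
  · subst huv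
    rcases he u with h | h <;> simp [D, coordProj, h]
  · simp [D, coordProj, Matrix.diagonal_apply_ne _ huv]

/-- A finite set of unitaries that fix the kernel of the projection `Q` and twirl its range. -/
theorem exists_twirl {Q : Matrix n n ℂ} (hQ : Q.IsHermitian) (hQ2 : Q * Q = Q) :
    ∃ (G : Type) (_ : Fintype G) (_ : Nonempty G) (g : G → Matrix.unitaryGroup n ℂ),
      (∀ i, (g i : Matrix n n ℂ) * (1 - Q) = 1 - Q) ∧
      ∀ X, (1 - Q) * X = 0 → Q.trace • ∑ i, (g i : Matrix n n ℂ) * X * (g i : Matrix n n ℂ)ᴴ =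
        ((Fintype.card G : ℂ) * X.trace) • Q := by
  obtain ⟨B, p, _, rfl⟩ := exists_coordProj hQ hQ2
  have hB1 : (B : Matrix n n ℂ)ᴴ * (B : Matrix n n ℂ) = 1 := Matrix.mem_unitaryGroup_iff'.mp B.2
  have hB2 : (B : Matrix n n ℂ) * (B : Matrix n n ℂ)ᴴ = 1 := Matrix.mem_unitaryGroup_iff.mp B.2
  set D := coordProj p
  have h1 : 1 - (B : Matrix n n ℂ) * D * (B : Matrix n n ℂ)ᴴ =
      (B : Matrix n n ℂ) * (1 - D) * (B : Matrix n n ℂ)ᴴ := by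
    rw [Matrix.mul_sub, Matrix.sub_mul, Matrix.mul_one, hB2]
  have hcancel : ∀ Y : Matrix n n ℂ, (B : Matrix n n ℂ)ᴴ * ((B : Matrix n n ℂ) * Y) = Y :=
    fun Y => by rw [← Matrix.mul_assoc, hB1, Matrix.one_mul]
  -- The twirl of `Q` consists of the signed permutations in an eigenbasis of `Q`.
  refine ⟨(Subtype p → ℤˣ) × Equiv.Perm (Subtype p), inferInstance, inferInstance,
    fun g => B * ⟨_, signedPerm_mem g.1 g.2⟩ * B⁻¹, fun g => ?_, fun X hX => ?_⟩
  · change (B : Matrix n n ℂ) * signedPerm g.1 g.2 * (B : Matrix n n ℂ)ᴴ * _ = _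
    rw [h1]
    simp only [Matrix.mul_assoc, hcancel]
    rw [← Matrix.mul_assoc (signedPerm g.1 g.2), signedPerm_mul_coordProj]
  · have hX' : (1 - D) * ((B : Matrix n n ℂ)ᴴ * X * (B : Matrix n n ℂ)) = 0 := by
      rw [h1] at hX
      have h := congrArg (fun Y => (B : Matrix n n ℂ)ᴴ * Y * (B : Matrix n n ℂ)) hX
      simpa only [Matrix.mul_assoc, hcancel, Matrix.mul_zero, Matrix.zero_mul] using h
    have h := sum_signedPerm_conj p hX'
    have ht1 : ((B : Matrix n n ℂ) * D * (B : Matrix n n ℂ)ᴴ).trace = D.trace := by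
      rw [Matrix.trace_mul_comm, hcancel]
    have ht2 : ((B : Matrix n n ℂ)ᴴ * X * (B : Matrix n n ℂ)).trace = X.trace := by
      rw [Matrix.trace_mul_comm, ← Matrix.mul_assoc, hB2, Matrix.one_mul]
    rw [ht2] at h
    rw [ht1]
    have h2 := congrArg (fun Y => (B : Matrix n n ℂ) * Y * (B : Matrix n n ℂ)ᴴ) h
    simp only [Matrix.mul_smul, Matrix.smul_mul, Matrix.mul_sum, Matrix.sum_mul] at h2
    rw [← h2]
    congr 1
    refine Finset.sum_congr rfl fun g _ => ?_
    have h3 : ((B * ⟨_, signedPerm_mem g.1 g.2⟩ * B⁻¹ : Matrix.unitaryGroup n ℂ) :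
        Matrix n n ℂ) = (B : Matrix n n ℂ) * signedPerm g.1 g.2 * (B : Matrix n n ℂ)ᴴ := rfl
    rw [h3]
    simp only [Matrix.conjTranspose_mul, Matrix.conjTranspose_conjTranspose, Matrix.mul_assoc]

end Twirl

/-! ### The projector onto the queried messages -/

section SpanProjection

/-- The orthogonal projector onto the span of finitely many vectors. -/
theorem exists_spanProjection {n : Type} [Fintype n] [DecidableEq n] {q : ℕ}
    (ψ : Fin q → n → ℂ) : ∃ (P : Matrix n n ℂ) (d : ℕ), P.IsHermitian ∧ P * P = P ∧
      P.trace = d ∧ d ≤ q ∧ (∀ i, P *ᵥ ψ i = ψ i) ∧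
      ∀ v, (∀ i, star (ψ i) ⬝ᵥ v = 0) → P *ᵥ v = 0 := by
  let f : Fin q → EuclideanSpace ℂ n := fun i => WithLp.toLp 2 (ψ i)
  let S := Submodule.span ℂ (Set.range f)
  let b := stdOrthonormalBasis ℂ S
  let w : Fin (Module.finrank ℂ S) → n → ℂ := fun j => WithLp.ofLp (b j : EuclideanSpace ℂ n)
  have hinner : ∀ x y : EuclideanSpace ℂ n, inner ℂ x y = star (WithLp.ofLp x) ⬝ᵥ WithLp.ofLp y := by
    intro x y
    rw [EuclideanSpace.inner_eq_star_dotProduct, dotProduct_comm]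
  have hw : ∀ i j, star (w i) ⬝ᵥ w j = if i = j then 1 else 0 := by
    intro i j
    rw [← hinner, ← Submodule.coe_inner]
    exact orthonormal_iff_ite.mp b.orthonormal i j
  have hP : ∀ v, (∑ j, Matrix.vecMulVec (w j) (star (w j))) *ᵥ v =
      ∑ j, (star (w j) ⬝ᵥ v) • w j := by
    intro v
    rw [Matrix.sum_mulVec]
    refine Finset.sum_congr rfl fun j _ => ?_
    rw [Matrix.vecMulVec_mulVec]
    simp
  -- The rank is the dimension of the span, which can be below `q` because the vectors may be
  -- dependent.
  refine ⟨∑ j, Matrix.vecMulVec (w j) (star (w j)), Module.finrank ℂ S, ?_, ?_, ?_, ?_, ?_, ?_⟩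
  · rw [Matrix.IsHermitian, Matrix.conjTranspose_sum]
    simp [Matrix.conjTranspose_vecMulVec]
  · rw [Finset.sum_mul_sum]
    refine Finset.sum_congr rfl fun i _ => ?_
    simp only [Matrix.vecMulVec_mul_vecMulVec, hw]
    rw [Finset.sum_eq_single i]
    · simp
    · intro j _ hj
      simp [hj.symm]
    · simp
  · rw [Matrix.trace_sum]
    simp only [Matrix.trace_vecMulVec, dotProduct_comm (w _), hw]
    simp
  · exact (finrank_range_le_card (R := ℂ) f).trans (by simp)
  · intro i
    rw [hP]
    have hi : f i ∈ S := Submodule.subset_span ⟨i, rfl⟩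
    have h := congrArg (fun x : S => WithLp.ofLp (x : EuclideanSpace ℂ n)) (b.sum_repr' ⟨f i, hi⟩)
    simpa [Submodule.coe_inner, hinner, w, f] using h
  · intro v hv
    rw [hP]
    refine Finset.sum_eq_zero fun j _ => ?_
    have h : ∀ x ∈ S, star (WithLp.ofLp x) ⬝ᵥ v = 0 := by
      intro x hx
      induction hx using Submodule.span_induction with
      | mem x hx =>
        obtain ⟨i, rfl⟩ := hx
        exact hv i
      | zero => simp
      | add x y _ _ hx hy => simp [add_dotProduct, hx, hy]
      | smul c x _ hx => simp [hx]
    rw [h _ (b j).2, zero_smul]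

end SpanProjection

/-! ### The bound for Haar unitaries -/

section HaarBound

variable {α β : Type} [Fintype α] [DecidableEq α] [Fintype β] [DecidableEq β]

/-- `A |a⟩⟨b| ⊗ 1`. -/
def columnOp (β : Type) [Fintype β] [DecidableEq β] (A : Op α) (a b : Bits α) : Op (α ⊕ β) :=
  Matrix.of fun z w => if w = Sum.elim b (z ∘ Sum.inr) then A (z ∘ Sum.inl) a else 0

/-- The block `⟨a|ρ|b⟩` of an operator. -/
def opBlock {τ : Type} (ρ : Op (α ⊕ τ)) (a b : Bits α) : Op τ :=
  Matrix.of fun s t => ρ (Sum.elim a s) (Sum.elim b t)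

theorem sum_mul_traceAux (A : Op α) (Y : Op (α ⊕ β)) (a b : Bits α) :
    ∑ r, A r a * traceAux Y b r = (Y * columnOp β A a b).trace := by
  simp only [Matrix.trace, Matrix.diag_apply, Matrix.mul_apply]
  rw [Finset.sum_comm]
  simp only [columnOp, Matrix.of_apply, mul_ite, mul_zero, Finset.sum_ite_eq', Finset.mem_univ,
    if_true]
  rw [sum_bits_sum]
  refine Finset.sum_congr rfl fun r _ => ?_
  simp only [traceAux, Matrix.of_apply, Sum.elim_comp_inl, Sum.elim_comp_inr, Finset.mul_sum]
  exact Finset.sum_congr rfl fun c _ => mul_comm _ _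

/-- The adjoint of the partial trace tensors with the identity. In this form, replacing `U` by `U g`
for a fixed state amounts to conjugating `columnOp` by `g`, which is what the twirl averages. -/
theorem overlap_unitaryInverse (A : Op α) (U : UGroup (α ⊕ β)) (ρ : Op (α ⊕ (α ⊕ β))) :
    overlap A (unitaryInverse U) ρ = ∑ a, ∑ b,
      (opBlock ρ a b * ((U : Op (α ⊕ β)) * columnOp β A a b * (U : Op (α ⊕ β))ᴴ)).trace := by
  unfold overlap
  refine Finset.sum_congr rfl fun a _ => Finset.sum_congr rfl fun b _ => ?_
  have h := sum_mul_traceAux A ((U : Op (α ⊕ β))ᴴ * opBlock ρ a b * (U : Op (α ⊕ β))) a b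
  refine h.trans ?_
  rw [Matrix.mul_assoc, Matrix.mul_assoc, Matrix.trace_mul_comm]
  simp only [Matrix.mul_assoc]

theorem trace_columnOp (A : Op α) (a b : Bits α) :
    (columnOp β A a b).trace = 2 ^ Fintype.card β * A b a := by
  have h : ∀ (x : Bits α) (c : Bits β), Sum.elim x c = Sum.elim b c ↔ x = b := by
    intro x c
    constructor
    · intro h
      exact funext fun i => congrFun h (Sum.inl i)
    · rintro rfl
      rfl
  simp only [Matrix.trace, Matrix.diag_apply, columnOp, Matrix.of_apply]
  rw [sum_bits_sum]
  simp only [Sum.elim_comp_inl, Sum.elim_comp_inr, h]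
  rw [Finset.sum_comm]
  simp

theorem conjTranspose_appendZeros_mul_self :
    (appendZeros α β)ᴴ * appendZeros α β = 1 := by
  have h := (truncate (1 : UGroup (α ⊕ β))).2
  simpa [truncate] using h

/-- Projecting the auxiliary register onto zero leaves `A|a⟩` on the left, and `P` kills it. This
verifies the hypothesis of the twirl for `A = 1 - P`. -/
theorem conjTranspose_appendZeros_mul_columnOp {P A : Op α} (h : P * A = 0) (a b : Bits α) :
    P * ((appendZeros α β)ᴴ * columnOp β A a b) = 0 := by
  have h1 : ∀ x w, ((appendZeros α β)ᴴ * columnOp β A a b) x w =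
      A x a * if w = Sum.elim b (zeros β) then 1 else 0 := by
    intro x w
    rw [Matrix.mul_apply, Finset.sum_eq_single (Sum.elim x (zeros β))]
    · simp [appendZeros, columnOp]
      rfl
    · intro z _ hz
      simp [appendZeros, hz]
    · simp
  ext x w
  rw [Matrix.mul_apply]
  simp only [h1, ← mul_assoc, ← Finset.sum_mul]
  have h2 := congrFun (congrFun h x) a
  rw [Matrix.mul_apply] at h2
  rw [h2]
  simp

theorem trace_mul_projection_re_le {n : Type} [Fintype n] [DecidableEq n] {ρ K : Matrix n n ℂ}
    (hρ : ρ.PosSemidef) (hK : Kᴴ = K) (hK2 : K * K = K) : (ρ * K).trace.re ≤ ρ.trace.re := by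
  have h1 : ((1 - K) * ρ * (1 - K)ᴴ).PosSemidef := hρ.mul_mul_conjTranspose_same _
  have h2 := (Complex.le_def.mp h1.trace_nonneg).1
  have h3 : (1 - K)ᴴ * (1 - K) = 1 - K := by
    rw [Matrix.conjTranspose_sub, hK, Matrix.conjTranspose_one, Matrix.sub_mul, Matrix.mul_sub,
      Matrix.mul_sub, hK2]
    simp
  rw [Matrix.trace_mul_comm, ← Matrix.mul_assoc, h3, Matrix.sub_mul, Matrix.one_mul,
    Matrix.trace_sub, Matrix.trace_mul_comm K] at h2
  simpa using h2

/-- The double sum is `Tr[ρ (A ⊗ B)]`, and `K = A ⊗ B` is a projection. -/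
theorem re_sum_trace_opBlock_le {τ : Type} [Fintype τ] [DecidableEq τ] {ρ : Op (α ⊕ τ)}
    (hρ : IsDensity ρ) {A : Op α} {B : Op τ} (hA : Aᴴ = A) (hA2 : A * A = A) (hB : Bᴴ = B)
    (hB2 : B * B = B) : (∑ a, ∑ b, A b a * (opBlock ρ a b * B).trace).re ≤ 1 := by
  let K : Op (α ⊕ τ) := Matrix.of fun x y =>
    A (x ∘ Sum.inl) (y ∘ Sum.inl) * B (x ∘ Sum.inr) (y ∘ Sum.inr)
  have hK : Kᴴ = K := by
    ext x y
    have h1 := congrFun (congrFun hA (x ∘ Sum.inl)) (y ∘ Sum.inl)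
    have h2 := congrFun (congrFun hB (x ∘ Sum.inr)) (y ∘ Sum.inr)
    rw [Matrix.conjTranspose_apply] at h1 h2
    simp only [K, Matrix.conjTranspose_apply, Matrix.of_apply, star_mul', h1, h2]
  have hK2 : K * K = K := by
    ext x y
    rw [Matrix.mul_apply, sum_bits_sum]
    have h1 := congrFun (congrFun hA2 (x ∘ Sum.inl)) (y ∘ Sum.inl)
    have h2 := congrFun (congrFun hB2 (x ∘ Sum.inr)) (y ∘ Sum.inr)
    rw [Matrix.mul_apply] at h1 h2
    simp only [K, Matrix.of_apply, Sum.elim_comp_inl, Sum.elim_comp_inr]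
    rw [← h1, ← h2, Finset.sum_mul_sum]
    exact Finset.sum_congr rfl fun a _ => Finset.sum_congr rfl fun b _ => by ring
  have h3 : (ρ * K).trace = ∑ a, ∑ b, A b a * (opBlock ρ a b * B).trace := by
    simp only [Matrix.trace, Matrix.diag_apply, Matrix.mul_apply, sum_bits_sum, K, opBlock,
      Matrix.of_apply, Sum.elim_comp_inl, Sum.elim_comp_inr, Finset.mul_sum]
    refine Finset.sum_congr rfl fun a _ => ?_
    rw [Finset.sum_comm]
    refine Finset.sum_congr rfl fun b _ => Finset.sum_congr rfl fun s _ =>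
      Finset.sum_congr rfl fun t _ => by ring
  rw [← h3]
  have h4 := trace_mul_projection_re_le hρ.1 hK hK2
  rwa [hρ.2, Complex.one_re] at h4

/-- Inverting a Haar unitary: no strategy that knows the unitary only on the range of `P` finds a
pair of a state orthogonal to that range and of its image. -/
theorem integral_overlap_unitaryInverse_le {P : Op α} {d : ℕ} (hP : P.IsHermitian)
    (hP2 : P * P = P) (hd : P.trace = d) {ρ : UGroup (α ⊕ β) → Op (α ⊕ (α ⊕ β))}
    (hρ : Continuous ρ) (hdens : ∀ U, IsDensity (ρ U))
    (hW : ∀ U W : UGroup (α ⊕ β), (W : Op (α ⊕ β)) * (appendZeros α β * P) = appendZeros α β * P →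
      ρ (U * W) = ρ U) :
    (∫ U, overlap (1 - P) (unitaryInverse U) (ρ U) ∂(haarUnitary (α ⊕ β))).re ≤
      (d + 1) / 2 ^ Fintype.card α := by
  set A := 1 - P with hA
  have hAh : Aᴴ = A := by
    rw [hA, Matrix.conjTranspose_sub, Matrix.conjTranspose_one, hP.eq]
  have hPA : P * A = 0 := by rw [hA, Matrix.mul_sub, Matrix.mul_one, hP2, sub_self]
  have hA2 : A * A = A := by
    conv_lhs => rw [hA, Matrix.sub_mul, Matrix.one_mul, hPA, sub_zero]
  set J := appendZeros α β
  have hJ : Jᴴ * J = 1 := conjTranspose_appendZeros_mul_self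
  -- `Q` projects onto the complement of the padded queried messages, the part of the space on which
  -- the action of `U` remains free.
  set Q : Op (α ⊕ β) := 1 - J * P * Jᴴ with hQ
  have hQh : Q.IsHermitian := by
    rw [Matrix.IsHermitian, hQ, Matrix.conjTranspose_sub, Matrix.conjTranspose_one,
      Matrix.conjTranspose_mul, Matrix.conjTranspose_mul, Matrix.conjTranspose_conjTranspose,
      hP.eq, Matrix.mul_assoc]
  have hJP : (J * P * Jᴴ) * (J * P * Jᴴ) = J * P * Jᴴ := by
    calc _ = J * P * (Jᴴ * J) * P * Jᴴ := by simp only [Matrix.mul_assoc]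
      _ = _ := by rw [hJ, Matrix.mul_one, Matrix.mul_assoc J, hP2]
  have hQ2 : Q * Q = Q := by
    rw [hQ, Matrix.sub_mul, Matrix.mul_sub, Matrix.mul_sub, hJP]
    simp
  have htrJ : (J * P * Jᴴ).trace = d := by
    rw [Matrix.trace_mul_comm, ← Matrix.mul_assoc, hJ, Matrix.one_mul, hd]
  have htrQ : Q.trace = ((2 : ℝ) ^ Fintype.card α * 2 ^ Fintype.card β - d : ℝ) := by
    rw [hQ, Matrix.trace_sub, htrJ, Matrix.trace_one]
    simp [pow_add]
  have hdle : (d : ℝ) ≤ 2 ^ Fintype.card α := by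
    have h1 : (0 : ℂ) ≤ A.trace := by
      have := (Matrix.posSemidef_conjTranspose_mul_self A).trace_nonneg
      rwa [hAh, hA2] at this
    have h2 := (Complex.le_def.mp h1).1
    have h3 : (((2 : ℝ) ^ Fintype.card α : ℝ) : ℂ).re = 2 ^ Fintype.card α := Complex.ofReal_re _
    rw [hA, Matrix.trace_sub, hd, Matrix.trace_one] at h2
    push_cast at h3
    simpa [h3] using h2
  obtain ⟨G, _, _, g, hg, htw⟩ := exists_twirl hQh hQ2
  have h1Q : 1 - Q = J * P * Jᴴ := by rw [hQ, sub_sub_cancel]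
  -- Twirling unitaries fix the padded queries, so by `hW` the state `ρ` is the same for `U` and `U
  -- * g i`.
  have hgJ : ∀ i, (g i : Op (α ⊕ β)) * (J * P) = J * P := by
    intro i
    have h := congrArg (fun Y => Y * J) (hg i)
    rw [h1Q] at h
    simpa only [Matrix.mul_assoc, hJ, Matrix.mul_one] using h
  set f : UGroup (α ⊕ β) → ℂ := fun U => overlap A (unitaryInverse U) (ρ U) with hf
  have hfc : Continuous f := continuous_overlap_unitaryInverse A continuous_id hρ
  set I := ∫ U, f U ∂(haarUnitary (α ⊕ β)) with hI
  have hint : ∀ i, Integrable (fun U => f (U * g i)) (haarUnitary (α ⊕ β)) := fun i =>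
    integrable_of_continuous (hfc.comp (continuous_mul_const (g i)))
  have hGI : (Fintype.card G : ℂ) * I =
      ∫ U, ∑ i, f (U * g i) ∂(haarUnitary (α ⊕ β)) := by
    rw [integral_finsetSum _ fun i _ => hint i]
    simp only [integral_mul_right_eq_self f]
    simp [hI]
  -- Pointwise in `U`, the twirl replaces `columnOp` by its trace, `2 ^ m` times an entry of `A`,
  -- times `Q / Tr Q`; the division is kept on the other side.
  have hpt : ∀ U, Q.trace * ∑ i, f (U * g i) = (Fintype.card G : ℂ) * 2 ^ Fintype.card β *
      ∑ a, ∑ b, A b a * (opBlock (ρ U) a b *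
        ((U : Op (α ⊕ β)) * Q * (U : Op (α ⊕ β))ᴴ)).trace := by
    intro U
    have h1 : ∀ i, f (U * g i) = ∑ a, ∑ b, (opBlock (ρ U) a b * ((U : Op (α ⊕ β)) *
        ((g i : Op (α ⊕ β)) * columnOp β A a b * (g i : Op (α ⊕ β))ᴴ) *
        (U : Op (α ⊕ β))ᴴ)).trace := by
      intro i
      simp only [hf, hW U (g i) (hgJ i), overlap_unitaryInverse, Submonoid.coe_mul,
        Matrix.conjTranspose_mul, Matrix.mul_assoc]
    simp only [h1]
    rw [← Finset.sum_comm_cycle, Finset.mul_sum, Finset.mul_sum]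
    refine Finset.sum_congr rfl fun a _ => ?_
    rw [Finset.mul_sum, Finset.mul_sum]
    refine Finset.sum_congr rfl fun b _ => ?_
    have hX : (1 - Q) * columnOp β A a b = 0 := by
      rw [h1Q, Matrix.mul_assoc, Matrix.mul_assoc, conjTranspose_appendZeros_mul_columnOp hPA,
        Matrix.mul_zero]
    have h2 := congrArg (fun Y => (opBlock (ρ U) a b * ((U : Op (α ⊕ β)) * Y *
      (U : Op (α ⊕ β))ᴴ)).trace) (htw _ hX)
    simp only [Matrix.mul_smul, Matrix.smul_mul, Matrix.mul_sum, Matrix.sum_mul,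
      Matrix.trace_smul, Matrix.trace_sum, smul_eq_mul, trace_columnOp] at h2
    rw [h2]
    ring
  have hD : (0 : ℝ) ≤ (2 : ℝ) ^ Fintype.card α * 2 ^ Fintype.card β - d := by
    have : (1 : ℝ) ≤ 2 ^ Fintype.card β := one_le_pow₀ (by norm_num)
    nlinarith [pow_pos (show (0 : ℝ) < 2 by norm_num) (Fintype.card α)]
  have hbound : ((2 : ℝ) ^ Fintype.card α * 2 ^ Fintype.card β - d) * I.re ≤
      2 ^ Fintype.card β := by
    have hG : (0 : ℝ) < Fintype.card G := by exact_mod_cast Fintype.card_pos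
    have h1 : (Fintype.card G : ℝ) * (((2 : ℝ) ^ Fintype.card α * 2 ^ Fintype.card β - d) * I.re) =
        (∫ U, Q.trace * ∑ i, f (U * g i) ∂(haarUnitary (α ⊕ β))).re := by
      rw [integral_const_mul, ← hGI, htrQ]
      have h3 : ((((2 : ℝ) ^ Fintype.card α * 2 ^ Fintype.card β - d : ℝ) : ℂ) *
          ((Fintype.card G : ℂ) * I)) = (((2 : ℝ) ^ Fintype.card α * 2 ^ Fintype.card β - d) *
          Fintype.card G : ℝ) * I := by
        push_cast
        ring
      rw [h3, Complex.re_ofReal_mul]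
      ring
    have hint2 : Integrable (fun U => Q.trace * ∑ i, f (U * g i)) (haarUnitary (α ⊕ β)) :=
      (integrable_finsetSum _ fun i _ => hint i).const_mul _
    have h2 : (∫ U, Q.trace * ∑ i, f (U * g i) ∂(haarUnitary (α ⊕ β))).re =
        ∫ U, (Q.trace * ∑ i, f (U * g i)).re ∂(haarUnitary (α ⊕ β)) := (integral_re hint2).symm
    have h4 : ∫ U, (Q.trace * ∑ i, f (U * g i)).re ∂(haarUnitary (α ⊕ β)) ≤
        ∫ _U, ((Fintype.card G : ℝ) * 2 ^ Fintype.card β) ∂(haarUnitary (α ⊕ β)) := by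
      refine integral_mono hint2.re (integrable_const _) fun U => ?_
      have hQU : ((U : Op (α ⊕ β)) * Q * (U : Op (α ⊕ β))ᴴ)ᴴ =
          (U : Op (α ⊕ β)) * Q * (U : Op (α ⊕ β))ᴴ := by
        simp only [Matrix.conjTranspose_mul, Matrix.conjTranspose_conjTranspose, hQh.eq,
          Matrix.mul_assoc]
      have hQU2 : ((U : Op (α ⊕ β)) * Q * (U : Op (α ⊕ β))ᴴ) *
          ((U : Op (α ⊕ β)) * Q * (U : Op (α ⊕ β))ᴴ) =
          (U : Op (α ⊕ β)) * Q * (U : Op (α ⊕ β))ᴴ := by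
        calc _ = (U : Op (α ⊕ β)) * Q * ((U : Op (α ⊕ β))ᴴ * (U : Op (α ⊕ β))) * Q *
              (U : Op (α ⊕ β))ᴴ := by simp only [Matrix.mul_assoc]
          _ = _ := by
            rw [UGroup.conjTranspose_mul, Matrix.mul_one, Matrix.mul_assoc (U : Op (α ⊕ β)), hQ2]
      have h5 := re_sum_trace_opBlock_le (hdens U) hAh hA2 hQU hQU2
      change (Q.trace * ∑ i, f (U * g i)).re ≤ _
      rw [hpt U]
      have h6 : (Fintype.card G : ℂ) * 2 ^ Fintype.card β =
          ((Fintype.card G * 2 ^ Fintype.card β : ℝ) : ℂ) := by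
        push_cast
        rfl
      rw [h6, Complex.re_ofReal_mul]
      exact mul_le_of_le_one_right (by positivity) h5
    rw [← h2, ← h1] at h4
    simp only [integral_const, probReal_univ, one_smul] at h4
    exact le_of_mul_le_mul_left h4 hG
  have hα : (0 : ℝ) < 2 ^ Fintype.card α := by positivity
  have hβ : (1 : ℝ) ≤ 2 ^ Fintype.card β := one_le_pow₀ (by norm_num)
  -- If the queries span the whole message space, `1 - P` vanishes. This case is separate because
  -- `Tr Q` is then zero when there are no auxiliary qubits.
  rcases eq_or_lt_of_le hdle with hdeq | hdlt
  · have hA0 : A = 0 := by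
      rw [← Matrix.trace_conjTranspose_mul_self_eq_zero_iff, hAh, hA2, hA, Matrix.trace_sub, hd,
        Matrix.trace_one]
      have : (d : ℂ) = 2 ^ Fintype.card α := by exact_mod_cast hdeq
      simp [this]
    have hI0 : I = 0 := by
      rw [hI]
      simp [hf, hA0, overlap]
    rw [hI0, Complex.zero_re]
    positivity
  · have hd1 : (d : ℝ) + 1 ≤ 2 ^ Fintype.card α := by exact_mod_cast hdlt
    rw [le_div_iff₀ hα]
    have hd0 : (0 : ℝ) ≤ d := Nat.cast_nonneg d
    have hDpos : 0 < (2 : ℝ) ^ Fintype.card α * 2 ^ Fintype.card β - d := by nlinarith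
    refine le_of_mul_le_mul_left ?_ hDpos
    -- With `N = 2 ^ (n + m)`, the difference `(N - d) (d + 1) - N` equals `d (N - d - 1)`, which is
    -- nonnegative.
    have key : (2 : ℝ) ^ Fintype.card β * 2 ^ Fintype.card α ≤
        ((2 : ℝ) ^ Fintype.card α * 2 ^ Fintype.card β - d) * (d + 1) := by
      have : (d : ℝ) + 1 ≤ 2 ^ Fintype.card α * 2 ^ Fintype.card β := by nlinarith
      nlinarith
    calc _ = ((2 : ℝ) ^ Fintype.card α * 2 ^ Fintype.card β - d) * I.re *
          2 ^ Fintype.card α := by ring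
      _ ≤ 2 ^ Fintype.card β * 2 ^ Fintype.card α := by gcongr
      _ ≤ _ := key

end HaarBound

/-! ### Products of pure states and fresh wires -/

section PureStates

variable {μ τ γ ι κ : Type} [Fintype μ] [DecidableEq μ] [Fintype τ] [DecidableEq τ]
  [Fintype γ] [DecidableEq γ] [Fintype ι] [DecidableEq ι] [Fintype κ] [DecidableEq κ]

theorem isLinearMap_reduced (e : γ ↪ ι) : IsLinearMap ℂ (reduced e) := by
  constructor
  · intro ρ σ
    ext a b
    simp only [reduced, Matrix.of_apply, Matrix.add_apply, ← Finset.sum_add_distrib]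
    refine Finset.sum_congr rfl fun z _ => ?_
    split_ifs <;> simp
  · intro c ρ
    ext a b
    simp only [reduced, Matrix.of_apply, Matrix.smul_apply, smul_eq_mul, Finset.mul_sum, mul_ite,
      mul_zero]

/-- Purity of each register gives one factorization of the joint marginal. Tracing out the message
in both identifies the unknown factor, up to the trace of `ρ`, which is kept because the states
after SWAP tests are not normalized. -/
theorem reduced_of_pureOn (e : μ ⊕ τ ↪ ι) {ψ : Bits μ → ℂ} {φ : Bits τ → ℂ} (hψ : IsKet ψ)
    (hφ : IsKet φ) {ρ : Op ι} (h1 : PureOn (Function.Embedding.inl.trans e) ψ ρ)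
    (h2 : PureOn (Function.Embedding.inr.trans e) φ ρ) (a b : Bits μ) (s t : Bits τ) :
    reduced e ρ (Sum.elim a s) (Sum.elim b t) =
      ψ a * star (ψ b) * (ρ.trace • proj φ) s t := by
  have hψ' : ∑ a, ψ a * star (ψ a) = 1 := by
    rw [← show star ψ ⬝ᵥ ψ = 1 from hψ]
    exact Finset.sum_congr rfl fun a _ => mul_comm _ _
  have hφ' : ∑ a, φ a * star (φ a) = 1 := by
    rw [← show star φ ⬝ᵥ φ = 1 from hφ]
    exact Finset.sum_congr rfl fun a _ => mul_comm _ _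
  have hdis := disjointWires_inl_inr e
  obtain ⟨κ₁, hκ₁⟩ : ∃ κ₁ : Bits τ → Bits τ → ℂ, ∀ a b s t,
      reduced e ρ (Sum.elim a s) (Sum.elim b t) = ψ a * star (ψ b) * κ₁ s t := by
    obtain ⟨R, hR, hρ⟩ := h1
    refine ⟨fun s t => ∑ z : Bits ι, if z ∘ e = zeros _ then
      R (overwrite (Function.Embedding.inr.trans e) s z)
        (overwrite (Function.Embedding.inr.trans e) t z) else 0, fun a b s t => ?_⟩
    simp only [reduced, Matrix.of_apply, ← overwrite_inl_overwrite_inr, hρ, overwrite_comp,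
      hR _ _ (overwrite _ _ _), Finset.mul_sum, mul_ite, mul_zero]
  obtain ⟨κ₂, hκ₂⟩ : ∃ κ₂ : Bits μ → Bits μ → ℂ, ∀ a b s t,
      reduced e ρ (Sum.elim a s) (Sum.elim b t) = φ s * star (φ t) * κ₂ a b := by
    obtain ⟨R, hR, hρ⟩ := h2
    refine ⟨fun a b => ∑ z : Bits ι, if z ∘ e = zeros _ then
      R (overwrite (Function.Embedding.inl.trans e) a z)
        (overwrite (Function.Embedding.inl.trans e) b z) else 0, fun a b s t => ?_⟩
    simp only [reduced, Matrix.of_apply, ← overwrite_inl_overwrite_inr, overwrite_comm hdis, hρ,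
      overwrite_comp, hR _ _ (overwrite _ _ _), Finset.mul_sum, mul_ite, mul_zero]
  have h3 : ∀ s t, κ₁ s t = φ s * star (φ t) * ∑ a, κ₂ a a := by
    intro s t
    have h : ∑ a, reduced e ρ (Sum.elim a s) (Sum.elim a t) = κ₁ s t := by
      simp only [hκ₁, ← Finset.sum_mul, hψ', one_mul]
    rw [← h, Finset.mul_sum]
    exact Finset.sum_congr rfl fun a _ => hκ₂ a a s t
  have h4 : ρ.trace = ∑ a, κ₂ a a := by
    rw [← trace_reduced e ρ]
    simp only [Matrix.trace, Matrix.diag_apply, sum_bits_sum, hκ₂, ← Finset.sum_mul, hφ', one_mul]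
  rw [hκ₁, h3, h4, Matrix.smul_apply, proj, Matrix.vecMulVec_apply, Pi.star_apply, smul_eq_mul]
  ring

/-- The environment of fresh wires in the zero state. -/
def zerosWeight (ι κ : Type) [Fintype κ] [DecidableEq κ] (x y : Bits (ι ⊕ κ)) : ℂ :=
  if x ∘ Sum.inr = zeros κ ∧ y ∘ Sum.inr = zeros κ then 1 else 0

theorem adjoinZeros_eq_extendState (ρ : Op ι) :
    adjoinZeros κ ρ = extendState Function.Embedding.inl (zerosWeight ι κ) ρ := by
  ext x y
  simp only [adjoinZeros, extendState, zerosWeight, Matrix.of_apply, mul_ite, mul_one, mul_zero]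
  rfl

theorem overwrite_inl_comp_inr {α : Type} (e : α ↪ ι) (a : Bits α) (x : Bits (ι ⊕ κ)) :
    overwrite (e.trans Function.Embedding.inl) a x ∘ Sum.inr = x ∘ Sum.inr :=
  overwrite_comp_of_disjoint (f := (Function.Embedding.inr : κ ↪ ι ⊕ κ))
    (by intro i j h; simp at h) a x

theorem indepOf_zerosWeight :
    IndepOf (Function.Embedding.inl : ι ↪ ι ⊕ κ) (zerosWeight ι κ) := by
  intro a b x y
  have h : ∀ (a : Bits ι) (x : Bits (ι ⊕ κ)),
      overwrite Function.Embedding.inl a x ∘ Sum.inr = x ∘ Sum.inr := fun a x =>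
    overwrite_inl_comp_inr (Function.Embedding.refl ι) a x
  simp only [zerosWeight, h]

theorem trace_adjoinZeros (ρ : Op ι) : (adjoinZeros κ ρ).trace = ρ.trace := by
  simp only [Matrix.trace, Matrix.diag_apply, adjoinZeros, Matrix.of_apply, and_self]
  rw [sum_bits_sum]
  refine Finset.sum_congr rfl fun a _ => ?_
  rw [Finset.sum_eq_single (zeros κ)]
  · simp
  · intro b _ hb
    simp [hb]
  · simp

theorem isLinearMap_adjoinZeros : IsLinearMap ℂ (adjoinZeros κ : Op ι → Op (ι ⊕ κ)) := by
  constructor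
  · intro ρ σ
    ext x y
    simp only [adjoinZeros, Matrix.of_apply, Matrix.add_apply]
    split_ifs <;> simp
  · intro c ρ
    ext x y
    simp only [adjoinZeros, Matrix.of_apply, Matrix.smul_apply]
    split_ifs <;> simp

theorem PureOn.adjoinZeros {e : γ ↪ ι} {ψ : Bits γ → ℂ} {ρ : Op ι} (h : PureOn e ψ ρ) :
    PureOn (e.trans Function.Embedding.inl) ψ (adjoinZeros κ ρ) := by
  obtain ⟨R, hR, hρ⟩ := h
  refine ⟨QCrypto.adjoinZeros κ (Matrix.of R), ?_, ?_⟩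
  · intro a b x y
    have h : ∀ (a : Bits γ) (x : Bits (ι ⊕ κ)),
        overwrite (e.trans Function.Embedding.inl) a x ∘ Sum.inl = overwrite e a (x ∘ Sum.inl) :=
      fun a x => overwrite_trans_comp e Function.Embedding.inl a x
    simp only [QCrypto.adjoinZeros, Matrix.of_apply, overwrite_inl_comp_inr, h, hR a b]
  · intro x y
    simp only [QCrypto.adjoinZeros, Matrix.of_apply, hρ]
    split_ifs
    · rfl
    · simp

end PureStates

/-! ### SWAP tests -/

section SwapTests

variable {μ τ γ ι : Type} [Fintype μ] [DecidableEq μ] [Fintype τ] [DecidableEq τ]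
  [Fintype γ] [DecidableEq γ] [Fintype ι] [DecidableEq ι]

/-- The unnormalized state after an accepted SWAP test. -/
def swapTest (e : μ ⊕ μ ↪ ι) (ρ : Op ι) : Op ι := Matrix.of fun x y =>
  (ρ x y + ρ (swapBits e x) y + (ρ x (swapBits e y) + ρ (swapBits e x) (swapBits e y))) / 4

theorem swapTestProj_conj (e : μ ⊕ μ ↪ ι) (ρ : Op ι) :
    swapTestProj e * ρ * (swapTestProj e)ᴴ = swapTest e ρ := by
  have hinv := swapBits_involutive e
  have h1 : ∀ x z, swapTestProj e x z =
      ((if z = x then 1 else 0) + (if z = swapBits e x then 1 else 0)) / 2 := by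
    intro x z
    have h2 : (x = overwrite e (z ∘ e ∘ Sum.swap) z) = (z = swapBits e x) := by
      apply propext
      constructor
      · intro h
        change x = swapBits e z at h
        rw [h, hinv z]
      · intro h
        change x = swapBits e z
        rw [h, hinv x]
    simp only [swapTestProj, Matrix.of_apply, h2, eq_comm (a := x)]
  have h3 : ∀ x (f : Bits ι → ℂ), ∑ z, swapTestProj e x z * f z =
      (f x + f (swapBits e x)) / 2 := by
    intro x f
    simp only [h1, add_div, add_mul, Finset.sum_add_distrib, ite_div, zero_div, ite_mul, zero_mul,
      Finset.sum_ite_eq', Finset.mem_univ, if_true]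
    ring
  have h4 : ∀ x z, star (swapTestProj e x z) = swapTestProj e x z := by
    intro x z
    rw [h1]
    split_ifs <;> simp
  ext x y
  simp only [Matrix.mul_apply, Matrix.conjTranspose_apply, h4, h3]
  simp only [mul_comm _ (swapTestProj e y _), h3, swapTest, Matrix.of_apply]
  ring

theorem isLinearMap_swapTest (e : μ ⊕ μ ↪ ι) : IsLinearMap ℂ (swapTest e) := by
  constructor
  · intro ρ σ
    ext x y
    simp only [swapTest, Matrix.of_apply, Matrix.add_apply]
    ring
  · intro c ρ
    ext x y
    simp only [swapTest, Matrix.of_apply, Matrix.smul_apply, smul_eq_mul]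
    ring

/-- SWAP is an involution, so after reindexing the four terms coincide in pairs. -/
theorem trace_swapTest (e : μ ⊕ μ ↪ ι) (ρ : Op ι) :
    (swapTest e ρ).trace = (ρ.trace + ∑ x, ρ (swapBits e x) x) / 2 := by
  have hb := (swapBits_involutive e).bijective
  have h1 : ∑ x, ρ (swapBits e x) (swapBits e x) = ρ.trace := hb.sum_comp fun x => ρ x x
  have h2 : ∑ x, ρ x (swapBits e x) = ∑ x, ρ (swapBits e x) x := by
    rw [← hb.sum_comp fun x => ρ x (swapBits e x)]
    simp only [swapBits_involutive e _]
  have h0 : ∑ x, ρ x x = ρ.trace := rfl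
  simp only [Matrix.trace, Matrix.diag_apply, swapTest, Matrix.of_apply]
  rw [← Finset.sum_div, Finset.sum_add_distrib, Finset.sum_add_distrib, Finset.sum_add_distrib,
    h1, h2, h0]
  change _ = (ρ.trace + _) / 2
  ring

theorem swapBits_overwrite_of_disjoint {e : μ ⊕ μ ↪ ι} {f : γ ↪ ι} (h : DisjointWires e f)
    (a : Bits γ) (x : Bits ι) : swapBits e (overwrite f a x) = overwrite f a (swapBits e x) := by
  rw [swapBits, swapBits, ← overwrite_comm h, ← Function.comp_assoc,
    overwrite_comp_of_disjoint h.symm, Function.comp_assoc]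

theorem swapBits_comp_of_disjoint {e : μ ⊕ μ ↪ ι} {f : γ ↪ ι} (h : DisjointWires e f)
    (x : Bits ι) : swapBits e x ∘ f = x ∘ f :=
  overwrite_comp_of_disjoint h _ _

/-- The game runs all verifications before all SWAP tests; commutation on disjoint wires permits
finishing one copy at a time. -/
theorem swapTest_call_comm {α β : Type} [Fintype α] [DecidableEq α] [Fintype β] [DecidableEq β]
    {Φ : Op α → Op β} (hΦ : IsLinearMap ℂ Φ) {e : μ ⊕ μ ↪ ι} {f : α ⊕ β ↪ ι}
    (h : DisjointWires e f) (ρ : Op ι) :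
    swapTest e (call Φ f ρ) = call Φ f (swapTest e ρ) := by
  ext x y
  have h1 : callArg f (swapTest e ρ) x y = (1 / 4 : ℂ) • (callArg f ρ x y +
      callArg f ρ (swapBits e x) y + (callArg f ρ x (swapBits e y) +
        callArg f ρ (swapBits e x) (swapBits e y))) := by
    ext a b
    simp only [callArg, swapTest, Matrix.of_apply, swapBits_overwrite_of_disjoint h,
      Matrix.smul_apply, Matrix.add_apply, ← Finset.sum_add_distrib, smul_eq_mul, Finset.mul_sum]
    exact Finset.sum_congr rfl fun c _ => by ring
  rw [call_apply, h1]
  simp only [swapTest, Matrix.of_apply, call_apply, ← Function.comp_assoc,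
    swapBits_comp_of_disjoint h, hΦ.map_smul, hΦ.map_add, Matrix.smul_apply, Matrix.add_apply,
    smul_eq_mul]
  split_ifs <;> ring

theorem PureOn.swapTest_disjoint {e : μ ⊕ μ ↪ ι} {f : γ ↪ ι} (h : DisjointWires e f)
    {ψ : Bits γ → ℂ} {ρ : Op ι} (hρ : PureOn f ψ ρ) : PureOn f ψ (swapTest e ρ) := by
  obtain ⟨R, hR, hρ⟩ := hρ
  refine ⟨swapTest e (Matrix.of R), ?_, ?_⟩
  · intro a b x y
    simp only [swapTest, Matrix.of_apply, swapBits_overwrite_of_disjoint h, hR a b]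
  · intro x y
    simp only [swapTest, Matrix.of_apply, hρ, swapBits_comp_of_disjoint h]
    ring

theorem sum_call_swapBits {Ψ : Op τ → Op μ} (hΨ : IsLinearMap ℂ Ψ) (E : (μ ⊕ τ) ⊕ μ ↪ ι)
    (ρ : Op ι) : ∑ x, call Ψ (tagOut E) ρ (swapBits (msgOut E) x) x =
      overlap 1 Ψ (reduced (Function.Embedding.inl.trans E) ρ) := by
  rw [← sum_call_eq_overlap hΨ]
  refine Finset.sum_congr rfl fun x _ => ?_
  have h : x ∘ msgOut E ∘ Sum.swap =
      Sum.elim (x ∘ E ∘ Sum.inr) (x ∘ E ∘ Sum.inl ∘ Sum.inl) := by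
    funext i
    rcases i with i | i <;> rfl
  rw [swapBits, h, Finset.sum_eq_single (x ∘ E ∘ Sum.inr)]
  · rw [Matrix.one_apply_eq, one_mul]
  · intro a _ ha
    rw [Matrix.one_apply_ne ha.symm, zero_mul]
  · simp

/-- A verification followed by a SWAP test, on a product of pure states. -/
theorem trace_swapTest_call {Ψ : Op τ → Op μ} (hΨ : IsLinearMap ℂ Ψ)
    (hT : ∀ X, (Ψ X).trace = X.trace) (E : (μ ⊕ τ) ⊕ μ ↪ ι) {ψ : Bits μ → ℂ} {φ : Bits τ → ℂ}
    (hψ : IsKet ψ) (hφ : IsKet φ) {ρ : Op ι}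
    (h1 : PureOn (Function.Embedding.inl.trans (Function.Embedding.inl.trans E)) ψ ρ)
    (h2 : PureOn (Function.Embedding.inr.trans (Function.Embedding.inl.trans E)) φ ρ) :
    (swapTest (msgOut E) (call Ψ (tagOut E) ρ)).trace =
      (1 + star ψ ⬝ᵥ (Ψ (proj φ) *ᵥ ψ)) / 2 * ρ.trace := by
  rw [trace_swapTest, trace_call hT, sum_call_swapBits hΨ,
    overlap_pure 1 hΨ (reduced_of_pureOn _ hψ hφ h1 h2), hΨ.map_smul, Matrix.one_mulVec,
    Matrix.smul_mulVec, dotProduct_smul, smul_eq_mul]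
  ring

end SwapTests

/-! ### The winning probability -/

section Winning

variable {μ τ : Type} [Fintype μ] [DecidableEq μ] [Fintype τ] [DecidableEq τ] {q t : ℕ}

theorem msgOut_mem_range {ι : Type} (E : (μ ⊕ τ) ⊕ μ ↪ ι) (a : μ ⊕ μ) :
    ∃ b, msgOut E a = E b := by
  rcases a with a | a
  · exact ⟨.inl (.inl a), rfl⟩
  · exact ⟨.inr a, rfl⟩

theorem tagOut_mem_range {ι : Type} (E : (μ ⊕ τ) ⊕ μ ↪ ι) (a : τ ⊕ μ) :
    ∃ b, tagOut E a = E b := by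
  rcases a with a | a
  · exact ⟨.inl (.inr a), rfl⟩
  · exact ⟨.inr a, rfl⟩

/-- The message, the tag and the verified message of the `j`-th copy of the forgery. -/
def Forger.copyWires (A : Forger μ τ q t) (j : Fin t) :
    (μ ⊕ τ) ⊕ μ ↪ Fin A.width ⊕ (Fin t × μ) :=
  ⟨Sum.map (slot A.forgery j) fun y => (j, y),
    (slot A.forgery j).injective.sumMap fun _ _ h => (Prod.mk.inj h).2⟩

theorem Forger.verWires_eq (A : Forger μ τ q t) (j : Fin t) :
    A.verWires j = tagOut (A.copyWires j) := by
  ext i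
  rcases i with i | i <;> rfl

theorem Forger.swapWires_eq (A : Forger μ τ q t) (j : Fin t) :
    A.swapWires j = msgOut (A.copyWires j) := by
  ext i
  rcases i with i | i <;> rfl

theorem Forger.copyWires_ne (A : Forger μ τ q t) {i j : Fin t} (h : i ≠ j)
    (a b : (μ ⊕ τ) ⊕ μ) : A.copyWires i a ≠ A.copyWires j b := by
  rcases a with a | a <;> rcases b with b | b
  · intro hab
    exact h (Prod.mk.inj (A.forgery.injective (Sum.inl_injective hab))).1
  · intro hab
    cases hab
  · intro hab
    cases hab
  · intro hab
    exact h (Prod.mk.inj (Sum.inr_injective hab)).1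

/-- The unnormalized state after the verification of the copies in `L` and after the SWAP tests,
if `ρ` is the state before the verification. -/
def Forger.verifyCopies (A : Forger μ τ q t) (Ver : Op τ → Op μ) (L : List (Fin t))
    (ρ : Op (Fin A.width ⊕ (Fin t × μ))) : Op (Fin A.width ⊕ (Fin t × μ)) :=
  L.foldl (fun σ j => swapTest (msgOut (A.copyWires j)) σ)
    (L.foldl (fun σ j => call Ver (tagOut (A.copyWires j)) σ) ρ)

theorem Forger.winProb_eq (A : Forger μ τ q t) (Sign : Op μ → Op τ) (Ver : Op τ → Op μ) :
    A.winProb Sign Ver = (A.verifyCopies Ver (List.finRange t)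
      (adjoinZeros (Fin t × μ) (A.output Sign))).trace.re := by
  simp only [Forger.winProb, Forger.verifyCopies, swapTestProj_conj, A.verWires_eq, A.swapWires_eq]

theorem isLinearMap_foldl {ι I : Type} {f : Op ι → I → Op ι}
    (hf : ∀ i, IsLinearMap ℂ fun ρ => f ρ i) (L : List I) :
    IsLinearMap ℂ fun ρ => L.foldl f ρ := by
  induction L with
  | nil => exact ⟨fun _ _ => rfl, fun _ _ => rfl⟩
  | cons i L ih =>
    constructor
    · intro ρ σ
      simp only [List.foldl_cons, (hf i).map_add, ih.map_add]
    · intro c ρ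
      simp only [List.foldl_cons, (hf i).map_smul, ih.map_smul]

theorem Forger.isLinearMap_verifyCopies (A : Forger μ τ q t) {Ver : Op τ → Op μ}
    (hV : IsLinearMap ℂ Ver) (L : List (Fin t)) : IsLinearMap ℂ (A.verifyCopies Ver L) := by
  have h1 := isLinearMap_foldl (fun j => isLinearMap_call hV (tagOut (A.copyWires j))) L
  have h2 := isLinearMap_foldl (fun j => isLinearMap_swapTest (msgOut (A.copyWires j))) L
  exact ((h2.mk' _).comp (h1.mk' _)).isLinear

/-- Each copy contributes the same factor, since treating one copy leaves the pure registers of the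
others intact. -/
theorem Forger.trace_verifyCopies (A : Forger μ τ q t) {Ver : Op τ → Op μ}
    (hV : IsLinearMap ℂ Ver) (hT : ∀ X, (Ver X).trace = X.trace) {ψ : Bits μ → ℂ}
    {φ : Bits τ → ℂ} (hψ : IsKet ψ) (hφ : IsKet φ) {L : List (Fin t)} (hL : L.Nodup)
    {ρ : Op (Fin A.width ⊕ (Fin t × μ))}
    (h1 : ∀ j ∈ L, PureOn (Function.Embedding.inl.trans
      (Function.Embedding.inl.trans (A.copyWires j))) ψ ρ)
    (h2 : ∀ j ∈ L, PureOn (Function.Embedding.inr.trans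
      (Function.Embedding.inl.trans (A.copyWires j))) φ ρ) :
    (A.verifyCopies Ver L ρ).trace =
      ((1 + star ψ ⬝ᵥ (Ver (proj φ) *ᵥ ψ)) / 2) ^ L.length * ρ.trace := by
  induction L generalizing ρ with
  | nil => simp [Forger.verifyCopies]
  | cons j L ih =>
    rw [List.nodup_cons] at hL
    have hne : ∀ i ∈ L, j ≠ i := fun i hi hji => hL.1 (hji ▸ hi)
    -- The SWAP test of copy `j` moves ahead of the verifications of all later copies.
    have hcomm : ∀ (M : List (Fin t)), (∀ i ∈ M, j ≠ i) → ∀ σ,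
        swapTest (msgOut (A.copyWires j))
          (M.foldl (fun σ i => call Ver (tagOut (A.copyWires i)) σ) σ) =
        M.foldl (fun σ i => call Ver (tagOut (A.copyWires i)) σ)
          (swapTest (msgOut (A.copyWires j)) σ) := by
      intro M
      induction M with
      | nil => exact fun _ _ => rfl
      | cons i M ihM =>
        intro hM σ
        rw [List.foldl_cons, List.foldl_cons, ihM fun k hk => hM k (List.mem_cons_of_mem i hk),
          swapTest_call_comm hV]
        intro a b
        have hji := A.copyWires_ne (hM i List.mem_cons_self)
        obtain ⟨a', ha⟩ := msgOut_mem_range (A.copyWires j) a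
        obtain ⟨b', hb⟩ := tagOut_mem_range (A.copyWires i) b
        rw [ha, hb]
        exact hji a' b'
    have hstep : A.verifyCopies Ver (j :: L) ρ = A.verifyCopies Ver L
        (swapTest (msgOut (A.copyWires j)) (call Ver (tagOut (A.copyWires j)) ρ)) := by
      rw [Forger.verifyCopies, Forger.verifyCopies, List.foldl_cons, List.foldl_cons,
        hcomm L hne]
    rw [hstep, ih hL.2, trace_swapTest_call hV hT _ hψ hφ (h1 j List.mem_cons_self)
      (h2 j List.mem_cons_self), List.length_cons, pow_succ]
    · ring
    · intro i hi
      have hji := A.copyWires_ne (hne i hi)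
      refine PureOn.swapTest_disjoint ?_ (PureOn.call_disjoint hV ?_
        (h1 i (List.mem_cons_of_mem j hi)))
      · intro a b
        obtain ⟨a', ha⟩ := msgOut_mem_range (A.copyWires j) a
        rw [ha]
        exact hji a' (.inl (.inl b))
      · intro a b
        obtain ⟨a', ha⟩ := tagOut_mem_range (A.copyWires j) a
        rw [ha]
        exact hji a' (.inl (.inl b))
    · intro i hi
      have hji := A.copyWires_ne (hne i hi)
      refine PureOn.swapTest_disjoint ?_ (PureOn.call_disjoint hV ?_
        (h2 i (List.mem_cons_of_mem j hi)))
      · intro a b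
        obtain ⟨a', ha⟩ := msgOut_mem_range (A.copyWires j) a
        rw [ha]
        exact hji a' (.inl (.inr b))
      · intro a b
        obtain ⟨a', ha⟩ := tagOut_mem_range (A.copyWires j) a
        rw [ha]
        exact hji a' (.inl (.inr b))

/-- On `[0, 1]` the convex function `(1 + x) ^ t` lies below its chord `1 + (2 ^ t - 1) x`. The
result is linear in `x`, so the forgery of all copies is controlled by an expectation on a single
copy. -/
theorem half_add_pow_le {x : ℝ} (h0 : 0 ≤ x) (h1 : x ≤ 1) (t : ℕ) :
    ((1 + x) / 2) ^ t ≤ (1 / 2) ^ t + x := by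
  have h : (1 + x) ^ t ≤ 1 + (2 ^ t - 1) * x := by
    induction t with
    | zero => simp
    | succ t ih =>
      have h2 : (1 : ℝ) ≤ 2 ^ t := one_le_pow₀ (by norm_num)
      calc (1 + x) ^ (t + 1) = (1 + x) ^ t * (1 + x) := pow_succ _ _
        _ ≤ (1 + (2 ^ t - 1) * x) * (1 + x) := by gcongr
        _ ≤ 1 + (2 ^ (t + 1) - 1) * x := by
          have : (2 ^ t - 1) * (x * x) ≤ (2 ^ t - 1) * x := by
            apply mul_le_mul_of_nonneg_left _ (by linarith)
            nlinarith
          rw [pow_succ]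
          nlinarith
  have h3 : (0 : ℝ) < 2 ^ t := by positivity
  rw [div_pow, div_pow, one_pow, div_add' _ _ _ h3.ne', div_le_div_iff_of_pos_right h3]
  nlinarith

variable {β : Type} [Fintype β] [DecidableEq β]

/-- The forged message is orthogonal to the queries, so `P` kills it and the overlap weighted with
`1 - P` is the full fidelity `x`. Any copy `j` gives the same value. -/
theorem Forger.win_le_of_forges (A : Forger μ (μ ⊕ β) q t) (V : Isom μ β)
    {ψ : Fin q → Bits μ → ℂ} {P : Op μ} (hP : ∀ v, (∀ i, star (ψ i) ⬝ᵥ v = 0) → P *ᵥ v = 0)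
    (j : Fin t) {ω : Op (Fin A.width)} (hω : A.Forges ψ ω) :
    (A.verifyCopies (inverseChannel V) (List.finRange t)
      (adjoinZeros (Fin t × μ) ω)).trace.re ≤
      (1 / 2) ^ t + (overlap (1 - P) (inverseChannel V) (reduced (slot A.forgery j) ω)).re := by
  obtain ⟨hdens, ψ', φ', hψ', hφ', hperp, hred⟩ := hω
  have h1 : ∀ j, PureOn (Function.Embedding.inl.trans (slot A.forgery j)) ψ' ω := fun j =>
    pureOn_of_reduced _ hψ' hdens.1 (hred j).1
  have h2 : ∀ j, PureOn (Function.Embedding.inr.trans (slot A.forgery j)) φ' ω := fun j =>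
    pureOn_of_reduced _ hφ' hdens.1 (hred j).2
  set x := star ψ' ⬝ᵥ (inverseChannel V (proj φ') *ᵥ ψ') with hx
  have hwin := A.trace_verifyCopies (isLinearMap_inverseChannel V) (trace_inverseChannel V) hψ' hφ'
    (List.nodup_finRange t) (ρ := adjoinZeros (Fin t × μ) ω) (fun j _ => (h1 j).adjoinZeros)
    (fun j _ => (h2 j).adjoinZeros)
  rw [trace_adjoinZeros, hdens.2, mul_one, List.length_finRange] at hwin
  have hover : overlap (1 - P) (inverseChannel V) (reduced (slot A.forgery j) ω) = x := by
    rw [overlap_pure _ (isLinearMap_inverseChannel V)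
      (reduced_of_pureOn _ hψ' hφ' (h1 j) (h2 j)), hdens.2, one_smul, Matrix.sub_mulVec,
      hP ψ' hperp, sub_zero, Matrix.one_mulVec]
  have hφd : IsDensity (proj φ') := by
    refine ⟨Matrix.posSemidef_vecMulVec_self_star φ', ?_⟩
    rw [proj, Matrix.trace_vecMulVec, dotProduct_comm]
    exact hφ'
  have hmem := dotProduct_inverseChannel_mem V hψ' hφd
  have hherm : (inverseChannel V (proj φ')).IsHermitian := by
    rw [Matrix.IsHermitian, ← conjTranspose_inverseChannel, hφd.1.isHermitian.eq]
  -- Without this, the real part of the power could not be compared with the power of the real part.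
  have hxre : x = (x.re : ℂ) := by
    apply Complex.ext
    · simp
    · simpa using hherm.im_star_dotProduct_mulVec_self ψ'
  rw [← hx] at hwin hmem
  rw [hwin, hover, hxre]
  have h3 : ((1 + (x.re : ℂ)) / 2) ^ t = ((((1 + x.re) / 2) ^ t : ℝ) : ℂ) := by
    push_cast
    rfl
  rw [h3, Complex.ofReal_re, Complex.ofReal_re]
  exact half_add_pow_le hmem.1 hmem.2 t

/-- Both sides are linear in `ω` up to the constant, so the admissible states form a half-space,
which contains the convex hull. -/
theorem Forger.win_le_of_mem_convexHull (A : Forger μ (μ ⊕ β) q t) (V : Isom μ β)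
    {ψ : Fin q → Bits μ → ℂ} {P : Op μ} (hP : ∀ v, (∀ i, star (ψ i) ⬝ᵥ v = 0) → P *ᵥ v = 0)
    (j : Fin t) {ω : Op (Fin A.width)} (hω : ω ∈ convexHull ℝ {ω | A.Forges ψ ω}) :
    (A.verifyCopies (inverseChannel V) (List.finRange t)
      (adjoinZeros (Fin t × μ) ω)).trace.re ≤
      (1 / 2) ^ t + (overlap (1 - P) (inverseChannel V) (reduced (slot A.forgery j) ω)).re := by
  have hlin : IsLinearMap ℝ fun ω : Op (Fin A.width) =>
      (A.verifyCopies (inverseChannel V) (List.finRange t)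
        (adjoinZeros (Fin t × μ) ω)).trace.re -
      (overlap (1 - P) (inverseChannel V) (reduced (slot A.forgery j) ω)).re := by
    have hL := A.isLinearMap_verifyCopies (isLinearMap_inverseChannel V) (List.finRange t)
    have hO := isLinearMap_overlap (isLinearMap_inverseChannel V) (1 - P)
    have hR := isLinearMap_reduced (slot A.forgery j)
    have hZ : IsLinearMap ℂ (adjoinZeros (Fin t × μ) : Op (Fin A.width) → _) :=
      isLinearMap_adjoinZeros
    constructor
    · intro ρ σ
      simp only [hZ.map_add, hL.map_add, hR.map_add, hO.map_add, Matrix.trace_add, Complex.add_re]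
      ring
    · intro c ρ
      have hc : ∀ {ι : Type} [Fintype ι] (X : Op ι), c • X = (c : ℂ) • X := fun X => by
        ext x y
        simp
      simp only [hc, hZ.map_smul, hL.map_smul, hR.map_smul, hO.map_smul, Matrix.trace_smul,
        smul_eq_mul, Complex.re_ofReal_mul]
      ring
  have hsub : convexHull ℝ {ω | A.Forges ψ ω} ⊆ {ω : Op (Fin A.width) |
      (A.verifyCopies (inverseChannel V) (List.finRange t)
        (adjoinZeros (Fin t × μ) ω)).trace.re -
      (overlap (1 - P) (inverseChannel V) (reduced (slot A.forgery j) ω)).re ≤ (1 / 2) ^ t} := by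
    refine convexHull_min (fun ω hω => ?_) (convex_halfSpace_le hlin _)
    have := A.win_le_of_forges V hP j hω
    simp only [Set.mem_ofPred_eq]
    linarith
  have := hsub hω
  simp only [Set.mem_ofPred_eq] at this
  linarith

end Winning

/-! ### Forgers with Haar signing -/

section HaarSigning

variable {α β ι : Type} [Fintype α] [DecidableEq α] [Fintype β] [DecidableEq β]
  [Fintype ι] [DecidableEq ι] {q t : ℕ}

theorem continuous_call_isomChannel {T : Type*} [TopologicalSpace T] {V : T → Isom α β}
    {ρ : T → Op ι} (hV : Continuous fun s => (V s).1) (hρ : Continuous ρ)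
    (e : α ⊕ (α ⊕ β) ↪ ι) : Continuous fun s => call (isomChannel (V s)) e (ρ s) := by
  refine continuous_matrix fun x y => ?_
  simp only [call_apply, isomChannel_apply]
  split_ifs
  · refine continuous_finsetSum _ fun a _ => continuous_finsetSum _ fun b _ => ?_
    refine ((hV.matrix_elem _ _).mul (hV.matrix_elem _ _).star).mul ?_
    simp only [callArg, Matrix.of_apply]
    exact continuous_finsetSum _ fun c _ => hρ.matrix_elem _ _
  · exact continuous_const

theorem continuous_callSlots_isomChannel {T : Type*} [TopologicalSpace T] {V : T → Isom α β}
    {ρ : T → Op ι} (hV : Continuous fun s => (V s).1) (hρ : Continuous ρ)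
    (e : Fin q × (α ⊕ (α ⊕ β)) ↪ ι) (L : List (Fin q)) :
    Continuous fun s => callSlots (isomChannel (V s)) e L (ρ s) := by
  induction L generalizing ρ with
  | nil => exact hρ
  | cons i L ih => exact ih (continuous_call_isomChannel hV hρ (slot e i))

theorem Forger.continuous_finish (A : Forger α (α ⊕ β) q t) (σ : Op (Fin A.width)) :
    Continuous fun U : UGroup (α ⊕ β) => A.finish (isomChannel (truncate U)) σ := by
  have hV : Continuous fun U : UGroup (α ⊕ β) => (truncate U : Isom α β).1 :=
    continuous_subtype_val.matrix_mul continuous_const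
  exact (IsLinearMap.continuous_op (isLinearMap_runGates A.stage2)).comp
    (continuous_callSlots_isomChannel hV continuous_const A.query (List.finRange q))

theorem Forger.isDensity_finish (A : Forger α (α ⊕ β) q t) (V : Isom α β)
    {σ : Op (Fin A.width)} (hσ : IsDensity σ) : IsDensity (A.finish (isomChannel V) σ) :=
  isDensity_runGates _ (isDensity_callSlots V A.query _ hσ)

/-- All that a forger learns about the isometry is its action on the queried vectors. -/
theorem Forger.finish_congr (A : Forger α (α ⊕ β) q t) {V V' : Isom α β}
    {ψ : Fin q → Bits α → ℂ} (hψ : ∀ i, IsKet (ψ i)) {σ : Op (Fin A.width)} (hσ : A.Sends ψ σ)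
    (h : ∀ i, V.1 *ᵥ ψ i = V'.1 *ᵥ ψ i) :
    A.finish (isomChannel V) σ = A.finish (isomChannel V') σ :=
  congrArg (runGates A.stage2) (callSlots_congr h A.query (List.nodup_finRange q) fun i _ =>
    pureOn_of_reduced _ (hψ i) hσ.1.1 (hσ.2 i))

/-- Against a Haar isometry, the overlap of the forged message with the result of the
verification is small outside of the span of the queried messages. -/
theorem Forger.integral_overlap_le (A : Forger α (α ⊕ β) q t) {ψ : Fin q → Bits α → ℂ}
    (hψ : ∀ i, IsKet (ψ i)) {σ : Op (Fin A.width)} (hσ : A.Sends ψ σ) {P : Op α} {d : ℕ}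
    (hP : P.IsHermitian) (hP2 : P * P = P) (hd : P.trace = d) (hfix : ∀ i, P *ᵥ ψ i = ψ i)
    (j : Fin t) :
    (∫ U, overlap (1 - P) (inverseChannel (truncate U)) (reduced (slot A.forgery j)
      (A.finish (isomChannel (truncate U)) σ)) ∂(haarUnitary (α ⊕ β))).re ≤
      (d + 1) / 2 ^ Fintype.card α := by
  have hcont : Continuous fun U : UGroup (α ⊕ β) => reduced (slot A.forgery j)
      (A.finish (isomChannel (truncate U)) σ) :=
    (IsLinearMap.continuous_op (isLinearMap_reduced _)).comp (A.continuous_finish σ)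
  -- Because `P` fixes each query, a unitary that fixes the padded range of `P` does not change the
  -- tags.
  have hmul : ∀ U W : UGroup (α ⊕ β), ∀ i,
      (W : Op (α ⊕ β)) * (appendZeros α β * P) = appendZeros α β * P →
      (truncate (U * W)).1 *ᵥ ψ i = (truncate U).1 *ᵥ ψ i := by
    intro U W i hW
    have h1 : ∀ Y : Op (α ⊕ β), (Y * appendZeros α β) *ᵥ ψ i =
        (Y * (appendZeros α β * P)) *ᵥ ψ i := by
      intro Y
      rw [← Matrix.mul_assoc, ← Matrix.mulVec_mulVec (ψ i) (Y * appendZeros α β) P, hfix]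
    change (((U * W : UGroup (α ⊕ β)) : Op (α ⊕ β)) * appendZeros α β) *ᵥ ψ i =
      ((U : Op (α ⊕ β)) * appendZeros α β) *ᵥ ψ i
    rw [h1, h1, Submonoid.coe_mul, Matrix.mul_assoc, hW]
  have hinv : ∀ U W : UGroup (α ⊕ β),
      (W : Op (α ⊕ β)) * (appendZeros α β * P) = appendZeros α β * P →
      reduced (slot A.forgery j) (A.finish (isomChannel (truncate (U * W))) σ) =
        reduced (slot A.forgery j) (A.finish (isomChannel (truncate U)) σ) := by
    intro U W hW
    rw [A.finish_congr hψ hσ fun i => hmul U W i hW]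
  -- Elements of the stabilizer fix every padded message, in particular the queries, so the state is
  -- invariant as required for passing to the inverse of `U`.
  rw [integral_overlap_inverseChannel _ hcont]
  · exact integral_overlap_unitaryInverse_le hP hP2 hd hcont
      (fun U => isDensity_reduced _ (A.isDensity_finish _ hσ.1)) hinv
  · intro U W hW
    refine hinv U W ?_
    rw [← Matrix.mul_assoc, show (W : Op (α ⊕ β)) * appendZeros α β = appendZeros α β from hW]

end HaarSigning

/-! ### Oracle circuits and Hadamard-test distinguishers -/

section OracleCircuits

variable {α β ι κ : Type} [Fintype α] [DecidableEq α] [Fintype β] [DecidableEq β]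
  [Fintype ι] [DecidableEq ι] [Fintype κ] [DecidableEq κ]

/-- Linear maps that preserve the trace and the adjoint. -/
structure IsTracePreserving (Φ : Op α → Op β) : Prop where
  isLinearMap : IsLinearMap ℂ Φ
  trace_apply : ∀ X, (Φ X).trace = X.trace
  conjTranspose_apply : ∀ X, Φ Xᴴ = (Φ X)ᴴ

theorem isTracePreserving_isomChannel (V : Isom α β) : IsTracePreserving (isomChannel V) where
  isLinearMap := isLinearMap_isomChannel V
  trace_apply := trace_isomChannel V
  conjTranspose_apply X := by simp [isomChannel, Matrix.mul_assoc]

theorem isTracePreserving_inverseChannel (V : Isom α β) :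
    IsTracePreserving (inverseChannel V) where
  isLinearMap := isLinearMap_inverseChannel V
  trace_apply := trace_inverseChannel V
  conjTranspose_apply := conjTranspose_inverseChannel V

theorem isTracePreserving_gate (g : Gate ι) : IsTracePreserving g.apply where
  isLinearMap := g.isLinearMap_apply
  trace_apply := g.trace_apply
  conjTranspose_apply ρ := by
    cases g
    case measure i =>
      ext x y
      simp only [Gate.apply, Matrix.of_apply, Matrix.conjTranspose_apply, eq_comm (a := x i)]
      split_ifs <;> simp
    all_goals simp [Gate.apply, Matrix.mul_assoc]

theorem IsTracePreserving.call {Φ : Op α → Op β} (hΦ : IsTracePreserving Φ) (e : α ⊕ β ↪ ι) :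
    IsTracePreserving (call Φ e) where
  isLinearMap := isLinearMap_call hΦ.isLinearMap e
  trace_apply := trace_call hΦ.trace_apply e
  conjTranspose_apply := conjTranspose_call hΦ.conjTranspose_apply e

/-- Relabel the wires of an operation of an oracle circuit. -/
def OracleOp.map (f : ι ↪ κ) : OracleOp α β ι → OracleOp α β κ
  | .gate g => .gate (g.map f)
  | .forward e => .forward (e.trans f)
  | .backward e => .backward (e.trans f)

/-- Run a list of operations of an oracle circuit, from left to right. -/
def runOps (Φ : Op α → Op β) (Ψ : Op β → Op α) (ops : List (OracleOp α β ι)) (ρ : Op ι) : Op ι :=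
  ops.foldl (fun σ o => o.apply Φ Ψ σ) ρ

theorem runOps_append (Φ : Op α → Op β) (Ψ : Op β → Op α) (ops ops' : List (OracleOp α β ι))
    (ρ : Op ι) : runOps Φ Ψ (ops ++ ops') ρ = runOps Φ Ψ ops' (runOps Φ Ψ ops ρ) :=
  List.foldl_append

theorem runOps_gates (Φ : Op α → Op β) (Ψ : Op β → Op α) (C : List (Gate ι)) (ρ : Op ι) :
    runOps Φ Ψ (C.map OracleOp.gate) ρ = runGates C ρ :=
  List.foldl_map

variable {Φ : Op α → Op β} {Ψ : Op β → Op α}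

theorem runOps_map (hΦ : IsTracePreserving Φ) (hΨ : IsTracePreserving Ψ) (f : ι ↪ κ)
    {E : Bits κ → Bits κ → ℂ} (hE : IndepOf f E) (ops : List (OracleOp α β ι)) (ρ : Op ι) :
    runOps Φ Ψ (ops.map (OracleOp.map f)) (extendState f E ρ) =
      extendState f E (runOps Φ Ψ ops ρ) := by
  induction ops generalizing ρ with
  | nil => rfl
  | cons o ops ih =>
    have h : (o.map f).apply Φ Ψ (extendState f E ρ) = extendState f E (o.apply Φ Ψ ρ) := by
      cases o with
      | gate g => exact g.apply_map f hE ρ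
      | forward e => exact call_extendState hΦ.isLinearMap e f hE ρ
      | backward e => exact call_extendState hΨ.isLinearMap e f hE ρ
    change runOps Φ Ψ (ops.map (OracleOp.map f)) ((o.map f).apply Φ Ψ (extendState f E ρ)) = _
    rw [h, ih]
    rfl

theorem isTracePreserving_runOps (hΦ : IsTracePreserving Φ) (hΨ : IsTracePreserving Ψ)
    (ops : List (OracleOp α β ι)) : IsTracePreserving (runOps Φ Ψ ops) := by
  induction ops with
  | nil => exact ⟨⟨fun _ _ => rfl, fun _ _ => rfl⟩, fun _ => rfl, fun _ => rfl⟩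
  | cons o ops ih =>
    have h : IsTracePreserving (o.apply Φ Ψ : Op ι → Op ι) := by
      cases o with
      | gate g => exact isTracePreserving_gate g
      | forward e => exact hΦ.call e
      | backward e => exact hΨ.call e
    refine ⟨((ih.isLinearMap.mk' _).comp (h.isLinearMap.mk' _)).isLinear, fun ρ => ?_, fun ρ => ?_⟩
    · exact (ih.trace_apply _).trans (h.trace_apply ρ)
    · change runOps Φ Ψ ops (o.apply Φ Ψ ρᴴ) = (runOps Φ Ψ ops (o.apply Φ Ψ ρ))ᴴ
      rw [h.conjTranspose_apply, ih.conjTranspose_apply]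

/-- The product state of `ρ` and `X`. -/
def adjoinState (X : Op κ) (ρ : Op ι) : Op (ι ⊕ κ) :=
  extendState Function.Embedding.inl (fun x y => X (x ∘ Sum.inr) (y ∘ Sum.inr)) ρ

theorem indepOf_comp_inr (X : Op κ) : IndepOf (Function.Embedding.inl : ι ↪ ι ⊕ κ)
    fun x y => X (x ∘ Sum.inr) (y ∘ Sum.inr) := by
  intro a b x y
  have h : ∀ (a : Bits ι) (x : Bits (ι ⊕ κ)),
      overwrite Function.Embedding.inl a x ∘ Sum.inr = x ∘ Sum.inr := fun a x =>
    overwrite_inl_comp_inr (Function.Embedding.refl ι) a x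
  simp only [h]

theorem isDensity_adjoinState {X : Op κ} (hX : IsDensity X) {ρ : Op ι} (hρ : IsDensity ρ) :
    IsDensity (adjoinState X ρ) := by
  constructor
  · exact (hρ.1.submatrix fun x : Bits (ι ⊕ κ) => x ∘ Sum.inl).hadamard
      (hX.1.submatrix fun x : Bits (ι ⊕ κ) => x ∘ Sum.inr)
  · simp only [Matrix.trace, Matrix.diag_apply]
    rw [sum_bits_sum]
    have h : ∀ (a : Bits ι) (b : Bits κ),
        adjoinState X ρ (Sum.elim a b) (Sum.elim a b) = ρ a a * X b b := fun a b => rfl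
    simp only [h, ← Finset.mul_sum, ← Finset.sum_mul]
    have h1 : ∑ a, ρ a a = 1 := hρ.2
    have h2 : ∑ b, X b b = 1 := hX.2
    rw [h1, h2, one_mul]

theorem isDensity_adjoinZeros {ρ : Op ι} (hρ : IsDensity ρ) : IsDensity (adjoinZeros κ ρ) := by
  have h1 : adjoinZeros κ ρ = adjoinState (proj (Pi.single (zeros κ) 1)) ρ := by
    ext x y
    simp only [adjoinZeros, adjoinState, extendState, proj, Matrix.of_apply,
      Matrix.vecMulVec_apply, Pi.single_apply, Pi.star_apply]
    by_cases hx : x ∘ Sum.inr = zeros κ <;> by_cases hy : y ∘ Sum.inr = zeros κ <;>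
      simp [hx, hy] <;> rfl
  rw [h1]
  refine isDensity_adjoinState ⟨Matrix.posSemidef_vecMulVec_self_star _, ?_⟩ hρ
  change (Matrix.vecMulVec (Pi.single (zeros κ) (1 : ℂ)) (star (Pi.single (zeros κ) 1))).trace = 1
  rw [Matrix.trace_vecMulVec]
  simp

theorem reduced_adjoinZeros {γ : Type} [Fintype γ] [DecidableEq γ] (e : γ ↪ ι) (ρ : Op ι) :
    reduced (e.trans Function.Embedding.inl) (adjoinZeros κ ρ) = reduced e ρ := by
  ext a b
  simp only [reduced, Matrix.of_apply, adjoinZeros, overwrite_inl_comp_inr]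
  have h : ∀ (a : Bits γ) (x : Bits (ι ⊕ κ)),
      overwrite (e.trans Function.Embedding.inl) a x ∘ Sum.inl = overwrite e a (x ∘ Sum.inl) :=
    fun a x => overwrite_trans_comp e Function.Embedding.inl a x
  simp only [h]
  rw [sum_bits_sum]
  refine Finset.sum_congr rfl fun z _ => ?_
  simp only [Sum.elim_comp_inl, Sum.elim_comp_inr, and_self]
  rw [Finset.sum_eq_single (zeros κ)]
  · simp only [if_true]
    rfl
  · intro c _ hc
    simp [hc]
  · simp

theorem sum_bits_equiv {M : Type*} [AddCommMonoid M] (f : ι ≃ κ) (g : Bits ι → M) :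
    ∑ x : Bits κ, g (x ∘ f) = ∑ x, g x :=
  (Equiv.arrowCongr f.symm (Equiv.refl Bool)).sum_comp g

/-- The Hadamard test of a reversible map on the output of an oracle circuit, as a
distinguisher. -/
theorem exists_hadamardTest (ops : List (OracleOp α β ι)) {ρ : Op ι} (hρ : IsDensity ρ)
    (C : List (Gate (ι ⊕ Unit))) {F : Bits ι → Bits ι} (hF : Function.Bijective F)
    (hC : ∀ ρ, runGates C ρ = ρ.submatrix (controlled F) (controlled F)) :
    ∃ D : Distinguisher α β, D.size = Fintype.card ι + ops.length + C.length + 3 ∧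
      ∀ Φ Ψ, IsTracePreserving Φ → IsTracePreserving Ψ →
        1 - 2 * D.acceptProb Φ Ψ = (∑ z, runOps Φ Ψ ops ρ (F z) z).re := by
  -- Distinguishers live on numbered wires. With the constant weight, `extendState` along this
  -- bijection is a pure renaming.
  let f := Fintype.equivFin (ι ⊕ Unit)
  let E : Bits (Fin (Fintype.card (ι ⊕ Unit))) → Bits (Fin (Fintype.card (ι ⊕ Unit))) → ℂ :=
    fun _ _ => 1
  have hE : IndepOf f.toEmbedding E := fun _ _ _ _ => rfl
  have hsub : ∀ ρ : Op (ι ⊕ Unit), extendState f.toEmbedding E ρ =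
      ρ.submatrix (fun x => x ∘ f) fun x => x ∘ f := by
    intro ρ
    ext x y
    exact mul_one _
  let test : List (Gate (ι ⊕ Unit)) :=
    Gate.hadamard (Sum.inr ()) :: (C ++ [Gate.hadamard (Sum.inr ())])
  let ops' : List (OracleOp α β (ι ⊕ Unit)) :=
    ops.map (OracleOp.map Function.Embedding.inl) ++ test.map OracleOp.gate
  have hdens : IsDensity (extendState f.toEmbedding E (adjoinZeros Unit ρ)) := by
    rw [hsub]
    refine ⟨(isDensity_adjoinZeros hρ).1.submatrix _, ?_⟩
    rw [← (isDensity_adjoinZeros (κ := Unit) hρ).2]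
    exact sum_bits_equiv f fun x => adjoinZeros Unit ρ x x
  let D : Distinguisher α β :=
    { width := Fintype.card (ι ⊕ Unit)
      advice := extendState f.toEmbedding E (adjoinZeros Unit ρ)
      isDensity := hdens
      ops := ops'.map (OracleOp.map f.toEmbedding)
      out := f (Sum.inr ()) }
  refine ⟨D, ?_, fun Φ Ψ hΦ hΨ => ?_⟩
  · simp only [D, Distinguisher.size, ops', test, List.length_map, List.length_append,
      List.length_cons, List.length_nil, Fintype.card_sum, Fintype.card_unit]
    omega
  · have hrun : runOps Φ Ψ (ops'.map (OracleOp.map f.toEmbedding))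
        (extendState f.toEmbedding E (adjoinZeros Unit ρ)) =
        (runGates test (adjoinZeros Unit (runOps Φ Ψ ops ρ))).submatrix
          (fun x => x ∘ f) fun x => x ∘ f := by
      rw [runOps_map hΦ hΨ _ hE, hsub, runOps_append, adjoinZeros_eq_extendState,
        runOps_map hΦ hΨ _ indepOf_zerosWeight, runOps_gates, adjoinZeros_eq_extendState]
    have hp := isTracePreserving_runOps hΦ hΨ ops
    have htest := hadamardTest C F hF hC (runOps Φ Ψ ops ρ)
      (by rw [← hp.conjTranspose_apply, hρ.1.isHermitian.eq])
    rw [hp.trace_apply, hρ.2, Complex.one_re] at htest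
    have hacc : D.acceptProb Φ Ψ = (1 - (∑ z, runOps Φ Ψ ops ρ (F z) z).re) / 2 := by
      rw [← htest]
      change (∑ x : Bits (Fin (Fintype.card (ι ⊕ Unit))), if x (f (Sum.inr ())) then
        runOps Φ Ψ (ops'.map (OracleOp.map f.toEmbedding))
          (extendState f.toEmbedding E (adjoinZeros Unit ρ)) x x else 0).re = _
      rw [hrun]
      exact congrArg Complex.re (sum_bits_equiv f fun x => if x (Sum.inr ()) then
        runGates test (adjoinZeros Unit (runOps Φ Ψ ops ρ)) x x else 0)
    rw [hacc]
    ring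

end OracleCircuits

/-! ### Distinguishers that estimate overlaps -/

section OverlapDistinguishers

variable {μ τ ι : Type} [Fintype μ] [DecidableEq μ] [Fintype τ] [DecidableEq τ]
  [Fintype ι] [DecidableEq ι]

/-- The register `e (inl ·)` and an additional register. -/
def fstAux (e : μ ⊕ μ ↪ ι) : μ ⊕ μ ↪ ι ⊕ μ :=
  ⟨Sum.map (fun a => e (.inl a)) id,
    (e.injective.comp Sum.inl_injective).sumMap Function.injective_id⟩

theorem swapBits_trans_inl (e : μ ⊕ μ ↪ ι) (x : Bits ι) (c : Bits μ) :
    swapBits (e.trans Function.Embedding.inl) (Sum.elim x c) = Sum.elim (swapBits e x) c := by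
  have h1 : swapBits (e.trans Function.Embedding.inl) (Sum.elim x c) ∘ Sum.inl = swapBits e x :=
    overwrite_trans_comp e Function.Embedding.inl _ _
  have h2 : swapBits (e.trans Function.Embedding.inl) (Sum.elim x c) ∘ Sum.inr = c :=
    overwrite_inl_comp_inr e _ _
  rw [← h1]
  conv_rhs => rw [← h2]
  exact (Sum.elim_comp_inl_inr _).symm

theorem swapBits_fstAux (e : μ ⊕ μ ↪ ι) (x : Bits ι) (c : Bits μ) :
    swapBits (fstAux e) (Sum.elim x c) =
      Sum.elim (overwrite (Function.Embedding.inl.trans e) c x) (x ∘ e ∘ Sum.inl) := by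
  funext i
  rcases i with i | i
  · by_cases hi : ∃ j, e (.inl j) = i
    · obtain ⟨j, rfl⟩ := hi
      trans c j
      · exact overwrite_emb (fstAux e) _ _ (.inl j)
      · exact (overwrite_emb (Function.Embedding.inl.trans e) c x j).symm
    · push Not at hi
      rw [swapBits, overwrite_of_forall_ne]
      · exact (overwrite_of_forall_ne (Function.Embedding.inl.trans e) c x hi).symm
      · rintro (j | j) h
        · exact hi j (Sum.inl_injective h)
        · cases h
  · exact overwrite_emb (fstAux e) _ _ (.inr i)

/-- Two overlapping swaps compose to the cyclic shift of message, output and additional register. -/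
theorem swapBits_fstAux_swapBits (e : μ ⊕ μ ↪ ι) (x : Bits ι) (c : Bits μ) :
    swapBits (fstAux e) (swapBits (e.trans Function.Embedding.inl) (Sum.elim x c)) =
      Sum.elim (overwrite e (Sum.elim c (x ∘ e ∘ Sum.inl)) x) (x ∘ e ∘ Sum.inr) := by
  have h1 : swapBits e x ∘ e ∘ Sum.inl = x ∘ e ∘ Sum.inr :=
    congrArg (fun y : Bits (μ ⊕ μ) => y ∘ Sum.inl) (swapBits_comp e x)
  have h2 : x ∘ e ∘ Sum.swap = Sum.elim (x ∘ e ∘ Sum.inr) (x ∘ e ∘ Sum.inl) := by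
    funext i
    rcases i with i | i <;> rfl
  rw [swapBits_trans_inl, swapBits_fstAux, h1, swapBits, h2, ← overwrite_inl_overwrite_inr,
    overwrite_overwrite, overwrite_inl_overwrite_inr]

/-- The trace of a 3-cycle against a product with `X` multiplies `X` into the SWAP expectation. The
weight is thereby realized by a state, and `X` needs no efficient circuit. -/
theorem sum_adjoinState_call_swapBits {Ψ : Op τ → Op μ} (hΨ : IsLinearMap ℂ Ψ)
    (E : (μ ⊕ τ) ⊕ μ ↪ ι) (X : Op μ) (ρ : Op ι) :
    ∑ z, adjoinState X (call Ψ (tagOut E) ρ) (swapBits (fstAux (msgOut E))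
        (swapBits ((msgOut E).trans Function.Embedding.inl) z)) z =
      overlap X Ψ (reduced (Function.Embedding.inl.trans E) ρ) := by
  rw [← sum_call_eq_overlap hΨ, sum_bits_sum]
  refine Finset.sum_congr rfl fun x _ => Finset.sum_congr rfl fun c _ => ?_
  rw [swapBits_fstAux_swapBits]
  exact mul_comm _ _

variable {q t : ℕ}

/-- The run of a forger after its first stage, as operations of an oracle circuit. -/
def Forger.ops (A : Forger μ τ q t) : List (OracleOp μ τ (Fin A.width)) :=
  (List.finRange q).map (fun i => OracleOp.forward (slot A.query i)) ++
    A.stage2.map OracleOp.gate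

theorem Forger.runOps_ops (A : Forger μ τ q t) (Φ : Op μ → Op τ) (Ψ : Op τ → Op μ)
    (σ : Op (Fin A.width)) : runOps Φ Ψ A.ops σ = A.finish Φ σ := by
  rw [Forger.ops, runOps_append, runOps_gates, Forger.finish]
  congr 1
  exact List.foldl_map

/-- The wires of the `j`-th copy of a forgery, and an additional register. -/
def Forger.forgeryAux (A : Forger μ τ q t) (j : Fin t) : (μ ⊕ τ) ⊕ μ ↪ Fin A.width ⊕ μ :=
  ⟨Sum.map (slot A.forgery j) id, (slot A.forgery j).injective.sumMap Function.injective_id⟩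

/-- The run of a forger after its first stage, followed by the verification of the `j`-th copy. -/
def Forger.verifyOps (A : Forger μ τ q t) (j : Fin t) :
    List (OracleOp μ τ (Fin A.width ⊕ μ)) :=
  A.ops.map (OracleOp.map Function.Embedding.inl) ++ [OracleOp.backward (tagOut (A.forgeryAux j))]

theorem Forger.length_verifyOps (A : Forger μ τ q t) (j : Fin t) :
    (A.verifyOps j).length = q + A.stage2.length + 1 := by
  simp [Forger.verifyOps, Forger.ops, add_assoc]

variable {Φ : Op μ → Op τ} {Ψ : Op τ → Op μ}

theorem Forger.runOps_verifyOps (A : Forger μ τ q t) (j : Fin t) (hΦ : IsTracePreserving Φ)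
    (hΨ : IsTracePreserving Ψ) (σ : Op (Fin A.width)) :
    runOps Φ Ψ (A.verifyOps j) (adjoinZeros μ σ) =
      call Ψ (tagOut (A.forgeryAux j)) (adjoinZeros μ (A.finish Φ σ)) := by
  rw [Forger.verifyOps, runOps_append, adjoinZeros_eq_extendState,
    runOps_map hΦ hΨ _ indepOf_zerosWeight, A.runOps_ops, ← adjoinZeros_eq_extendState]
  rfl

theorem Forger.reduced_forgeryAux (A : Forger μ τ q t) (j : Fin t) (ω : Op (Fin A.width)) :
    reduced (Function.Embedding.inl.trans (A.forgeryAux j)) (adjoinZeros μ ω) =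
      reduced (slot A.forgery j) ω :=
  reduced_adjoinZeros (slot A.forgery j) ω

/-- A distinguisher that measures the overlap of the forged message with the result of the
verification. -/
theorem Forger.exists_overlap_one (A : Forger μ τ q t) (j : Fin t) {σ : Op (Fin A.width)}
    (hσ : IsDensity σ) : ∃ D : Distinguisher μ τ,
      D.size ≤ A.size + q + 8 * Fintype.card μ + 4 ∧
      ∀ Φ Ψ, IsTracePreserving Φ → IsTracePreserving Ψ → 1 - 2 * D.acceptProb Φ Ψ =
        (overlap 1 Ψ (reduced (slot A.forgery j) (A.finish Φ σ))).re := by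
  obtain ⟨D, hD, hacc⟩ := exists_hadamardTest (A.verifyOps j) (isDensity_adjoinZeros hσ)
    (controlledSwapCircuit (msgOut (A.forgeryAux j))) (swapBits_involutive _).bijective
    (runGates_controlledSwapCircuit _)
  refine ⟨D, ?_, fun Φ Ψ hΦ hΨ => ?_⟩
  · rw [hD, A.length_verifyOps, length_controlledSwapCircuit, Fintype.card_sum, Fintype.card_fin,
      Forger.size]
    omega
  · rw [hacc Φ Ψ hΦ hΨ, A.runOps_verifyOps j hΦ hΨ, sum_call_swapBits hΨ.isLinearMap,
      A.reduced_forgeryAux]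

/-- A distinguisher that measures the overlap of the forged message with the result of the
verification, weighted with a density matrix. -/
theorem Forger.exists_overlap_density (A : Forger μ τ q t) (j : Fin t) {σ : Op (Fin A.width)}
    (hσ : IsDensity σ) {X : Op μ} (hX : IsDensity X) : ∃ D : Distinguisher μ τ,
      D.size ≤ A.size + q + 8 * Fintype.card μ + 4 ∧
      ∀ Φ Ψ, IsTracePreserving Φ → IsTracePreserving Ψ → 1 - 2 * D.acceptProb Φ Ψ =
        (overlap X Ψ (reduced (slot A.forgery j) (A.finish Φ σ))).re := by
  have hC : ∀ ρ, runGates (controlledSwapCircuit (fstAux (msgOut (A.forgeryAux j))) ++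
      controlledSwapCircuit ((msgOut (A.forgeryAux j)).trans Function.Embedding.inl)) ρ =
      ρ.submatrix
        (controlled (swapBits (fstAux (msgOut (A.forgeryAux j))) ∘
          swapBits ((msgOut (A.forgeryAux j)).trans Function.Embedding.inl)))
        (controlled (swapBits (fstAux (msgOut (A.forgeryAux j))) ∘
          swapBits ((msgOut (A.forgeryAux j)).trans Function.Embedding.inl))) := by
    intro ρ
    rw [runGates_append, runGates_controlledSwapCircuit, runGates_controlledSwapCircuit,
      Matrix.submatrix_submatrix]
    congr 1 <;> exact funext fun x => controlled_controlled _ _ x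
  obtain ⟨D, hD, hacc⟩ := exists_hadamardTest
    ((A.verifyOps j).map (OracleOp.map Function.Embedding.inl))
    (isDensity_adjoinState hX (isDensity_adjoinZeros hσ)) _
    ((swapBits_involutive _).bijective.comp (swapBits_involutive _).bijective) hC
  refine ⟨D, ?_, fun Φ Ψ hΦ hΨ => ?_⟩
  · rw [hD, List.length_map, A.length_verifyOps, List.length_append, length_controlledSwapCircuit,
      length_controlledSwapCircuit, Fintype.card_sum, Fintype.card_sum, Fintype.card_fin,
      Forger.size]
    omega
  · rw [hacc Φ Ψ hΦ hΨ, adjoinState, runOps_map hΦ hΨ _ (indepOf_comp_inr X),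
      A.runOps_verifyOps j hΦ hΨ, ← A.reduced_forgeryAux,
      ← sum_adjoinState_call_swapBits hΨ.isLinearMap]
    rfl

end OverlapDistinguishers

/-! ### Reduction to pseudorandomness -/

section Reduction

variable {μ β : Type} [Fintype μ] [DecidableEq μ] [Fintype β] [DecidableEq β] {q t : ℕ}

/-- The advantage of a distinguisher between a uniformly random member of a family of isometries
and a Haar isometry. -/
def advantage {K : Type} [Fintype K] (V : K → Isom μ β) (D : Distinguisher μ (μ ⊕ β)) : ℝ :=
  (∑ k, D.acceptProb (isomChannel (V k)) (inverseChannel (V k))) / Fintype.card K -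
    ∫ U, D.acceptProb (isomChannel (truncate U)) (inverseChannel (truncate U))
      ∂(haarUnitary (μ ⊕ β))

theorem Forger.continuous_overlap (A : Forger μ (μ ⊕ β) q t) (j : Fin t) (σ : Op (Fin A.width))
    (X : Op μ) : Continuous fun U : UGroup (μ ⊕ β) => overlap X (inverseChannel (truncate U))
      (reduced (slot A.forgery j) (A.finish (isomChannel (truncate U)) σ)) :=
  continuous_overlap_inverseChannel X
    ((IsLinearMap.continuous_op (isLinearMap_reduced _)).comp (A.continuous_finish σ))

/-- The quantity `g` is affine in the acceptance probability with slope `-2`, so its keyed and Haar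
means differ by exactly twice the advantage. -/
theorem average_overlap_eq {K : Type} [Fintype K] [Nonempty K] (V : K → Isom μ β)
    (D : Distinguisher μ (μ ⊕ β)) {g : Isom μ β → ℝ}
    (hg : ∀ W, 1 - 2 * D.acceptProb (isomChannel W) (inverseChannel W) = g W)
    (hc : Continuous fun U : UGroup (μ ⊕ β) => g (truncate U)) :
    (∑ k, g (V k)) / Fintype.card K =
      ∫ U, g (truncate U) ∂(haarUnitary (μ ⊕ β)) - 2 * advantage V D := by
  have h1 : ∀ W, D.acceptProb (isomChannel W) (inverseChannel W) = (1 - g W) / 2 := fun W => by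
    rw [← hg]
    ring
  have hK : (Fintype.card K : ℝ) ≠ 0 := by
    simp
  rw [advantage]
  simp only [h1]
  rw [integral_div, integral_sub (integrable_const _) (integrable_of_continuous hc),
    ← Finset.sum_div, Finset.sum_sub_distrib]
  simp
  field_simp
  ring

/-- The winning probability is at most `2 ^ (-t)` plus the mean overlap with weight `1 - P`.
Splitting that weight as `1` minus `P` gives two quantities measurable by distinguishers; their Haar
means recombine into the integral bounded by `Forger.integral_overlap_le`. -/
theorem Forger.exists_distinguishers_of_sends (A : Forger μ (μ ⊕ β) q t) (j : Fin t)
    {K : Type} [Fintype K] [Nonempty K] (V : K → Isom μ β) {ψ : Fin q → Bits μ → ℂ}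
    (hψ : ∀ i, IsKet (ψ i)) {σ : Op (Fin A.width)} (hσ : A.Sends ψ σ)
    (hF : ∀ k, A.finish (isomChannel (V k)) σ ∈ convexHull ℝ {ω | A.Forges ψ ω}) :
    ∃ D₀ D₁ : Distinguisher μ (μ ⊕ β),
      D₀.size ≤ A.size + q + 8 * Fintype.card μ + 4 ∧
      D₁.size ≤ A.size + q + 8 * Fintype.card μ + 4 ∧
      (∑ k, (A.verifyCopies (inverseChannel (V k)) (List.finRange t)
        (adjoinZeros (Fin t × μ) (A.finish (isomChannel (V k)) σ))).trace.re) / Fintype.card K ≤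
      (1 / 2) ^ t + (2 * |advantage V D₀| + 2 * (q * |advantage V D₁|) +
        (q + 1) / 2 ^ Fintype.card μ) := by
  obtain ⟨P, d, hP, hP2, hd, hdq, hfix, hperp⟩ := exists_spanProjection ψ
  let ov : Op μ → Isom μ β → ℝ := fun X W => (overlap X (inverseChannel W)
    (reduced (slot A.forgery j) (A.finish (isomChannel W) σ))).re
  have hcont : ∀ X, Continuous fun U : UGroup (μ ⊕ β) => ov X (truncate U) := fun X =>
    Complex.continuous_re.comp (A.continuous_overlap j σ X)
  have hK : (0 : ℝ) < Fintype.card K := by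
    exact_mod_cast Fintype.card_pos
  obtain ⟨D₀, hD₀, hacc₀⟩ := A.exists_overlap_one j hσ.1
  have h0 := average_overlap_eq V D₀ (g := ov 1) (fun W => hacc₀ _ _
    (isTracePreserving_isomChannel W) (isTracePreserving_inverseChannel W)) (hcont 1)
  obtain ⟨D₁, hD₁, h1⟩ : ∃ D₁ : Distinguisher μ (μ ⊕ β),
      D₁.size ≤ A.size + q + 8 * Fintype.card μ + 4 ∧
      (∑ k, ov P (V k)) / Fintype.card K =
        ∫ U, ov P (truncate U) ∂(haarUnitary (μ ⊕ β)) - 2 * (d * advantage V D₁) := by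
    -- The advice state `P / d` needs `d > 0`. For `d = 0`, which occurs without queries, `P`
    -- vanishes and any distinguisher of the right size will do.
    rcases Nat.eq_zero_or_pos d with rfl | hdpos
    · have hP0 : P = 0 := by
        rw [← Matrix.trace_conjTranspose_mul_self_eq_zero_iff, hP.eq, hP2, hd, Nat.cast_zero]
      have hov : ∀ W, ov P W = 0 := fun W => by
        simp [ov, hP0, overlap]
      refine ⟨D₀, hD₀, ?_⟩
      simp [hov]
    · have hdC : (d : ℂ) ≠ 0 := by
        exact_mod_cast hdpos.ne'
      have hX : IsDensity ((d : ℂ)⁻¹ • P) := by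
        constructor
        · have hpsd : P.PosSemidef := by
            rw [← hP2]
            nth_rewrite 1 [← hP.eq]
            exact Matrix.posSemidef_conjTranspose_mul_self P
          refine hpsd.smul ?_
          rw [← Complex.ofReal_natCast, ← Complex.ofReal_inv, Complex.zero_le_real]
          positivity
        · rw [Matrix.trace_smul, hd, smul_eq_mul, inv_mul_cancel₀ hdC]
      obtain ⟨D₁, hD₁, hacc₁⟩ := A.exists_overlap_density j hσ.1 hX
      refine ⟨D₁, hD₁, ?_⟩
      have hov : ∀ W, ov P W = d * ov ((d : ℂ)⁻¹ • P) W := fun W => by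
        simp only [ov]
        rw [← Complex.re_ofReal_mul, overlap_smul, Complex.ofReal_natCast, ← mul_assoc,
          mul_inv_cancel₀ hdC, one_mul]
      have h := average_overlap_eq V D₁ (g := ov ((d : ℂ)⁻¹ • P)) (fun W => hacc₁ _ _
        (isTracePreserving_isomChannel W) (isTracePreserving_inverseChannel W)) (hcont _)
      simp only [hov]
      rw [← Finset.mul_sum, integral_const_mul, mul_div_assoc, h]
      ring
  refine ⟨D₀, D₁, hD₀, hD₁, ?_⟩
  have hsub : ∀ W, ov (1 - P) W = ov 1 W - ov P W := fun W => by
    simp only [ov, overlap_sub, Complex.sub_re]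
  have hwin : ∀ k, (A.verifyCopies (inverseChannel (V k)) (List.finRange t)
      (adjoinZeros (Fin t × μ) (A.finish (isomChannel (V k)) σ))).trace.re ≤
      (1 / 2) ^ t + ov (1 - P) (V k) := fun k =>
    A.win_le_of_mem_convexHull (V k) hperp j (hF k)
  have hhaar : ∫ U, ov (1 - P) (truncate U) ∂(haarUnitary (μ ⊕ β)) ≤
      (d + 1) / 2 ^ Fintype.card μ := by
    refine le_trans (le_of_eq ?_) (A.integral_overlap_le hψ hσ hP hP2 hd hfix j)
    exact integral_re (integrable_of_continuous (A.continuous_overlap j σ (1 - P)))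
  have havg : (∑ k, (A.verifyCopies (inverseChannel (V k)) (List.finRange t)
      (adjoinZeros (Fin t × μ) (A.finish (isomChannel (V k)) σ))).trace.re) / Fintype.card K ≤
      (1 / 2) ^ t + ((∑ k, ov 1 (V k)) / Fintype.card K -
        (∑ k, ov P (V k)) / Fintype.card K) := by
    rw [← sub_div, ← Finset.sum_sub_distrib, add_div' _ _ _ hK.ne', div_le_div_iff_of_pos_right hK]
    refine (Finset.sum_le_sum fun k _ => hwin k).trans (le_of_eq ?_)
    simp only [hsub, Finset.sum_add_distrib, Finset.sum_const, Finset.card_univ, nsmul_eq_mul]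
    ring
  simp only [hsub] at hhaar
  rw [integral_sub (integrable_of_continuous (hcont 1)) (integrable_of_continuous (hcont P))]
    at hhaar
  have hdq' : (d : ℝ) ≤ q := by
    exact_mod_cast hdq
  have h2 : ((d : ℝ) + 1) / 2 ^ Fintype.card μ ≤ (q + 1) / 2 ^ Fintype.card μ := by
    gcongr
  have h3 : d * advantage V D₁ ≤ q * |advantage V D₁| :=
    (mul_le_mul_of_nonneg_left (le_abs_self _) d.cast_nonneg).trans
      (mul_le_mul_of_nonneg_right hdq' (abs_nonneg _))
  have h4 := neg_abs_le (advantage V D₀)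
  rw [h0, h1] at havg
  linarith

/-- The winning probability of an admissible forger, bounded in terms of the advantages of two
distinguishers. -/
theorem Forger.exists_distinguishers (A : Forger μ (μ ⊕ β) q t) {K : Type} [Fintype K] [Nonempty K]
    (V : K → Isom μ β) (hA : A.Admissible (Set.range fun k => isomChannel (V k))) :
    ∃ D₀ D₁ : Distinguisher μ (μ ⊕ β),
      D₀.size ≤ A.size + q + 8 * Fintype.card μ + 4 ∧
      D₁.size ≤ A.size + q + 8 * Fintype.card μ + 4 ∧
      (∑ k, A.winProb (isomChannel (V k)) (inverseChannel (V k))) / Fintype.card K ≤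
      (1 / 2) ^ t + (2 * |advantage V D₀| + 2 * (q * |advantage V D₁|) +
        (q + 1) / 2 ^ Fintype.card μ) := by
  obtain ⟨N, p, ψ, σ, hp0, hp1, hmix, hψ, hσ, hF⟩ := hA
  have hK : (0 : ℝ) < Fintype.card K := by
    exact_mod_cast Fintype.card_pos
  let X : Fin N → ℝ := fun r => (∑ k, (A.verifyCopies (inverseChannel (V k)) (List.finRange t)
    (adjoinZeros (Fin t × μ) (A.finish (isomChannel (V k)) (σ r)))).trace.re) / Fintype.card K
  have hwin : (∑ k, A.winProb (isomChannel (V k)) (inverseChannel (V k))) / Fintype.card K =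
      ∑ r, p r * X r := by
    -- Everything after the first stage is linear, so the winning probability is the mixture of
    -- those of the branches `σ r`.
    have h1 : ∀ k, A.winProb (isomChannel (V k)) (inverseChannel (V k)) =
        ∑ r, p r * (A.verifyCopies (inverseChannel (V k)) (List.finRange t)
          (adjoinZeros (Fin t × μ) (A.finish (isomChannel (V k)) (σ r)))).trace.re := by
      intro k
      have hfin : IsLinearMap ℂ (A.finish (isomChannel (V k))) :=
        (((isLinearMap_runGates A.stage2).mk' _).comp ((isLinearMap_callSlots
          (isLinearMap_isomChannel (V k)) A.query (List.finRange q)).mk' _)).isLinear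
      have hZ : IsLinearMap ℂ (adjoinZeros (Fin t × μ) : Op (Fin A.width) → _) :=
        isLinearMap_adjoinZeros
      have hver := A.isLinearMap_verifyCopies (isLinearMap_inverseChannel (V k)) (List.finRange t)
      rw [A.winProb_eq, Forger.output, hmix, IsLinearMap.map_sum_op hfin,
        IsLinearMap.map_sum_op hZ, IsLinearMap.map_sum_op hver, Matrix.trace_sum, Complex.re_sum]
      refine Finset.sum_congr rfl fun r _ => ?_
      rw [hfin.map_smul, hZ.map_smul, hver.map_smul, Matrix.trace_smul, smul_eq_mul,
        Complex.re_ofReal_mul]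
    simp only [h1, X, Finset.sum_div, Finset.mul_sum, mul_div_assoc]
    exact Finset.sum_comm
  -- Some branch does at least as well as the average. The distinguishers are non-uniform, so the
  -- state of that branch can be their advice.
  obtain ⟨r, hr⟩ : ∃ r, ∑ r, p r * X r ≤ X r := by
    by_contra! h
    have h1 : ∑ s, p s * X s < ∑ s, p s * ∑ r, p r * X r := by
      refine Finset.sum_lt_sum (fun s _ => mul_le_mul_of_nonneg_left (h s).le (hp0 s)) ?_
      by_contra! h2
      have h3 : ∀ s, p s ≤ 0 := fun s => by
        by_contra! h4
        exact absurd (mul_lt_mul_of_pos_left (h s) h4) (not_lt.mpr (h2 s (Finset.mem_univ s)))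
      have h5 : ∑ s, p s ≤ 0 := Finset.sum_nonpos fun s _ => h3 s
      linarith
    rw [← Finset.sum_mul, hp1, one_mul] at h1
    exact lt_irrefl _ h1
  rw [hwin]
  -- Without copies there is no `j` to test, but then the forger wins with probability `1 = (1 / 2)
  -- ^ 0`; a trivial circuit fills the place of both distinguishers.
  rcases Nat.eq_zero_or_pos t with rfl | ht
  · obtain ⟨D, hD, -⟩ := exists_hadamardTest (α := μ) (β := μ ⊕ β) [] (hσ r).1 [] (F := id)
      Function.bijective_id fun ρ => by
        have h : (controlled id : Bits (Fin A.width ⊕ Unit) → _) = id := by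
          funext x
          simp [controlled]
        rw [h]
        rfl
    have hsize : D.size ≤ A.size + q + 8 * Fintype.card μ + 4 := by
      rw [hD, Forger.size, Fintype.card_fin, List.length_nil, List.length_nil]
      omega
    refine ⟨D, D, hsize, hsize, hr.trans ?_⟩
    have hX : X r = 1 := by
      have h : ∀ k, (A.verifyCopies (inverseChannel (V k)) (List.finRange 0)
          (adjoinZeros (Fin 0 × μ) (A.finish (isomChannel (V k)) (σ r)))).trace.re = 1 := by
        intro k
        change (adjoinZeros (Fin 0 × μ) (A.finish (isomChannel (V k)) (σ r))).trace.re = 1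
        rw [trace_adjoinZeros, (A.isDensity_finish (V k) (hσ r).1).2, Complex.one_re]
      simp only [X, h, Finset.sum_const, Finset.card_univ, nsmul_eq_mul, mul_one]
      exact div_self hK.ne'
    rw [hX, pow_zero, le_add_iff_nonneg_right]
    positivity
  · obtain ⟨D₀, D₁, hD₀, hD₁, h⟩ := A.exists_distinguishers_of_sends ⟨0, ht⟩ V (hψ r) (hσ r)
      fun k => hF r _ ⟨k, rfl⟩
    exact ⟨D₀, D₁, hD₀, hD₁, hr.trans h⟩

end Reduction

/-! ### Polynomial and negligible functions -/

section AsymptoticBounds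

theorem PolyBounded.of_le {f g : ℕ → ℕ} (hg : PolyBounded g) (h : ∀ l, f l ≤ g l) :
    PolyBounded f :=
  hg.imp fun _ hp l => (h l).trans (hp l)

theorem PolyBounded.add {f g : ℕ → ℕ} (hf : PolyBounded f) (hg : PolyBounded g) :
    PolyBounded fun l => f l + g l := by
  obtain ⟨p, hp⟩ := hf
  obtain ⟨r, hr⟩ := hg
  exact ⟨p + r, fun l => by simpa using add_le_add (hp l) (hr l)⟩

theorem PolyBounded.const_mul {f : ℕ → ℕ} (hf : PolyBounded f) (c : ℕ) :
    PolyBounded fun l => c * f l := by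
  obtain ⟨p, hp⟩ := hf
  exact ⟨Polynomial.C c * p, fun l => by simpa using Nat.mul_le_mul_left c (hp l)⟩

theorem polyBounded_const (c : ℕ) : PolyBounded fun _ => c :=
  ⟨Polynomial.C c, fun l => by simp⟩

theorem Negligible.add {f g : ℕ → ℝ} (hf : Negligible f) (hg : Negligible g) :
    Negligible fun l => f l + g l :=
  SuperpolynomialDecay.add hf hg

theorem PolyBounded.negligible_mul {q : ℕ → ℕ} (hq : PolyBounded q) {f : ℕ → ℝ}
    (hf : Negligible f) : Negligible fun l => q l * f l := by
  obtain ⟨p, hp⟩ := hq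
  refine (SuperpolynomialDecay.mul_polynomial hf
    (p.map (Nat.castRingHom ℝ))).trans_abs_le fun l => ?_
  have h : (p.map (Nat.castRingHom ℝ)).eval (l : ℝ) = (p.eval l : ℕ) := by
    simp [Polynomial.eval_natCast_map]
  simp only [abs_mul, h, Nat.abs_cast]
  rw [mul_comm]
  gcongr
  exact_mod_cast hp l

end AsymptoticBounds

end

end QCrypto

/-! ### The theorem -/

theorem mainTheorem9 :
    ∃ c : ℝ, 0 < c ∧
      ∀ n m : ℕ → ℕ, PolyBounded n → PolyBounded m →
        Negligible (fun l => (2 : ℝ) ^ (-(n l : ℝ))) →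
        ∀ (F : ∀ l : ℕ, GenCircuit (Fin l ⊕ Fin (n l)) (Fin (n l) ⊕ Fin (m l)))
          (Inv : ∀ l : ℕ, GenCircuit (Fin l ⊕ (Fin (n l) ⊕ Fin (m l))) (Fin (n l))),
          IsStrongInvertiblePRI n m F Inv →
          ∀ t : ℕ → ℕ, PolyBounded t →
            (priMAC F Inv).ManyCopiesUnforgeable t (fun l => (2 : ℝ) ^ (-(c * (t l : ℝ)))) := by
  -- The chord bound gives exactly `2 ^ (-t)`, hence `c = 1`.
  refine ⟨1, one_pos, fun n m hn _ hneg F Inv hPRI t _ q hq A hA hadm => ?_⟩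
  choose V hV using hPRI.functional
  have hsign : ∀ l k, (priMAC F Inv).signChannel l k = isomChannel (V l k) := fun l k =>
    funext (hV l k).1
  have hver : ∀ l k, (priMAC F Inv).verChannel l k = inverseChannel (V l k) := fun l k =>
    funext (hV l k).2
  have hadm' : ∀ l, (A l).Admissible (Set.range fun k => isomChannel (V l k)) := by
    intro l
    have h : (fun k => isomChannel (V l k)) = (priMAC F Inv).signChannel l :=
      funext fun k => (hsign l k).symm
    rw [h]
    exact hadm l
  choose D₀ D₁ hD₀ hD₁ hwin using fun l => (A l).exists_distinguishers (V l) (hadm' l)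
  have hsize : PolyBounded fun l =>
      (A l).size + q l + 8 * Fintype.card (Fin (n l)) + 4 := by
    simp only [Fintype.card_fin]
    exact ((hA.add hq).add (hn.const_mul 8)).add (polyBounded_const 4)
  have hadv : ∀ D : ∀ l : ℕ, Distinguisher (Fin (n l)) (Fin (n l) ⊕ Fin (m l)),
      (PolyBounded fun l => (D l).size) → Negligible fun l => |advantage (V l) (D l)| := by
    intro D hD
    refine (hPRI.secure D hD).congr fun l => ?_
    have h1 : ∀ k, (fun X => (F l).channel (withKey k X)) = isomChannel (V l k) := hsign l
    have h2 : ∀ k, (fun X => (Inv l).channel (withKey k X)) = inverseChannel (V l k) := hver l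
    simp only [h1, h2, advantage, Fintype.card_fun, Fintype.card_bool, Fintype.card_fin,
      Nat.cast_pow, Nat.cast_ofNat]
  have h0 := hadv D₀ (hsize.of_le hD₀)
  have h1 := hadv D₁ (hsize.of_le hD₁)
  -- The error is `2 |adv₀| + 2 q |adv₁| + (q + 1) 2 ^ (-n)`; each term is a polynomially bounded
  -- factor times a negligible function.
  refine ⟨_, (((polyBounded_const 2).negligible_mul h0).add
    ((hq.const_mul 2).negligible_mul h1)).add
    ((hq.add (polyBounded_const 1)).negligible_mul hneg), fun l => ?_⟩
  have hcard : ((Fintype.card (Bits (Fin l)) : ℕ) : ℝ) = 2 ^ l := by simp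
  have h := hwin l
  simp only [hcard, Fintype.card_fin] at h
  simp only [QMAC.gameProb, hsign, hver]
  refine h.trans (le_of_eq ?_)
  rw [one_mul, Real.rpow_neg (by norm_num), Real.rpow_neg (by norm_num), Real.rpow_natCast,
    Real.rpow_natCast]
  push_cast
  rw [one_div, inv_pow]
  ring
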